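/- Let $r>0$, let $\mathcal M=\{x\in\mathbb R^3:|x|=r\}$ with its surface measure $ds$ and spherical coordinates (colatitude $\theta$, longitude $\phi$), let $\Delta_{\mathrm h}$ be the Laplace–Beltrami operator, $\nabla_{\mathrm h}f$ the surface gradient and $\overrightarrow{\mathrm{curl}}_{\mathrm h}f=\nabla_{\mathrm h}f\times e_r$ the vectorial surface curl on $\mathcal M$, and write $\langle f,g\rangle=\int_{\mathcal M}f\,\overline g\,ds$ (with $f\cdot\overline g$ in place of $f\,\overline g$ for vector fields). For $s\ge 0$ let $H^s(\mathcal M)=\operatorname{dom}\big((I-\Delta_{\mathrm h})^{s/2}\big)\subset L^2(\mathcal M;\mathbb C)$ with norm $\|(I-\Delta_{\mathrm h})^{s/2}f\|_{L^2}$, let $H^2_\diamond(\mathcal M)=\{f\in H^2(\mathcal M):\langle f,1\rangle=0\}$, and let $H^{-2}_\diamond(\mathcal M)$ be the space of bounded conjugate-linear functionals on $H^2_\diamond(\mathcal M)$. Let $\gamma>0$, $\Omega_{\mathrm{ref}}\in\mathbb R$, and let $\Omega\in H^1(\mathcal M)$ be independent of $\phi$, i.e. $\Omega=\Omega(\theta)$.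 Put $\beta_\Omega=\Omega-\Omega_{\mathrm{ref}}$, $\tilde\alpha_\Omega(\theta)=\Omega'(\theta)\sin\theta+2\Omega(\theta)\cos\theta$ and $\alpha_\Omega=\frac{1}{r^2\sin\theta}\frac{d\tilde\alpha_\Omega}{d\theta}$. For $\omega\in\mathbb C$ let $$\mathbf B_\omega\Psi=\gamma\Delta_{\mathrm h}^2\Psi+i\omega\Delta_{\mathrm h}\Psi-\beta_\Omega\Delta_{\mathrm h}\frac{\partial\Psi}{\partial\phi}+\alpha_\Omega\frac{\partial\Psi}{\partial\phi}$$ be understood in the weak sense, that is, $\mathbf B_\omega:H^2_\diamond(\mathcal M)\to H^{-2}_\diamond(\mathcal M)$ is given by $$\langle\mathbf B_\omega\Psi,\psi\rangle=\gamma\langle\Delta_{\mathrm h}\Psi,\Delta_{\mathrm h}\psi\rangle-i\omega\langle\nabla_{\mathrm h}\Psi,\nabla_{\mathrm h}\psi\rangle+\langle\tilde\alpha_\Omega\nabla_{\mathrm h}\Psi,\overrightarrow{\mathrm{curl}}_{\mathrm h}\psi\rangle+\Big\langle\beta_\Omega\Delta_{\mathrm h}\Psi,\frac{\partial\psi}{\partial\phi}\Big\rangle\qquad(\Psi,\psi\in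 H^2_\diamond(\mathcal M)).$$ Then all these integrals converge absolutely and $\mathbf B_\omega$ is a bounded linear operator for every $\omega\in\mathbb C$. Moreover there is a discrete set $\Lambda\subset\mathbb C$ without accumulation points in $\mathbb C$ such that $\mathbf B_\omega:H^2_\diamond(\mathcal M)\to H^{-2}_\diamond(\mathcal M)$ is boundedly invertible for every $\omega\in\mathbb C\setminus\Lambda$, and $\ker\mathbf B_\omega$ is finite-dimensional and nontrivial for every $\omega\in\Lambda$. (The elements of these kernels are called inertial modes.) -/

import Mathlib

open MeasureTheory Topology Filter Set
open scoped ComplexConjugate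

noncomputable section

namespace InertialWaves

/-- The ambient Euclidean space `ℝ³`. -/
abbrev E3 : Type := EuclideanSpace ℝ (Fin 3)

/-- The surface measure `ds` of the sphere `M = {x ∈ ℝ³ : ‖x‖ = r}`, as a measure on `ℝ³` that is
concentrated on `M`: the image of the surface measure of the unit sphere under `s ↦ r s`,
times `r²`. Functions on `M` are functions on `ℝ³`, up to equality `surf r`-almost everywhere. -/
def surf (r : ℝ) : Measure E3 :=
  ENNReal.ofReal (r ^ 2) •
    ((volume : Measure E3).toSphere).map
      (fun s : Metric.sphere (0 : E3) 1 => r • (s : E3))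

instance (r : ℝ) : IsFiniteMeasure (surf r) := by
  unfold surf
  exact Measure.smul_finite _ ENNReal.ofReal_ne_top

theorem ae_surf_ne_zero (r : ℝ) : ∀ᵐ x ∂(surf r), x ≠ 0 := by
  unfold surf
  rcases eq_or_ne r 0 with rfl | hr
  · simp
  · refine Measure.ae_smul_measure ?_ _
    have hm : Measurable fun s : Metric.sphere (0 : E3) 1 => r • (s : E3) :=
      measurable_subtype_coe.const_smul r
    refine (ae_map_iff hm.aemeasurable (measurableSet_singleton (0 : E3)).compl).2 ?_
    refine Filter.Eventually.of_forall fun s => ?_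
    refine smul_ne_zero hr ?_
    intro h
    have := s.2
    rw [h] at this
    simp at this

/-- `L²(M)`, complex valued. -/
abbrev L2 (r : ℝ) : Type := Lp ℂ 2 (surf r)

/-- `L²` vector fields along `M`, with values in `ℂ³`. -/
abbrev L2vec (r : ℝ) : Type := Lp (EuclideanSpace ℂ (Fin 3)) 2 (surf r)

/-- `C^∞(M)`. A smooth function on the sphere is represented by its extension to `ℝ³ \ {0}` that
is constant along rays (its value at the origin is irrelevant). -/
def SmoothFun : Submodule ℂ (E3 → ℂ) where
  carrier := {F | ContDiffOn ℝ (⊤ : ℕ∞) F {0}ᶜ ∧ ∀ t : ℝ, 0 < t → ∀ x, F (t • x) = F x}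
  add_mem' := by
    rintro F G ⟨hF, hF'⟩ ⟨hG, hG'⟩
    exact ⟨hF.add hG, fun t ht x => by simp [hF' t ht x, hG' t ht x]⟩
  zero_mem' := ⟨contDiffOn_const, fun _ _ _ => rfl⟩
  smul_mem' := by
    rintro c F ⟨hF, hF'⟩
    exact ⟨contDiffOn_const.smul hF, fun t ht x => by simp [hF' t ht x]⟩

/-- The Cartesian gradient of a complex valued function on `ℝ³`. At a point of `M`, for a function
that is constant along rays, the radial derivative vanishes and this is the surface gradient
`∇_h F = ∇F - (∂F/∂r) e_r`; likewise the Cartesian Laplacian `Δ F` is then the Laplace-Beltrami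
operator `Δ_h F` of `M`. -/
def grad (F : E3 → ℂ) (x : E3) : EuclideanSpace ℂ (Fin 3) :=
  WithLp.toLp 2 fun i => fderiv ℝ F x (EuclideanSpace.single i 1)

theorem SmoothFun.contDiffAt {F : E3 → ℂ} (hF : F ∈ SmoothFun) {x : E3} (hx : x ≠ 0) :
    ContDiffAt ℝ (⊤ : ℕ∞) F x :=
  hF.1.contDiffAt (isOpen_compl_singleton.mem_nhds hx)

theorem grad_add {F G : E3 → ℂ} {x : E3} (hF : DifferentiableAt ℝ F x)
    (hG : DifferentiableAt ℝ G x) : grad (F + G) x = grad F x + grad G x := by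
  ext i
  simp [grad, fderiv_add hF hG]

theorem grad_smul (c : ℂ) {F : E3 → ℂ} {x : E3} (hF : DifferentiableAt ℝ F x) :
    grad (c • F) x = c • grad F x := by
  ext i
  simp [grad, fderiv_const_smul hF c]

/-- The Hilbert space `L²(M) × L²(M; ℂ³)` of pairs `(f, G)`. -/
abbrev Jet1 (r : ℝ) : Type := WithLp 2 (L2 r × L2vec r)

/-- The Hilbert space `L²(M) × (L²(M; ℂ³) × L²(M))` of triples `(f, G, w)`. -/
abbrev Jet2 (r : ℝ) : Type := WithLp 2 (L2 r × WithLp 2 (L2vec r × L2 r))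

/-- The pairs `(F, ∇_h F)` with `F ∈ C^∞(M)`. -/
def smoothJet1 (r : ℝ) : Submodule ℂ (Jet1 r) where
  carrier := {p | ∃ F ∈ SmoothFun, p.fst =ᵐ[surf r] F ∧ p.snd =ᵐ[surf r] grad F}
  add_mem' := by
    rintro p q ⟨F, hF, h1, h2⟩ ⟨G, hG, k1, k2⟩
    refine ⟨F + G, SmoothFun.add_mem hF hG, ?_, ?_⟩
    · exact (Lp.coeFn_add _ _).trans (h1.add k1)
    · refine (Lp.coeFn_add _ _).trans ?_
      filter_upwards [h2, k2, ae_surf_ne_zero r] with x a b hx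
      change p.snd x + q.snd x = grad (F + G) x
      rw [a, b, grad_add ((SmoothFun.contDiffAt hF hx).differentiableAt (by simp))
        ((SmoothFun.contDiffAt hG hx).differentiableAt (by simp))]
  zero_mem' := by
    refine ⟨0, SmoothFun.zero_mem, Lp.coeFn_zero _ _ _, ?_⟩
    refine (Lp.coeFn_zero _ _ _).trans (Filter.Eventually.of_forall fun x => ?_)
    ext i
    simp [grad]
  smul_mem' := by
    rintro c p ⟨F, hF, h1, h2⟩
    refine ⟨c • F, SmoothFun.smul_mem c hF, ?_, ?_⟩
    · exact (Lp.coeFn_smul _ _).trans (h1.const_smul c)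
    · refine (Lp.coeFn_smul _ _).trans ?_
      filter_upwards [h2, ae_surf_ne_zero r] with x a hx
      change c • p.snd x = grad (c • F) x
      rw [a, grad_smul c ((SmoothFun.contDiffAt hF hx).differentiableAt (by simp))]

/-- The triples `(F, ∇_h F, Δ_h F)` with `F ∈ C^∞(M)`. -/
def smoothJet2 (r : ℝ) : Submodule ℂ (Jet2 r) where
  carrier := {p | ∃ F ∈ SmoothFun, p.fst =ᵐ[surf r] F ∧ p.snd.fst =ᵐ[surf r] grad F ∧
    p.snd.snd =ᵐ[surf r] Laplacian.laplacian F}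
  add_mem' := by
    rintro p q ⟨F, hF, h1, h2, h3⟩ ⟨G, hG, k1, k2, k3⟩
    refine ⟨F + G, SmoothFun.add_mem hF hG, ?_, ?_, ?_⟩
    · exact (Lp.coeFn_add _ _).trans (h1.add k1)
    · refine (Lp.coeFn_add _ _).trans ?_
      filter_upwards [h2, k2, ae_surf_ne_zero r] with x a b hx
      change p.snd.fst x + q.snd.fst x = grad (F + G) x
      rw [a, b, grad_add ((SmoothFun.contDiffAt hF hx).differentiableAt (by simp))
        ((SmoothFun.contDiffAt hG hx).differentiableAt (by simp))]
    · refine (Lp.coeFn_add _ _).trans ?_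
      filter_upwards [h3, k3, ae_surf_ne_zero r] with x a b hx
      change p.snd.snd x + q.snd.snd x = Laplacian.laplacian (F + G) x
      rw [a, b]
      exact (ContDiffAt.laplacian_add
        ((SmoothFun.contDiffAt hF hx).of_le (WithTop.coe_le_coe.2 (le_top : (2 : ℕ∞) ≤ ⊤)))
        ((SmoothFun.contDiffAt hG hx).of_le (WithTop.coe_le_coe.2 (le_top : (2 : ℕ∞) ≤ ⊤)))).symm
  zero_mem' := by
    refine ⟨0, SmoothFun.zero_mem, Lp.coeFn_zero _ _ _, ?_, ?_⟩
    · refine (Lp.coeFn_zero _ _ _).trans (Filter.Eventually.of_forall fun x => ?_)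
      ext i
      simp [grad]
    · refine (Lp.coeFn_zero _ _ _).trans (Filter.Eventually.of_forall fun x => ?_)
      have h : Laplacian.laplacian (0 : E3 → ℂ) x = 0 := by
        exact congrFun (InnerProductSpace.laplacian_const (E := E3) (c := (0 : ℂ))) x
      simp [h]
  smul_mem' := by
    rintro c p ⟨F, hF, h1, h2, h3⟩
    refine ⟨c • F, SmoothFun.smul_mem c hF, ?_, ?_, ?_⟩
    · exact (Lp.coeFn_smul _ _).trans (h1.const_smul c)
    · refine (Lp.coeFn_smul _ _).trans ?_
      filter_upwards [h2, ae_surf_ne_zero r] with x a hx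
      change c • p.snd.fst x = grad (c • F) x
      rw [a, grad_smul c ((SmoothFun.contDiffAt hF hx).differentiableAt (by simp))]
    · refine (Lp.coeFn_smul _ _).trans ?_
      filter_upwards [h3, ae_surf_ne_zero r] with x a hx
      change c • p.snd.snd x = Laplacian.laplacian (c • F) x
      rw [a]
      exact (InnerProductSpace.laplacian_smul c
        ((SmoothFun.contDiffAt hF hx).of_le (WithTop.coe_le_coe.2 (le_top : (2 : ℕ∞) ≤ ⊤)))).symm

/-- The Sobolev space `H¹(M)`: the closure of `C^∞(M)` in the norm
`(‖f‖² + ‖∇_h f‖²)^{1/2} = ‖(I - Δ_h)^{1/2} f‖`, an element being recorded together with its weak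
gradient as the pair `(f, ∇_h f)`. -/
def H1 (r : ℝ) : Submodule ℂ (Jet1 r) := (smoothJet1 r).topologicalClosure

/-- The Sobolev space `H²(M)`, the domain of the self-adjoint Laplace-Beltrami operator: the
closure of `C^∞(M)` in the norm `(‖f‖² + ‖∇_h f‖² + ‖Δ_h f‖²)^{1/2}`, which is equivalent to
`‖(I - Δ_h) f‖`. An element is recorded together with its weak gradient and its weak Laplacian as
the triple `(f, ∇_h f, Δ_h f)`; since `∇_h` and `Δ_h` are closable, `f` determines the triple. -/
def H2 (r : ℝ) : Submodule ℂ (Jet2 r) := (smoothJet2 r).topologicalClosure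

/-- The space `H²_⋄(M)` of the functions in `H²(M)` with zero mean. On it the inherited `H²`-norm
is equivalent to `‖Δ_h f‖`. -/
def Hd2 (r : ℝ) : Submodule ℂ (Jet2 r) where
  carrier := {p | p ∈ H2 r ∧ ∫ x, p.fst x ∂(surf r) = 0}
  add_mem' := by
    rintro p q ⟨hp, hp'⟩ ⟨hq, hq'⟩
    refine ⟨(H2 r).add_mem hp hq, ?_⟩
    have h : ∫ x, (p + q).fst x ∂(surf r) = ∫ x, (p.fst x + q.fst x) ∂(surf r) :=
      integral_congr_ae (Lp.coeFn_add p.fst q.fst)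
    rw [h, integral_add ((Lp.memLp p.fst).integrable one_le_two)
      ((Lp.memLp q.fst).integrable one_le_two), hp', hq', add_zero]
  zero_mem' := by
    refine ⟨(H2 r).zero_mem, ?_⟩
    have h : ∫ x, (0 : Jet2 r).fst x ∂(surf r) = ∫ _, (0 : ℂ) ∂(surf r) :=
      integral_congr_ae (Lp.coeFn_zero ℂ 2 (surf r))
    rw [h, integral_zero]
  smul_mem' := by
    rintro c p ⟨hp, hp'⟩
    refine ⟨(H2 r).smul_mem c hp, ?_⟩
    have h : ∫ x, (c • p).fst x ∂(surf r) = ∫ x, c • p.fst x ∂(surf r) :=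
      integral_congr_ae (Lp.coeFn_smul c p.fst)
    rw [h, integral_smul, hp', smul_zero]

/-- `H^{-2}_⋄(M)`, the dual of `H²_⋄(M)`: bounded conjugate-linear functionals, so that the
duality pairing `⟨g, ψ⟩ = g ψ` is linear in `g`, conjugate-linear in `ψ`, and extends
`⟨g, ψ⟩ = ∫ g conj(ψ) ds`. -/
abbrev Hdm2 (r : ℝ) : Type := Hd2 r →L⋆[ℂ] ℂ

/-- The weak surface gradient `∇_h Ψ`. -/
def gradH {r : ℝ} (Ψ : Hd2 r) : L2vec r := (Ψ : Jet2 r).snd.fst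

/-- The weak Laplace-Beltrami operator `Δ_h Ψ`. -/
def lapH {r : ℝ} (Ψ : Hd2 r) : L2 r := (Ψ : Jet2 r).snd.snd

/-- The rotation by the angle `t` about the `z`-axis. -/
def rotZ (t : ℝ) (x : E3) : E3 :=
  !₂[Real.cos t * x 0 - Real.sin t * x 1, Real.sin t * x 0 + Real.cos t * x 1, x 2]

/-- `Ω ∈ H¹(M; m = 0)`: the function `Ω ∈ H¹(M)` does not depend on the longitude `φ`. -/
def IsAxisymmetric {r : ℝ} (Ω : H1 r) : Prop :=
  ∀ t : ℝ, ∀ᵐ x ∂(surf r), (Ω : Jet1 r).fst (rotZ t x) = (Ω : Jet1 r).fst x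

/-- `cos θ = z / r` at a point of `M`. -/
def cosColat (r : ℝ) (x : E3) : ℝ := x 2 / r

/-- The Cartesian vector `sin θ e_θ = cos θ e_r - e_z` at a point of `M`, where `e_r = x / r`. -/
def sinColatVec (r : ℝ) (x : E3) : E3 :=
  (cosColat r x / r) • x - EuclideanSpace.single 2 1

/-- The derivative `Ω'(θ) sin θ = r ∇_h Ω · (sin θ e_θ)`. -/
def sinMulDeriv {r : ℝ} (Ω : H1 r) (x : E3) : ℂ :=
  r * ∑ i, (Ω : Jet1 r).snd x i * (sinColatVec r x i : ℂ)

/-- `α̃_Ω(θ) = Ω'(θ) sin θ + 2 Ω(θ) cos θ = (1 / sin θ) d/dθ (Ω(θ) sin² θ)`. -/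
def alphaTilde {r : ℝ} (Ω : H1 r) (x : E3) : ℂ :=
  sinMulDeriv Ω x + 2 * (Ω : Jet1 r).fst x * (cosColat r x : ℂ)

/-- `β_Ω(θ) = Ω(θ) - Ω_ref`. -/
def beta {r : ℝ} (Ωref : ℝ) (Ω : H1 r) (x : E3) : ℂ := (Ω : Jet1 r).fst x - (Ωref : ℂ)

/-- The longitudinal derivative `∂ψ/∂φ = (e_z × x) · ∇_h ψ`. -/
def dPhi {r : ℝ} (ψ : Hd2 r) (x : E3) : ℂ :=
  (x 0 : ℂ) * gradH ψ x 1 - (x 1 : ℂ) * gradH ψ x 0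

/-- The vectorial surface curl `Curl ψ = ∇_h ψ × e_r`, `e_r = x / r`. -/
def vCurl {r : ℝ} (ψ : Hd2 r) (x : E3) : EuclideanSpace ℂ (Fin 3) :=
  (r : ℂ)⁻¹ • !₂[gradH ψ x 1 * x 2 - gradH ψ x 2 * x 1,
    gradH ψ x 2 * x 0 - gradH ψ x 0 * x 2,
    gradH ψ x 0 * x 1 - gradH ψ x 1 * x 0]

/-- The integrand `α̃_Ω ∇_h Ψ · conj (Curl ψ)`. -/
def alphaIntegrand {r : ℝ} (Ω : H1 r) (Ψ ψ : Hd2 r) (x : E3) : ℂ :=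
  alphaTilde Ω x * ∑ i, gradH Ψ x i * conj (vCurl ψ x i)

/-- The integrand `β_Ω Δ_h Ψ conj (∂ψ/∂φ)`. -/
def betaIntegrand {r : ℝ} (Ωref : ℝ) (Ω : H1 r) (Ψ ψ : Hd2 r) (x : E3) : ℂ :=
  beta Ωref Ω x * lapH Ψ x * conj (dPhi ψ x)

/-- The sesquilinear form
`A_ω[Ψ, ψ] = γ ⟨Δ_h Ψ, Δ_h ψ⟩ - i ω ⟨∇_h Ψ, ∇_h ψ⟩ + ⟨α̃_Ω ∇_h Ψ, Curl ψ⟩ + ⟨β_Ω Δ_h Ψ, ∂ψ/∂φ⟩`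
with `⟨f, g⟩ = ∫ f conj(g) ds`; Mathlib's `inner` is conjugate-linear in its first argument. -/
def formA {r : ℝ} (γ Ωref : ℝ) (Ω : H1 r) (ω : ℂ) (Ψ ψ : Hd2 r) : ℂ :=
  γ * inner ℂ (lapH ψ) (lapH Ψ) - Complex.I * ω * inner ℂ (gradH ψ) (gradH Ψ)
    + ∫ x, alphaIntegrand Ω Ψ ψ x ∂(surf r)
    + ∫ x, betaIntegrand Ωref Ω Ψ ψ x ∂(surf r)

/-- `B : H²_⋄(M) → H^{-2}_⋄(M)` is the operator
`γ Δ_h² + i ω Δ_h - β_Ω Δ_h ∂/∂φ + α_Ω ∂/∂φ`, `α_Ω = (1 / (r² sin θ)) dα̃_Ω/dθ`, in its weak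
form: `⟨B Ψ, ψ⟩ = A_ω[Ψ, ψ]` for all `Ψ, ψ ∈ H²_⋄(M)`, all integrals being absolutely convergent.
There is at most one such `B`. -/
def IsInertialWaveOperator {r : ℝ} (γ Ωref : ℝ) (Ω : H1 r) (ω : ℂ) (B : Hd2 r →L[ℂ] Hdm2 r) :
    Prop :=
  ∀ Ψ ψ : Hd2 r,
    Integrable (alphaIntegrand Ω Ψ ψ) (surf r) ∧
    Integrable (betaIntegrand Ωref Ω Ψ ψ) (surf r) ∧
    B Ψ ψ = formA γ Ωref Ω ω Ψ ψ

theorem IsInertialWaveOperator.unique {r γ Ωref : ℝ} {Ω : H1 r} {ω : ℂ}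
    {B B' : Hd2 r →L[ℂ] Hdm2 r} (hB : IsInertialWaveOperator γ Ωref Ω ω B)
    (hB' : IsInertialWaveOperator γ Ωref Ω ω B') : B = B' := by
  ext Ψ ψ
  rw [(hB Ψ ψ).2.2, (hB' Ψ ψ).2.2]

end InertialWaves

end

/-! The family is affine in ω: after the Riesz identification of bounded conjugate-linear
functionals with vectors, B_ω = B_0 - iω G†G, where G = ∇_h maps H²_⋄ to L². Suppose G is compact
and Re B_0[Ψ,Ψ] + μ‖GΨ‖² ≥ c‖Ψ‖² with c > 0. Then P = B_0 + μ G†G is invertible by Lax–Milgram, S =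
P⁻¹G†G is compact, and B_ω = P(1 - (μ + iω)S). Hence B_ω is singular exactly when 1/(μ + iω) is an
eigenvalue of S. Riesz theory for the compact, in general not self-adjoint, operator S gives
finite-dimensional kernels and only finitely many singular ω in each bounded region. This is
`exists_discrete_spectrum`; the rest supplies its hypotheses.

The coercivity estimate is `exists_garding`. Since Ω lies only in H¹, the coefficient α̃ is merely
in L² and β in L⁶ ⊂ L⁴, so the zonal-flow terms are controlled by Hölder's inequality with ∇Ψ in L⁴.
Interpolating L⁴ between L² and L⁶ and using ‖∇Ψ‖₆ ≤ C‖Ψ‖ yields ‖∇Ψ‖₄⁴ ≤ K‖∇Ψ‖₂‖Ψ‖³. The positive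
power of ‖∇Ψ‖₂ on the right allows these terms to be absorbed into γ‖ΔΨ‖² at the cost of a multiple
of ‖∇Ψ‖₂².

The Sobolev theory of the sphere is obtained without charts. A function on the sphere is a function
on ℝ³ ∖ {0} that is constant along rays; multiplied by a radial cutoff it becomes a test function,
and polar coordinates compare the L^p norms. In this way the embedding of exponent 2 into exponent
6, the identity ‖D²u‖₂ = ‖Δu‖₂ and the inequality ‖∇u‖₂² ≤ ‖u‖₂‖Δu‖₂ on ℝ³ descend to the sphere.
The Poincaré inequality on convex sets, applied to the unit ball, gives the Poincaré inequality on
the sphere; applied to the cells of a fine grid it gives Rellich's theorem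
(`isCompactOperator_fstL`). With the interpolation inequality, compactness of H²_⋄ → L² improves to
compactness of ∇_h (`isCompactOperator_gradL`). Estimates are proved for smooth functions and pass
to the closures by closedness. -/

noncomputable section

namespace InertialWaves

/-! ### Compact operators, Lax–Milgram and the abstract spectral alternative -/

section Abstract

variable {V X Y : Type*} [NormedAddCommGroup V] [InnerProductSpace ℂ V]
  [NormedAddCommGroup X] [InnerProductSpace ℂ X]

/-- A compact operator has only finitely many eigenvalues outside a ball around zero. -/
theorem finite_eigenvalues_of_isCompactOperator {S : V →L[ℂ] V} (hS : IsCompactOperator S)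
    {δ : ℝ} (hδ : 0 < δ) :
    {l : ℂ | Module.End.HasEigenvalue (S : Module.End ℂ V) l ∧ δ ≤ ‖l‖}.Finite := by
  by_contra hinf
  replace hinf : Set.Infinite _ := hinf
  set g := hinf.natEmbedding
  have hg : ∀ n, Module.End.HasEigenvalue (S : Module.End ℂ V) (g n : ℂ) ∧ δ ≤ ‖(g n : ℂ)‖ :=
    fun n => (g n).2
  choose v hv using fun n => (hg n).1.exists_hasEigenvector
  have hli : LinearIndependent ℂ v :=
    Module.End.eigenvectors_linearIndependent' (S : Module.End ℂ V) (fun n => (g n : ℂ))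
      (fun a b h => g.injective (Subtype.ext h)) v hv
  set e := InnerProductSpace.gramSchmidtNormed ℂ v
  have he : Orthonormal ℂ e := InnerProductSpace.gramSchmidtNormed_orthonormal hli
  have hspanIio : ∀ n, Submodule.span ℂ (e '' Set.Iio n) = Submodule.span ℂ (v '' Set.Iio n) :=
    fun n => (InnerProductSpace.span_gramSchmidtNormed _ _).trans
      (InnerProductSpace.span_gramSchmidt_Iio ℂ v n)
  have hspanIic : ∀ n, Submodule.span ℂ (e '' Set.Iic n) = Submodule.span ℂ (v '' Set.Iic n) :=
    fun n => (InnerProductSpace.span_gramSchmidtNormed _ _).trans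
      (InnerProductSpace.span_gramSchmidt_Iic ℂ v n)
  have hSv : ∀ n, S (v n) = (g n : ℂ) • v n := fun n => (hv n).apply_eq_smul
  have horth : ∀ n, ∀ x ∈ Submodule.span ℂ (v '' Set.Iio n), inner ℂ (e n) x = 0 := by
    intro n x hx
    rw [← hspanIio] at hx
    induction hx using Submodule.span_induction with
    | mem x hx =>
      obtain ⟨m, hm, rfl⟩ := hx
      exact he.2 (ne_of_gt hm)
    | zero => simp
    | add x y _ _ hx hy => rw [inner_add_right, hx, hy, add_zero]
    | smul a x _ hx => rw [inner_smul_right, hx, mul_zero]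
  have hmaps : ∀ n, ∀ x ∈ Submodule.span ℂ (v '' Set.Iic n),
      S x ∈ Submodule.span ℂ (v '' Set.Iic n) := by
    intro n x hx
    induction hx using Submodule.span_induction with
    | mem x hx =>
      obtain ⟨m, hm, rfl⟩ := hx
      rw [hSv]
      exact Submodule.smul_mem _ _ (Submodule.subset_span ⟨m, hm, rfl⟩)
    | zero => simp
    | add x y _ _ hx hy => rw [map_add]; exact Submodule.add_mem _ hx hy
    | smul a x _ hx => rw [map_smul]; exact Submodule.smul_mem _ _ hx
  -- S is upper triangular in the flag spanned by the eigenvectors, with the eigenvalues on the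
  -- diagonal: S - l_n lowers the n-th space by one step.
  have hlow : ∀ n, ∀ x ∈ Submodule.span ℂ (v '' Set.Iic n),
      S x - (g n : ℂ) • x ∈ Submodule.span ℂ (v '' Set.Iio n) := by
    intro n x hx
    induction hx using Submodule.span_induction with
    | mem x hx =>
      obtain ⟨m, hm, rfl⟩ := hx
      rw [hSv, ← sub_smul]
      rcases eq_or_lt_of_le (show m ≤ n from hm) with rfl | h
      · simp
      · exact Submodule.smul_mem _ _ (Submodule.subset_span ⟨m, h, rfl⟩)
    | zero => simp
    | add x y _ _ hx hy =>
      rw [map_add, smul_add, add_sub_add_comm]; exact Submodule.add_mem _ hx hy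
    | smul a x _ hx =>
      rw [map_smul, smul_comm, ← smul_sub]; exact Submodule.smul_mem _ _ hx
  have hemem : ∀ n, e n ∈ Submodule.span ℂ (v '' Set.Iic n) := fun n => by
    rw [← hspanIic]; exact Submodule.subset_span ⟨n, Set.mem_Iic.2 le_rfl, rfl⟩
  -- Testing against e_n isolates the diagonal entry l_n, because S e_m stays in an earlier space of
  -- the flag. The images S e_n are thus δ-separated, which no compact operator allows on an
  -- orthonormal sequence.
  have hdist : ∀ m n, m < n → δ ≤ ‖S (e n) - S (e m)‖ := by
    intro m n hmn
    have h1 : inner ℂ (e n) (S (e n)) = (g n : ℂ) := by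
      have := horth n _ (hlow n _ (hemem n))
      rw [inner_sub_right, inner_smul_right, inner_self_eq_norm_sq_to_K, he.1 n] at this
      simpa [sub_eq_zero] using this
    have h2 : inner ℂ (e n) (S (e m)) = 0 := by
      refine horth n _ (Submodule.span_mono ?_ (hmaps m _ (hemem m)))
      exact Set.image_mono fun k hk => lt_of_le_of_lt hk hmn
    calc δ ≤ ‖(g n : ℂ)‖ := (hg n).2
      _ = ‖inner ℂ (e n) (S (e n) - S (e m))‖ := by rw [inner_sub_right, h1, h2, sub_zero]
      _ ≤ ‖e n‖ * ‖S (e n) - S (e m)‖ := norm_inner_le_norm _ _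
      _ = _ := by rw [he.1 n, one_mul]
  obtain ⟨K, hK, hKS⟩ := hS.image_closedBall_subset_compact (f := (S : V →ₗ[ℂ] V)) 1
  obtain ⟨a, -, φ, hφ, ha⟩ := hK.tendsto_subseq (x := fun n => S (e n))
    (fun n => hKS ⟨e n, by simp [he.1 n], rfl⟩)
  obtain ⟨N, hN⟩ := Metric.cauchySeq_iff'.1 ha.cauchySeq δ hδ
  have h1 := hN (N + 1) (Nat.le_succ N)
  have h2 := hdist _ _ (hφ (Nat.lt_succ_self N))
  rw [dist_eq_norm] at h1
  exact absurd h1 (not_lt.2 h2)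

/-- The eigenspaces of a compact operator for nonzero eigenvalues are finite-dimensional. -/
theorem finiteDimensional_eigenspace_of_isCompactOperator {S : V →L[ℂ] V}
    (hS : IsCompactOperator S) {l : ℂ} (hl : l ≠ 0) :
    FiniteDimensional ℂ (Module.End.eigenspace (S : Module.End ℂ V) l) := by
  have hcl : IsClosed (Module.End.eigenspace (S : Module.End ℂ V) l : Set V) := by
    have : (Module.End.eigenspace (S : Module.End ℂ V) l : Set V) = {v | S v = l • v} := by
      ext v; exact Module.End.mem_eigenspace_iff
    rw [this]
    exact isClosed_eq S.continuous (continuous_const_smul l)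
  have hmem : ∀ v ∈ Module.End.eigenspace (S : Module.End ℂ V) l,
      (S : Module.End ℂ V) v ∈ Module.End.eigenspace (S : Module.End ℂ V) l := fun v hv => by
    rw [Module.End.mem_eigenspace_iff.1 hv]; exact Submodule.smul_mem _ _ hv
  -- On the eigenspace, l⁻¹S is the identity, and a compact identity forces finite dimension.
  have h1 := (IsCompactOperator.restrict (f := (S : V →ₗ[ℂ] V)) hS hmem hcl).smul l⁻¹
  refine FiniteDimensional.of_isCompactOperator_id (𝕜 := ℂ) ?_
  refine (congrArg IsCompactOperator (funext fun v => Subtype.ext ?_)).mp h1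
  have : (S : Module.End ℂ V) (v : V) = l • (v : V) := Module.End.mem_eigenspace_iff.1 v.2
  simp [this, hl]

/-- An operator that is dominated, up to an arbitrarily small multiple of the norm, by compact
operators is compact. -/
theorem isCompactOperator_of_norm_le {V X : Type*} [NormedAddCommGroup V] [NormedSpace ℂ V]
    [NormedAddCommGroup X] [NormedSpace ℂ X] [CompleteSpace X] {G : V →L[ℂ] X}
    (h : ∀ ε : ℝ, 0 < ε → ∃ (Y : Type) (_ : NormedAddCommGroup Y) (_ : NormedSpace ℂ Y)
      (K : V →L[ℂ] Y), IsCompactOperator K ∧ ∀ v, ‖G v‖ ≤ ε * ‖v‖ + ‖K v‖) :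
    IsCompactOperator G := by
  rw [show (G : V → X) = (G : V →ₗ[ℂ] X) from rfl,
    isCompactOperator_iff_isCompact_closure_image_closedBall (G : V →ₗ[ℂ] X) zero_lt_one]
  refine isCompact_iff_totallyBounded_isComplete.2 ⟨TotallyBounded.closure ?_, isClosed_closure.isComplete⟩
  rw [Metric.totallyBounded_iff]
  intro ε hε
  -- Pull an ε/4-net of K(ball) back to the ball. Two points of the ball differ by norm at most 2,
  -- so the error under G is below 2·ε/4 + ε/4 < ε.
  obtain ⟨Y, _, _, K, hK, hKG⟩ := h (ε / 4) (by positivity)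
  obtain ⟨Q, hQ, hQK⟩ := hK.image_closedBall_subset_compact (f := (K : V →ₗ[ℂ] Y)) 1
  obtain ⟨t, hts, htf, ht⟩ := totallyBounded_iff_subset.1 (hQ.totallyBounded.subset hQK) _
    (Metric.dist_mem_uniformity (show 0 < ε / 4 by positivity))
  have hts' : ∀ y, ∃ v, y ∈ t → v ∈ Metric.closedBall (0 : V) 1 ∧ K v = y := fun y => by
    by_cases hy : y ∈ t
    · obtain ⟨v, hv⟩ := hts hy
      exact ⟨v, fun _ => hv⟩
    · exact ⟨0, fun h => absurd h hy⟩
  choose p hp using hts'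
  refine ⟨(fun y => G (p y)) '' t, htf.image _, ?_⟩
  rintro _ ⟨v, hv, rfl⟩
  obtain ⟨y, hy, hvy⟩ := mem_iUnion₂.1 (ht ⟨v, hv, rfl⟩)
  refine mem_iUnion₂.2 ⟨_, ⟨y, hy, rfl⟩, ?_⟩
  have h1 : dist (K v) (K (p y)) < ε / 4 := by
    rw [show K (p y) = y from (hp y hy).2]; exact hvy
  rw [Metric.mem_ball, dist_eq_norm]
  change ‖G v - G (p y)‖ < ε
  rw [dist_eq_norm, ← map_sub] at h1
  rw [← map_sub]
  have h2 : ‖v - p y‖ ≤ 2 := by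
    have h3 := norm_sub_le v (p y)
    have h4 := mem_closedBall_zero_iff.1 hv
    have h5 := mem_closedBall_zero_iff.1 (hp y hy).1
    linarith
  have h6 := hKG (v - p y)
  nlinarith

/-- A coercive operator on a Hilbert space is invertible. -/
theorem isInvertible_of_coercive [CompleteSpace V] {P : V →L[ℂ] V} {c : ℝ} (hc : 0 < c)
    (h : ∀ v, c * ‖v‖ ^ 2 ≤ (inner ℂ v (P v)).re) : P.IsInvertible := by
  have hb : ∀ v, c * ‖v‖ ≤ ‖P v‖ := by
    intro v
    rcases eq_or_ne v 0 with rfl | hv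
    · simp
    have h1 : c * ‖v‖ ^ 2 ≤ ‖v‖ * ‖P v‖ :=
      (h v).trans ((Complex.re_le_norm _).trans (norm_inner_le_norm _ _))
    have h2 : 0 < ‖v‖ := norm_pos_iff.2 hv
    nlinarith
  have hanti : AntilipschitzWith (c⁻¹).toNNReal P := by
    refine P.antilipschitz_of_bound fun v => ?_
    rw [Real.coe_toNNReal _ (inv_nonneg.2 hc.le), inv_mul_eq_div, le_div_iff₀ hc, mul_comm]
    exact hb v
  have hker : P.ker = ⊥ := LinearMap.ker_eq_bot.2 hanti.injective
  have hcl : IsClosed (P.range : Set V) := hanti.isClosed_range P.uniformContinuous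
  -- The range is closed because P is bounded below. A vector w orthogonal to it satisfies ⟨w, P w⟩
  -- = 0, so coercivity kills it.
  have hrange : P.range = ⊤ := by
    have := hcl.completeSpace_coe
    rw [← P.range.orthogonal_orthogonal, Submodule.eq_top_iff']
    intro v w hw
    have h0 : inner ℂ w (P w) = 0 := by
      have := hw (P w) ⟨w, rfl⟩
      rw [← inner_conj_symm, this, map_zero]
    have h1 := h w
    rw [h0, Complex.zero_re] at h1
    have h2 : w = 0 := by
      have : ‖w‖ ^ 2 ≤ 0 := by nlinarith
      exact norm_eq_zero.1 (pow_eq_zero_iff two_ne_zero |>.1 (le_antisymm this (sq_nonneg _)))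
    simp [h2]
  exact ⟨ContinuousLinearEquiv.ofBijective P hker hrange, rfl⟩

/-- The Riesz isomorphism onto the space of bounded conjugate-linear functionals. -/
theorem isInvertible_innerSLFlip [CompleteSpace V] :
    (innerSLFlip ℂ : V →L[ℂ] V →L⋆[ℂ] ℂ).IsInvertible := by
  refine ⟨ContinuousLinearEquiv.ofBijective (innerSLFlip ℂ : V →L[ℂ] V →L⋆[ℂ] ℂ) ?_ ?_, rfl⟩
  · rw [LinearMap.ker_eq_bot']
    intro v hv
    have := congrArg (fun φ : V →L⋆[ℂ] ℂ => φ v) hv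
    simpa using this
  · rw [LinearMap.range_eq_top]
    intro φ
    -- Conjugating φ makes it linear, so that the usual Riesz representation applies.
    refine ⟨(InnerProductSpace.toDual ℂ V).symm
      (((starL ℂ : ℂ ≃L⋆[ℂ] ℂ) : ℂ →L⋆[ℂ] ℂ).comp φ), ?_⟩
    ext w
    change inner ℂ w _ = φ w
    rw [← inner_conj_symm, InnerProductSpace.toDual_symm_apply]
    simp

/-- The spectral alternative for the family `A - i ω G† G`, where `G` is compact and
`A + μ G† G` is coercive. -/
theorem exists_discrete_spectrum [CompleteSpace V] [CompleteSpace X]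
    (A : V →L[ℂ] V →L⋆[ℂ] ℂ) (G : V →L[ℂ] X) (hG : IsCompactOperator G) {c μ : ℝ} (hc : 0 < c)
    (hA : ∀ v, c * ‖v‖ ^ 2 ≤ (A v v).re + μ * ‖G v‖ ^ 2)
    (B : ℂ → V →L[ℂ] V →L⋆[ℂ] ℂ)
    (hB : ∀ ω v w, B ω v w = A v w - Complex.I * ω * inner ℂ (G w) (G v)) :
    ∃ Λ : Set ℂ, IsDiscrete Λ ∧ (∀ z : ℂ, ¬ AccPt z (Filter.principal Λ)) ∧
        (∀ ω : ℂ, ω ∉ Λ → (B ω).IsInvertible) ∧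
        (∀ ω ∈ Λ, FiniteDimensional ℂ ((B ω).ker) ∧ (B ω).ker ≠ ⊥) := by
  obtain ⟨R, hR⟩ := isInvertible_innerSLFlip (V := V)
  have hRapp : ∀ v w, R v w = inner ℂ w v := fun v w => by
    change (R : V →L[ℂ] V →L⋆[ℂ] ℂ) v w = _
    rw [hR]; rfl
  set K : V →L[ℂ] V := (ContinuousLinearMap.adjoint G).comp G with hK
  have hKc : IsCompactOperator K := hG.clm_comp (ContinuousLinearMap.adjoint G)
  have hKapp : ∀ v w, inner ℂ w (K v) = inner ℂ (G w) (G v) := fun v w => by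
    simp [hK, ContinuousLinearMap.adjoint_inner_right]
  set P : V →L[ℂ] V := ((R.symm : _ →L[ℂ] V).comp A) + (μ : ℂ) • K with hP
  have hPapp : ∀ v w, inner ℂ w (P v) = A v w + μ * inner ℂ (G w) (G v) := fun v w => by
    rw [hP]
    simp only [add_apply, smul_apply, inner_add_right,
      inner_smul_right, hKapp, ContinuousLinearMap.comp_apply]
    rw [← hRapp]
    simp
  obtain ⟨Q, hQ⟩ : P.IsInvertible := by
    refine isInvertible_of_coercive hc fun v => (hA v).trans (le_of_eq ?_)
    rw [hPapp, inner_self_eq_norm_sq_to_K]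
    simp [← Complex.ofReal_pow]
  have hQapp : ∀ v, Q v = P v := fun v => by rw [← hQ]; rfl
  set S : V →L[ℂ] V := (Q.symm : V →L[ℂ] V).comp K with hS
  have hSc : IsCompactOperator S := hKc.clm_comp (Q.symm : V →L[ℂ] V)
  have hQS : ∀ v, Q (S v) = K v := fun v => by simp [hS]
  -- The μ-term added to make P coercive is subtracted again here, which turns the spectral
  -- parameter into μ + iω.
  have hfac : ∀ ω v, B ω v = R (Q (v - (μ + Complex.I * ω) • S v)) := by
    intro ω v
    ext w
    rw [hRapp, map_sub, map_smul, hQS, inner_sub_right, inner_smul_right, hQapp, hPapp, hKapp, hB]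
    ring
  have hker : ∀ ω v, B ω v = 0 ↔ v = ((μ : ℂ) + Complex.I * ω) • S v := by
    intro ω v
    rw [hfac, map_eq_zero_iff R R.injective, map_eq_zero_iff Q Q.injective, sub_eq_zero]
  -- The condition μ + iω ≠ 0 is needed because inversion sends 0 to 0, and 0 may be an eigenvalue
  -- of S; at μ + iω = 0 the operator is R Q, which is invertible.
  set Λ : Set ℂ := {ω | (μ : ℂ) + Complex.I * ω ≠ 0 ∧
    Module.End.HasEigenvalue (S : Module.End ℂ V) ((μ : ℂ) + Complex.I * ω)⁻¹} with hΛ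
  have hacc : ∀ z : ℂ, ¬ AccPt z (Filter.principal Λ) := by
    intro z hz
    have hfin : (Metric.ball z 1 ∩ Λ).Finite := by
      -- For ω in the unit ball about z one has |μ + iω| ≤ |μ| + ‖z‖ + 1, so the corresponding
      -- eigenvalues of S stay away from 0 and are finite in number.
      have h1 := finite_eigenvalues_of_isCompactOperator hSc
        (show 0 < (|μ| + ‖z‖ + 1)⁻¹ by positivity)
      refine Set.Finite.of_finite_image (f := fun ω => ((μ : ℂ) + Complex.I * ω)⁻¹)
        (h1.subset ?_) ?_
      · rintro _ ⟨ω, ⟨hω, hne, hev⟩, rfl⟩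
        refine ⟨hev, ?_⟩
        change _ ≤ ‖((μ : ℂ) + Complex.I * ω)⁻¹‖
        rw [norm_inv]
        refine inv_anti₀ (norm_pos_iff.2 hne) ?_
        refine (norm_add_le _ _).trans ?_
        rw [norm_mul, Complex.norm_I, one_mul, Complex.norm_real, Real.norm_eq_abs]
        have h2 : ‖ω‖ ≤ ‖z‖ + 1 := by
          have := norm_sub_norm_le ω z
          rw [mem_ball_iff_norm] at hω
          linarith
        linarith
      · intro a _ b _ hab
        simpa using hab
    have h3 : ((Metric.ball z 1 ∩ Λ) \ {z})ᶜ ∈ 𝓝 z :=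
      (hfin.subset sdiff_subset).isClosed.isOpen_compl.mem_nhds (by simp)
    rw [accPt_iff_nhds] at hz
    obtain ⟨y, ⟨⟨hy1, hy2⟩, hy3⟩, hy4⟩ := hz _ (Filter.inter_mem h3 (Metric.ball_mem_nhds z one_pos))
    exact hy1 ⟨⟨hy2, hy3⟩, hy4⟩
  refine ⟨Λ, ?_, hacc, ?_, ?_⟩
  · refine isDiscrete_iff_nhdsNE.2 fun x _ => ?_
    by_contra hne
    exact hacc x ⟨hne⟩
  · intro ω hω
    -- Fredholm alternative: outside Λ the number (μ + iω)⁻¹ is not an eigenvalue, hence lies in the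
    -- resolvent set of the compact operator S.
    have hu : IsUnit ((1 : V →L[ℂ] V) - ((μ : ℂ) + Complex.I * ω) • S) := by
      rcases eq_or_ne ((μ : ℂ) + Complex.I * ω) 0 with h0 | h0
      · simp [h0]
      · have := (hSc.hasEigenvalue_or_mem_resolventSet (inv_ne_zero h0)).resolve_left
          (fun h => hω ⟨h0, h⟩)
        rw [spectrum.mem_resolventSet_iff] at this
        have h1 := this.smul (Units.mk0 _ h0)
        have h2 : Units.mk0 _ h0 •
            ((algebraMap ℂ (V →L[ℂ] V)) ((μ : ℂ) + Complex.I * ω)⁻¹ - S) =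
            (1 : V →L[ℂ] V) - ((μ : ℂ) + Complex.I * ω) • S := by
          rw [Units.smul_mk0, smul_sub, Algebra.algebraMap_eq_smul_one, smul_inv_smul₀ h0]
        rwa [h2] at h1
    obtain ⟨u, hu⟩ := hu
    refine ⟨((ContinuousLinearEquiv.unitsEquiv ℂ V u).trans Q).trans R, ?_⟩
    ext v w
    rw [hfac]
    change R (Q ((u : V →L[ℂ] V) v)) w = _
    rw [hu]
    rfl
  · rintro ω ⟨h0, hev⟩
    have heq : (B ω).ker = Module.End.eigenspace (S : Module.End ℂ V)
        ((μ : ℂ) + Complex.I * ω)⁻¹ := by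
      ext v
      rw [LinearMap.mem_ker, Module.End.mem_eigenspace_iff]
      refine (hker ω v).trans ?_
      change _ ↔ S v = _
      constructor
      · intro h; rw [eq_inv_smul_iff₀ h0]; exact h.symm
      · intro h; rw [h, smul_inv_smul₀ h0]
    rw [heq]
    exact ⟨finiteDimensional_eigenspace_of_isCompactOperator hSc (inv_ne_zero h0), hev⟩

end Abstract

/-! ### Calculus and Sobolev inequalities for test functions on ℝ³ -/

section Euclidean

/-- The partial derivative `∂ᵢ u`. -/
def pd (i : Fin 3) (u : E3 → ℂ) (x : E3) : ℂ := fderiv ℝ u x (EuclideanSpace.single i 1)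

theorem contDiff_pd {u : E3 → ℂ} (hu : ContDiff ℝ (⊤ : ℕ∞) u) (i : Fin 3) :
    ContDiff ℝ (⊤ : ℕ∞) (pd i u) :=
  (hu.fderiv_right (m := (⊤ : ℕ∞)) (by simp)).clm_apply contDiff_const

theorem hasCompactSupport_pd {u : E3 → ℂ} (hu : HasCompactSupport u) (i : Fin 3) :
    HasCompactSupport (pd i u) :=
  hu.fderiv_apply ℝ _

theorem pd_pd_eq {u : E3 → ℂ} {x : E3} (hu : ContDiffAt ℝ 2 u x) (i j : Fin 3) :
    pd i (pd j u) x =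
      fderiv ℝ (fderiv ℝ u) x (EuclideanSpace.single i 1) (EuclideanSpace.single j 1) := by
  have h : DifferentiableAt ℝ (fderiv ℝ u) x :=
    (hu.fderiv_right (m := 1) (by norm_num)).differentiableAt (by norm_num)
  unfold pd
  rw [fderiv_clm_apply h (by fun_prop)]
  simp

theorem pd_comm {u : E3 → ℂ} (hu : ContDiff ℝ (⊤ : ℕ∞) u) (i j : Fin 3) :
    pd i (pd j u) = pd j (pd i u) := by
  ext x
  have h : ContDiffAt ℝ 2 u x := hu.contDiffAt.of_le (WithTop.coe_le_coe.2 (le_top : (2 : ℕ∞) ≤ ⊤))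
  rw [pd_pd_eq h, pd_pd_eq h]
  exact (h.isSymmSndFDerivAt (by simp)).eq _ _

theorem laplacian_eq_sum_pd {u : E3 → ℂ} {x : E3} (hu : ContDiffAt ℝ 2 u x) :
    Laplacian.laplacian u x = ∑ i, pd i (pd i u) x := by
  rw [InnerProductSpace.laplacian_eq_iteratedFDeriv_orthonormalBasis u
    (EuclideanSpace.basisFun (Fin 3) ℝ)]
  refine Finset.sum_congr rfl fun i _ => ?_
  rw [pd_pd_eq hu, iteratedFDeriv_two_apply]
  simp

theorem pd_conj {u : E3 → ℂ} (i : Fin 3) (x : E3) :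
    pd i (fun y => conj (u y)) x = conj (pd i u x) := by
  unfold pd
  have : (fun y => conj (u y)) = Complex.conjCLE ∘ u := rfl
  rw [this, ContinuousLinearEquiv.comp_fderiv]
  rfl

theorem contDiff_conj {u : E3 → ℂ} (hu : ContDiff ℝ (⊤ : ℕ∞) u) :
    ContDiff ℝ (⊤ : ℕ∞) fun y => conj (u y) :=
  Complex.conjCLE.contDiff.comp hu

theorem integral_mul_pd {u v : E3 → ℂ} (hu : ContDiff ℝ (⊤ : ℕ∞) u) (hv : ContDiff ℝ (⊤ : ℕ∞) v)
    (hcu : HasCompactSupport u) (i : Fin 3) :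
    ∫ x, u x * pd i v x = - ∫ x, pd i u x * v x := by
  refine integral_mul_fderiv_eq_neg_fderiv_mul_of_integrable ?_ ?_ ?_ ?_ ?_
  · exact ((contDiff_pd hu i).continuous.mul hv.continuous).integrable_of_hasCompactSupport
      (hasCompactSupport_pd hcu i).mul_right
  · exact (hu.continuous.mul (contDiff_pd hv i).continuous).integrable_of_hasCompactSupport
      hcu.mul_right
  · exact (hu.continuous.mul hv.continuous).integrable_of_hasCompactSupport hcu.mul_right
  · exact fun x _ => (hu.differentiable (by simp)) x
  · exact fun x _ => (hv.differentiable (by simp)) x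

/-- `∫ |∂ᵢ u|² = - ∫ u conj (∂ᵢ ∂ᵢ u)`. -/
theorem integral_pd_mul_conj {u v : E3 → ℂ} (hu : ContDiff ℝ (⊤ : ℕ∞) u)
    (hv : ContDiff ℝ (⊤ : ℕ∞) v) (hcu : HasCompactSupport u) (i : Fin 3) :
    ∫ x, pd i u x * conj (v x) = - ∫ x, u x * conj (pd i v x) := by
  have h := integral_mul_pd hu (contDiff_conj hv) hcu i
  simp only [pd_conj] at h
  rw [h, neg_neg]

/-- Both sides equal -∫ ∂ⱼu times the conjugate of ∂ⱼ∂ᵢ∂ᵢu: integrate by parts in the i-th variable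
on the left, in the j-th on the right, and commute derivatives. -/
theorem integral_pd_pd_mul_conj {u : E3 → ℂ} (hu : ContDiff ℝ (⊤ : ℕ∞) u)
    (hcu : HasCompactSupport u) (i j : Fin 3) :
    ∫ x, pd i (pd j u) x * conj (pd i (pd j u) x) =
      ∫ x, pd j (pd j u) x * conj (pd i (pd i u) x) := by
  rw [integral_pd_mul_conj (contDiff_pd hu j) (contDiff_pd (contDiff_pd hu j) i)
    (hasCompactSupport_pd hcu j), integral_pd_mul_conj (contDiff_pd hu j)
    (contDiff_pd (contDiff_pd hu i) i) (hasCompactSupport_pd hcu j), pd_comm hu i j,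
    pd_comm (contDiff_pd hu i) i j]

theorem enorm_sq_eq {z : ℂ} : ‖z‖ₑ ^ 2 = ENNReal.ofReal (z * conj z).re := by
  rw [Complex.mul_conj, Complex.ofReal_re, Complex.normSq_eq_norm_sq, ENNReal.ofReal_pow (norm_nonneg _), ofReal_norm]

theorem lintegral_enorm_sq_eq {u : E3 → ℂ} (hu : Continuous u) (hcu : HasCompactSupport u) :
    ∫⁻ x, ‖u x‖ₑ ^ 2 = ENNReal.ofReal (∫ x, u x * conj (u x)).re := by
  have hi : Integrable fun x => u x * conj (u x) :=
    (hu.mul (Complex.continuous_conj.comp hu)).integrable_of_hasCompactSupport hcu.mul_right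
  have h : (∫ x, u x * conj (u x)).re = ∫ x, (u x * conj (u x)).re :=
    (integral_re hi).symm
  rw [h, ofReal_integral_eq_lintegral_ofReal (f := fun x => (u x * conj (u x)).re) hi.re]
  · exact lintegral_congr fun x => enorm_sq_eq
  · refine Filter.Eventually.of_forall fun x => ?_
    change 0 ≤ (u x * conj (u x)).re
    rw [Complex.mul_conj, Complex.ofReal_re]
    exact Complex.normSq_nonneg _

/-- `∑ᵢⱼ ∫ |∂ᵢ ∂ⱼ u|² = ∫ |Δ u|²` for test functions. -/
theorem sum_lintegral_pd_pd {u : E3 → ℂ} (hu : ContDiff ℝ (⊤ : ℕ∞) u)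
    (hcu : HasCompactSupport u) :
    ∑ i, ∑ j, ∫⁻ x, ‖pd i (pd j u) x‖ₑ ^ 2 = ∫⁻ x, ‖Laplacian.laplacian u x‖ₑ ^ 2 := by
  have hl : Laplacian.laplacian u = fun x => ∑ i, pd i (pd i u) x := funext fun x =>
    laplacian_eq_sum_pd (hu.contDiffAt.of_le (WithTop.coe_le_coe.2 (le_top : (2 : ℕ∞) ≤ ⊤)))
  have hc : ∀ i j, Continuous (pd i (pd j u)) := fun i j =>
    (contDiff_pd (contDiff_pd hu j) i).continuous
  have hs : ∀ i j, HasCompactSupport (pd i (pd j u)) := fun i j =>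
    hasCompactSupport_pd (hasCompactSupport_pd hcu j) i
  have hlc : Continuous (Laplacian.laplacian u) := by
    rw [hl]; exact continuous_finsetSum _ fun i _ => hc i i
  have hls : HasCompactSupport (Laplacian.laplacian u) := by
    have : Laplacian.laplacian u =
        (pd 0 (pd 0 u) + pd 1 (pd 1 u)) + pd 2 (pd 2 u) := by
      rw [hl]; ext x; simp [Fin.sum_univ_three]
    rw [this]
    exact ((hs 0 0).add (hs 1 1)).add (hs 2 2)
  have hi : ∀ i j k l, Integrable fun x => pd i (pd j u) x * conj (pd k (pd l u) x) :=
    fun i j k l => ((hc i j).mul (Complex.continuous_conj.comp (hc k l))).integrable_of_hasCompactSupport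
      (hs i j).mul_right
  rw [lintegral_enorm_sq_eq hlc hls]
  have h1 : ∫ x, Laplacian.laplacian u x * conj (Laplacian.laplacian u x) =
      ∑ i, ∑ j, ∫ x, pd i (pd j u) x * conj (pd i (pd j u) x) := by
    -- Expanding |Δu|² gives the products ∂ⱼ∂ⱼu · conj(∂ᵢ∂ᵢu), whose integrals are those of
    -- |∂ᵢ∂ⱼu|².
    calc _ = ∫ x, ∑ i, ∑ j, pd j (pd j u) x * conj (pd i (pd i u) x) := by
          refine integral_congr_ae (Filter.Eventually.of_forall fun x => ?_)
          simp only [hl, map_sum, Finset.sum_mul_sum]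
          exact Finset.sum_comm
      _ = _ := by
          rw [integral_finsetSum _ fun i _ => integrable_finsetSum _ fun j _ => hi _ _ _ _]
          refine Finset.sum_congr rfl fun i _ => ?_
          rw [integral_finsetSum _ fun j _ => hi _ _ _ _]
          exact Finset.sum_congr rfl fun j _ => (integral_pd_pd_mul_conj hu hcu i j).symm
  have hnn : ∀ i j, 0 ≤ (∫ x, pd i (pd j u) x * conj (pd i (pd j u) x)).re := by
    intro i j
    rw [show (∫ x, pd i (pd j u) x * conj (pd i (pd j u) x)).re = ∫ x, (pd i (pd j u) x * conj (pd i (pd j u) x)).re from (integral_re (hi i j i j)).symm]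
    refine integral_nonneg fun x => ?_
    change 0 ≤ (pd i (pd j u) x * conj (pd i (pd j u) x)).re
    rw [Complex.mul_conj, Complex.ofReal_re]
    exact Complex.normSq_nonneg _
  rw [h1, Complex.re_sum, ENNReal.ofReal_sum_of_nonneg]
  · refine Finset.sum_congr rfl fun i _ => ?_
    rw [Complex.re_sum, ENNReal.ofReal_sum_of_nonneg fun j _ => hnn i j]
    exact Finset.sum_congr rfl fun j _ => lintegral_enorm_sq_eq (hc i j) (hs i j)
  · intro i _
    rw [Complex.re_sum]
    exact Finset.sum_nonneg fun j _ => hnn i j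

/-- The operator norm is at most the Hilbert–Schmidt norm, by Cauchy–Schwarz on the coordinates. -/
theorem norm_clm_sq_le {F : Type*} [NormedAddCommGroup F] [NormedSpace ℝ F] (L : E3 →L[ℝ] F) :
    ‖L‖ ^ 2 ≤ ∑ i, ‖L (EuclideanSpace.single i 1)‖ ^ 2 := by
  have h : ‖L‖ ≤ √(∑ i, ‖L (EuclideanSpace.single i 1)‖ ^ 2) := by
    refine L.opNorm_le_bound (Real.sqrt_nonneg _) fun x => ?_
    have hx : x = ∑ i, x i • (EuclideanSpace.single i (1 : ℝ) : E3) := by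
      have := (EuclideanSpace.basisFun (Fin 3) ℝ).sum_repr x
      simpa using this.symm
    calc ‖L x‖ = ‖∑ i, x i • L (EuclideanSpace.single i 1)‖ := by
          conv_lhs => rw [hx]
          rw [map_sum]
          simp only [map_smul]
      _ ≤ ∑ i, ‖L (EuclideanSpace.single i 1)‖ * |x i| := by
          refine (norm_sum_le _ _).trans (Finset.sum_le_sum fun i _ => ?_)
          rw [norm_smul, mul_comm, Real.norm_eq_abs]
      _ ≤ √(∑ i, ‖L (EuclideanSpace.single i 1)‖ ^ 2) * √(∑ i, |x i| ^ 2) :=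
          Real.sum_mul_le_sqrt_mul_sqrt _ _ _
      _ = _ := by rw [EuclideanSpace.norm_eq]; simp
  calc ‖L‖ ^ 2 ≤ √(∑ i, ‖L (EuclideanSpace.single i 1)‖ ^ 2) ^ 2 := by gcongr
    _ = _ := Real.sq_sqrt (by positivity)

/-- For complex-valued u the derivative is a real-linear map into a plane, so its operator norm and
the length of `grad` are in general different; they are only equivalent. -/
theorem norm_fderiv_le_grad (u : E3 → ℂ) (x : E3) : ‖fderiv ℝ u x‖ ≤ ‖grad u x‖ := by
  rw [EuclideanSpace.norm_eq]
  exact Real.le_sqrt_of_sq_le (norm_clm_sq_le _)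

theorem norm_grad_sq (u : E3 → ℂ) (x : E3) : ‖grad u x‖ ^ 2 = ∑ i, ‖pd i u x‖ ^ 2 := by
  rw [EuclideanSpace.norm_sq_eq]; rfl

theorem norm_grad_le (u : E3 → ℂ) (x : E3) : ‖grad u x‖ ≤ 3 * ‖fderiv ℝ u x‖ := by
  have h : ∀ i, ‖pd i u x‖ ≤ ‖fderiv ℝ u x‖ := fun i =>
    ((fderiv ℝ u x).le_opNorm _).trans (by simp)
  refine abs_le_of_sq_le_sq' ?_ (by positivity) |>.2
  rw [norm_grad_sq, Fin.sum_univ_three]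
  nlinarith [pow_le_pow_left₀ (norm_nonneg _) (h 0) 2, pow_le_pow_left₀ (norm_nonneg _) (h 1) 2,
    pow_le_pow_left₀ (norm_nonneg _) (h 2) 2, sq_nonneg ‖fderiv ℝ u x‖]

theorem eLpNorm_two_sq {α F : Type*} [MeasurableSpace α] [ENorm F] (f : α → F)
    (μ : Measure α) : eLpNorm f 2 μ ^ 2 = ∫⁻ x, ‖f x‖ₑ ^ 2 ∂μ := by
  have := eLpNorm_nnreal_pow_eq_lintegral (μ := μ) (f := f) (p := 2) two_ne_zero
  simpa using this

/-- Pointwise the Hessian is bounded by the sum of all |∂ᵢ∂ⱼu|², and the integral of that sum is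
exactly ∫|Δu|². -/
theorem eLpNorm_hessian_le {u : E3 → ℂ} (hu : ContDiff ℝ (⊤ : ℕ∞) u)
    (hcu : HasCompactSupport u) :
    eLpNorm (fderiv ℝ (fderiv ℝ u)) 2 volume ≤ eLpNorm (Laplacian.laplacian u) 2 volume := by
  rw [← ENNReal.pow_le_pow_left_iff two_ne_zero, eLpNorm_two_sq, eLpNorm_two_sq,
    ← sum_lintegral_pd_pd hu hcu]
  have hc : ∀ i j, Continuous (pd i (pd j u)) := fun i j =>
    (contDiff_pd (contDiff_pd hu j) i).continuous
  simp_rw [← lintegral_finsetSum _ fun j _ => ((hc _ j).enorm.measurable.pow_const 2)]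
  rw [← lintegral_finsetSum _ fun i _ => Finset.measurable_sum _ fun j _ =>
    ((hc i j).enorm.measurable.pow_const 2)]
  refine lintegral_mono fun x => ?_
  have h2 : ContDiffAt ℝ 2 u x := hu.contDiffAt.of_le (WithTop.coe_le_coe.2 (le_top : (2 : ℕ∞) ≤ ⊤))
  have h : ‖fderiv ℝ (fderiv ℝ u) x‖ ^ 2 ≤ ∑ i, ∑ j, ‖pd i (pd j u) x‖ ^ 2 := by
    refine (norm_clm_sq_le _).trans (Finset.sum_le_sum fun i _ => ?_)
    refine (norm_clm_sq_le _).trans (Finset.sum_le_sum fun j _ => ?_)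
    rw [pd_pd_eq h2]
  have h3 := ENNReal.ofReal_le_ofReal h
  calc ‖fderiv ℝ (fderiv ℝ u) x‖ₑ ^ 2 = ENNReal.ofReal (‖fderiv ℝ (fderiv ℝ u) x‖ ^ 2) := by
        rw [← ofReal_norm]
        exact (ENNReal.ofReal_pow (norm_nonneg _) 2).symm
    _ ≤ _ := h3
    _ = _ := by
        rw [ENNReal.ofReal_sum_of_nonneg fun i _ => by positivity]
        simp [ENNReal.ofReal_sum_of_nonneg, ENNReal.ofReal_pow]

/-- Cauchy–Schwarz for extended integrals, which avoids any integrability assumption. -/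
theorem lintegral_mul_le_eLpNorm {α F G : Type*} [MeasurableSpace α] {μ : Measure α}
    [NormedAddCommGroup F] [NormedAddCommGroup G] {f : α → F} {g : α → G}
    (hf : AEStronglyMeasurable f μ) (hg : AEStronglyMeasurable g μ) :
    ∫⁻ x, ‖f x‖ₑ * ‖g x‖ₑ ∂μ ≤ eLpNorm f 2 μ * eLpNorm g 2 μ := by
  have h := eLpNorm_le_eLpNorm_mul_eLpNorm'_of_norm (p := 2) (q := 2) (r := 1) (μ := μ)
    hf.norm hg.norm (fun a b : ℝ => a * b) 1 (Filter.Eventually.of_forall fun x => by simp)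
  rw [eLpNorm_one_eq_lintegral_enorm] at h
  simpa [enorm_mul, eLpNorm_norm] using h

/-- The Sobolev inequality for the gradient of a test function. -/
theorem exists_eLpNorm_grad_le : ∃ C : NNReal, ∀ u : E3 → ℂ, ContDiff ℝ (⊤ : ℕ∞) u →
    HasCompactSupport u →
    eLpNorm (grad u) 6 volume ≤ C * eLpNorm (Laplacian.laplacian u) 2 volume := by
  refine ⟨3 * SNormLESNormFDerivOfEqConst (E3 →L[ℝ] ℂ) (volume : Measure E3) 2, fun u hu hcu => ?_⟩
  have h1 : eLpNorm (fderiv ℝ u) (6 : NNReal) volume ≤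
      SNormLESNormFDerivOfEqConst (E3 →L[ℝ] ℂ) (volume : Measure E3) 2 *
        eLpNorm (fderiv ℝ (fderiv ℝ u)) (2 : NNReal) volume := by
    -- Gagliardo–Nirenberg–Sobolev applied to the derivative of u: in dimension 3 the exponents
    -- satisfy 1/6 = 1/2 - 1/3.
    refine eLpNorm_le_eLpNorm_fderiv_of_eq (volume : Measure E3) (p := 2) (p' := 6)
      (hu.fderiv_right (m := 1) ?_) (hcu.fderiv ℝ) (by norm_num)
      (by rw [finrank_euclideanSpace, Fintype.card_fin]; norm_num) ?_
    · exact WithTop.coe_le_coe.2 (le_top : (2 : ℕ∞) ≤ ⊤)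
    · rw [finrank_euclideanSpace, Fintype.card_fin]; norm_num
  have h2 : eLpNorm (grad u) 6 volume ≤ (3 : NNReal) * eLpNorm (fderiv ℝ u) (6 : NNReal) volume := by
    have := eLpNorm_le_nnreal_smul_eLpNorm_of_ae_le_mul (μ := (volume : Measure E3)) (c := 3)
      (f := grad u) (g := fderiv ℝ u)
      (Filter.Eventually.of_forall fun x => by
        exact_mod_cast norm_grad_le u x) 6
    simpa [ENNReal.smul_def] using this
  refine h2.trans ?_
  rw [ENNReal.coe_mul, mul_assoc]
  gcongr
  exact h1.trans (mul_le_mul_right (by simpa using eLpNorm_hessian_le hu hcu) _)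

/-- The Sobolev inequality for a test function. -/
theorem exists_eLpNorm_six_le : ∃ C : NNReal, ∀ u : E3 → ℂ, ContDiff ℝ (⊤ : ℕ∞) u →
    HasCompactSupport u → eLpNorm u 6 volume ≤ C * eLpNorm (grad u) 2 volume := by
  refine ⟨SNormLESNormFDerivOfEqConst ℂ (volume : Measure E3) 2, fun u hu hcu => ?_⟩
  have h1 : eLpNorm u (6 : NNReal) volume ≤
      SNormLESNormFDerivOfEqConst ℂ (volume : Measure E3) 2 *
        eLpNorm (fderiv ℝ u) (2 : NNReal) volume := by
    refine eLpNorm_le_eLpNorm_fderiv_of_eq (volume : Measure E3) (p := 2) (p' := 6)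
      (hu.of_le (WithTop.coe_le_coe.2 (le_top : (1 : ℕ∞) ≤ ⊤))) hcu (by norm_num)
      (by rw [finrank_euclideanSpace, Fintype.card_fin]; norm_num) ?_
    rw [finrank_euclideanSpace, Fintype.card_fin]; norm_num
  refine h1.trans (mul_le_mul_right ?_ _)
  exact eLpNorm_mono fun x => norm_fderiv_le_grad u x

/-- `‖∇u‖² ≤ ‖u‖ ‖Δu‖` for test functions. -/
theorem eLpNorm_grad_sq_le {u : E3 → ℂ} (hu : ContDiff ℝ (⊤ : ℕ∞) u)
    (hcu : HasCompactSupport u) : eLpNorm (grad u) 2 volume ^ 2 ≤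
      eLpNorm u 2 volume * eLpNorm (Laplacian.laplacian u) 2 volume := by
  have hl : Laplacian.laplacian u = fun x => ∑ i, pd i (pd i u) x := funext fun x =>
    laplacian_eq_sum_pd (hu.contDiffAt.of_le (WithTop.coe_le_coe.2 (le_top : (2 : ℕ∞) ≤ ⊤)))
  have hc2 : ∀ i, Continuous (pd i (pd i u)) := fun i =>
    (contDiff_pd (contDiff_pd hu i) i).continuous
  have hc : ∀ i, Continuous (pd i u) := fun i => (contDiff_pd hu i).continuous
  have hlc : Continuous (Laplacian.laplacian u) := by
    rw [hl]; exact continuous_finsetSum _ fun i _ => hc2 i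
  have hi : ∀ i, Integrable fun x => u x * conj (pd i (pd i u) x) := fun i =>
    (hu.continuous.mul (Complex.continuous_conj.comp (hc2 i))).integrable_of_hasCompactSupport
      hcu.mul_right
  have h1 : ∀ x, ‖grad u x‖ₑ ^ 2 = ∑ i, ‖pd i u x‖ₑ ^ 2 := by
    intro x
    have h3 := congrArg ENNReal.ofReal (norm_grad_sq u x)
    rw [ENNReal.ofReal_pow (norm_nonneg _), ENNReal.ofReal_sum_of_nonneg fun i _ => by positivity]
      at h3
    simpa [ENNReal.ofReal_pow] using h3
  have h2 : ∀ i, ∫⁻ x, ‖pd i u x‖ₑ ^ 2 = ENNReal.ofReal (- ∫ x, u x * conj (pd i (pd i u) x)).re :=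
    fun i => by
      rw [lintegral_enorm_sq_eq (hc i) (hasCompactSupport_pd hcu i),
        integral_pd_mul_conj hu (contDiff_pd hu i) hcu]
  have hnn : ∀ i, 0 ≤ (- ∫ x, u x * conj (pd i (pd i u) x)).re := by
    intro i
    rw [← integral_pd_mul_conj hu (contDiff_pd hu i) hcu,
      show (∫ x, pd i u x * conj (pd i u x)).re = ∫ x, (pd i u x * conj (pd i u x)).re from
        (integral_re (((hc i).mul (Complex.continuous_conj.comp
          (hc i))).integrable_of_hasCompactSupport (hasCompactSupport_pd hcu i).mul_right)).symm]
    refine integral_nonneg fun x => ?_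
    change 0 ≤ (pd i u x * conj (pd i u x)).re
    rw [Complex.mul_conj, Complex.ofReal_re]
    exact Complex.normSq_nonneg _
  rw [eLpNorm_two_sq]
  calc ∫⁻ x, ‖grad u x‖ₑ ^ 2 = ∑ i, ∫⁻ x, ‖pd i u x‖ₑ ^ 2 := by
        simp_rw [h1]
        exact lintegral_finsetSum _ fun i _ => (hc i).enorm.measurable.pow_const 2
    _ = ENNReal.ofReal (∑ i, (- ∫ x, u x * conj (pd i (pd i u) x)).re) := by
        rw [ENNReal.ofReal_sum_of_nonneg fun i _ => hnn i]
        exact Finset.sum_congr rfl fun i _ => h2 i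
    _ = ENNReal.ofReal (- ∫ x, u x * conj (Laplacian.laplacian u x)).re := by
        rw [← Complex.re_sum, Finset.sum_neg_distrib, ← integral_finsetSum _ fun i _ => hi i]
        simp only [hl, map_sum, Finset.mul_sum]
    _ ≤ ‖∫ x, u x * conj (Laplacian.laplacian u x)‖ₑ := by
        rw [← ofReal_norm, ← norm_neg]
        exact ENNReal.ofReal_le_ofReal (Complex.re_le_norm _)
    _ ≤ ∫⁻ x, ‖u x * conj (Laplacian.laplacian u x)‖ₑ := enorm_integral_le_lintegral_enorm _
    _ = ∫⁻ x, ‖u x‖ₑ * ‖Laplacian.laplacian u x‖ₑ := by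
        refine lintegral_congr fun x => ?_
        rw [enorm_mul, ← ofReal_norm (conj _), RCLike.norm_conj, ofReal_norm]
    _ ≤ _ := lintegral_mul_le_eLpNorm hu.continuous.aestronglyMeasurable
        hlc.aestronglyMeasurable

end Euclidean

/-! ### Polar coordinates: comparing the sphere with shells in ℝ³ -/

section Polar

/-- The radial projection onto the sphere of radius `r`. -/
def radialProj (r : ℝ) (x : E3) : E3 := (r / ‖x‖) • x

theorem measurable_radialProj (r : ℝ) : Measurable (radialProj r) :=
  (measurable_const.div measurable_norm).smul measurable_id

theorem lintegral_surf (r : ℝ) {h : E3 → ENNReal} (hh : Measurable h) :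
    ∫⁻ x, h x ∂(surf r) = ENNReal.ofReal (r ^ 2) *
      ∫⁻ s : Metric.sphere (0 : E3) 1, h (r • (s : E3)) ∂((volume : Measure E3).toSphere) := by
  unfold surf
  have hm : Measurable fun s : Metric.sphere (0 : E3) 1 => r • (s : E3) :=
    measurable_subtype_coe.const_smul r
  rw [lintegral_smul_measure, lintegral_map hh hm]
  rfl

/-- Integration in polar coordinates. -/
theorem lintegral_polar {r : ℝ} (hr : 0 < r) {a : ℝ → ENNReal} (ha : Measurable a)
    {h : E3 → ENNReal} (hh : Measurable h) :
    ∫⁻ x : E3, a ‖x‖ * h (radialProj r x) =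
      (∫⁻ t in Ioi (0 : ℝ), ENNReal.ofReal (t ^ 2) * a t) * (ENNReal.ofReal (r ^ 2))⁻¹ *
        ∫⁻ x, h x ∂(surf r) := by
  have hmp := (volume : Measure E3).measurePreserving_homeomorphUnitSphereProd
  have hdim : Module.finrank ℝ E3 - 1 = 2 := by simp [E3]
  rw [hdim] at hmp
  set f : E3 → ENNReal := fun x => a ‖x‖ * h (radialProj r x) with hf
  have hfm : Measurable f :=
    (ha.comp measurable_norm).mul (hh.comp (measurable_radialProj r))
  have h1 : ∫⁻ x, f x = ∫⁻ x : ({0}ᶜ : Set E3), f x ∂((volume : Measure E3).comap (↑)) := by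
    rw [lintegral_subtype_comap (measurableSet_singleton (0 : E3)).compl, 
      restrict_compl_singleton]
  have hg : Measurable fun p : Metric.sphere (0 : E3) 1 × Ioi (0 : ℝ) =>
      h (r • (p.1 : E3)) * a p.2 :=
    (hh.comp ((measurable_subtype_coe.comp measurable_fst).const_smul r)).mul
      (ha.comp (measurable_subtype_coe.comp measurable_snd))
  have h2 : ∫⁻ x : ({0}ᶜ : Set E3), f x ∂((volume : Measure E3).comap (↑)) =
      ∫⁻ p, h (r • (p.1 : E3)) * a p.2
        ∂((volume : Measure E3).toSphere.prod (Measure.volumeIoiPow 2)) := by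
    rw [← hmp.lintegral_comp hg]
    refine lintegral_congr fun x => ?_
    simp only [hf, radialProj, homeomorphUnitSphereProd_apply_fst_coe,
      homeomorphUnitSphereProd_apply_snd_coe, smul_smul]
    rw [mul_comm, div_eq_mul_inv]
  rw [h1, h2, lintegral_prod_mul (f := fun s : Metric.sphere (0 : E3) 1 => h (r • (s : E3)))
    (g := fun t : Ioi (0 : ℝ) => a t)
    (hh.comp (measurable_subtype_coe.const_smul r)).aemeasurable
    (ha.comp measurable_subtype_coe).aemeasurable, lintegral_surf r hh]
  have h3 : ∫⁻ t : Ioi (0 : ℝ), a t ∂(Measure.volumeIoiPow 2) =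
      ∫⁻ t in Ioi (0 : ℝ), ENNReal.ofReal (t ^ 2) * a t := by
    unfold Measure.volumeIoiPow
    have ha' : Measurable fun t : Ioi (0 : ℝ) => a t := ha.comp measurable_subtype_coe
    rw [lintegral_withDensity_eq_lintegral_mul _
      ((measurable_subtype_coe.pow_const 2).ennreal_ofReal) ha']
    exact lintegral_subtype_comap measurableSet_Ioi (fun t => ENNReal.ofReal (t ^ 2) * a t)
  rw [h3, mul_assoc, ← mul_assoc (ENNReal.ofReal (r ^ 2))⁻¹, ENNReal.inv_mul_cancel, one_mul,
    mul_comm]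
  · simpa using hr.ne'
  · exact ENNReal.ofReal_ne_top

/-- The spherical shell. -/
def shell (a b : ℝ) : Set E3 := {x | a < ‖x‖ ∧ ‖x‖ < b}

theorem measurableSet_shell (a b : ℝ) : MeasurableSet (shell a b) :=
  (measurableSet_lt measurable_const measurable_norm).inter
    (measurableSet_lt measurable_norm measurable_const)

/-- In polar coordinates the radial variable integrates out, so Lebesgue measure on a shell projects
to a multiple of the surface measure. The case a = 0 is allowed, for later use with the punctured
ball. -/
theorem exists_map_shell {r : ℝ} (hr : 0 < r) {a b : ℝ} (ha : 0 ≤ a) (hab : a < b) :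
    ∃ c : ENNReal, c ≠ 0 ∧ c ≠ ⊤ ∧
      ((volume : Measure E3).restrict (shell a b)).map (radialProj r) = c • surf r := by
  have hI : Ioo a b ⊆ Ioi 0 := fun t ht => lt_of_le_of_lt ha ht.1
  -- The constant is r⁻² ∫ₐᵇ t² dt.
  refine ⟨(∫⁻ t in Ioi (0 : ℝ), ENNReal.ofReal (t ^ 2) * (Ioo a b).indicator 1 t) *
    (ENNReal.ofReal (r ^ 2))⁻¹, ?_, ?_, ?_⟩
  · refine mul_ne_zero ?_ (by simp)
    rw [← pos_iff_ne_zero]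
    have : ∫⁻ t in Ioi (0 : ℝ), ENNReal.ofReal (t ^ 2) * (Ioo a b).indicator 1 t =
        ∫⁻ t in Ioo a b, ENNReal.ofReal (t ^ 2) := by
      simp_rw [← Set.indicator_mul_right _ (fun t => ENNReal.ofReal (t ^ 2)), Pi.one_apply, mul_one]
      rw [setLIntegral_indicator measurableSet_Ioo, inter_eq_left.2 hI]
    rw [this, setLIntegral_pos_iff (by fun_prop)]
    have : (Function.support fun t : ℝ => ENNReal.ofReal (t ^ 2)) ∩ Ioo a b = Ioo a b := by
      refine inter_eq_right.2 fun t ht => ?_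
      have := hI ht
      simp only [Function.mem_support, ne_eq, ENNReal.ofReal_eq_zero, not_le]
      exact pow_pos this 2
    rw [this]
    simp [hab]
  · refine ENNReal.mul_ne_top ?_ (by simpa using hr.ne')
    have : ∫⁻ t in Ioi (0 : ℝ), ENNReal.ofReal (t ^ 2) * (Ioo a b).indicator 1 t ≤
        ENNReal.ofReal (b ^ 2) * volume (Ioo a b) := by
      calc _ ≤ ∫⁻ t : ℝ, (Ioo a b).indicator (fun _ => ENNReal.ofReal (b ^ 2)) t := by
            refine (lintegral_mono' Measure.restrict_le_self le_rfl).trans (lintegral_mono fun t => ?_)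
            by_cases ht : t ∈ Ioo a b
            · simp only [ht, indicator_of_mem, Pi.one_apply, mul_one]
              have := hI ht
              exact ENNReal.ofReal_le_ofReal (pow_le_pow_left₀ (le_of_lt this) ht.2.le 2)
            · simp [ht]
        _ = _ := by rw [lintegral_indicator_const measurableSet_Ioo]
    exact ne_top_of_le_ne_top (ENNReal.mul_ne_top ENNReal.ofReal_ne_top (by simp)) this
  · ext A hA
    have h := lintegral_polar hr (a := (Ioo a b).indicator 1) (h := A.indicator 1)
      (measurable_one.indicator measurableSet_Ioo) (measurable_one.indicator hA)
    rw [lintegral_indicator_one hA] at h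
    rw [Measure.smul_apply, smul_eq_mul, ← h,
      ← lintegral_indicator_one hA,
      lintegral_map (measurable_one.indicator hA) (measurable_radialProj r),
      ← lintegral_indicator (measurableSet_shell a b)]
    refine lintegral_congr fun x => ?_
    by_cases hx : x ∈ shell a b
    · have : ‖x‖ ∈ Ioo a b := hx
      simp [hx, this]
    · have : ‖x‖ ∉ Ioo a b := hx
      simp [hx, this]

/-- The `L^p` norms on the sphere and on a shell, for functions constant along rays. -/
theorem exists_eLpNorm_shell {r : ℝ} (hr : 0 < r) {a b : ℝ} (ha : 0 ≤ a) (hab : a < b)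
    {p : ENNReal} (hp : p ≠ ⊤) :
    ∃ c : ENNReal, c ≠ 0 ∧ c ≠ ⊤ ∧ ∀ {G : Type} [NormedAddCommGroup G] (h : E3 → G),
      AEStronglyMeasurable h (surf r) →
      eLpNorm (h ∘ radialProj r) p ((volume : Measure E3).restrict (shell a b)) =
        c * eLpNorm h p (surf r) := by
  obtain ⟨c, hc0, hct, hc⟩ := exists_map_shell hr ha hab
  refine ⟨c ^ (1 / p).toReal, ?_, ?_, fun h hh => ?_⟩
  · simp [ENNReal.rpow_eq_zero_iff, hc0, hct]
  · simp [hc0, hct]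
  · rw [← eLpNorm_map_measure (by rw [hc]; exact hh.smul_measure c)
      (measurable_radialProj r).aemeasurable, hc, eLpNorm_smul_measure_of_ne_top hp, smul_eq_mul]

end Polar

/-! ### Homogeneity of derivatives and multiplication by a radial cutoff -/

section Cutoff

theorem SmoothFun.comp_radialProj {F : E3 → ℂ} (hF : F ∈ SmoothFun) {r : ℝ} (hr : 0 < r) {x : E3}
    (hx : x ≠ 0) : F (radialProj r x) = F x :=
  hF.2 _ (div_pos hr (norm_pos_iff.2 hx)) x

theorem pd_smul_arg (i : Fin 3) (G : E3 → ℂ) (t : ℝ) (x : E3) :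
    pd i (fun y => G (t • y)) x = t * pd i G (t • x) := by
  unfold pd
  rw [fderiv_comp_smul]
  simp

/-- A function constant along rays is homogeneous of degree 0, so its first derivatives have degree
-1 and its Laplacian degree -2. Derivatives off the sphere are thereby read off on the sphere. -/
theorem SmoothFun.pd_smul {F : E3 → ℂ} (hF : F ∈ SmoothFun) {t : ℝ} (ht : 0 < t) (i : Fin 3) (x : E3) :
    pd i F x = t * pd i F (t • x) := by
  rw [← pd_smul_arg]
  congr 1
  ext y
  exact (hF.2 t ht y).symm

theorem SmoothFun.grad_smul_arg {F : E3 → ℂ} (hF : F ∈ SmoothFun) {t : ℝ} (ht : 0 < t) (x : E3) :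
    grad F x = (t : ℂ) • grad F (t • x) := by
  ext i
  exact SmoothFun.pd_smul hF ht i x

theorem SmoothFun.laplacian_smul_arg {F : E3 → ℂ} (hF : F ∈ SmoothFun) {t : ℝ} (ht : 0 < t)
    {x : E3} (hx : x ≠ 0) :
    Laplacian.laplacian F x = (t : ℂ) ^ 2 * Laplacian.laplacian F (t • x) := by
  have h2 : ∀ {y : E3}, y ≠ 0 → ContDiffAt ℝ 2 F y := fun hy =>
    (SmoothFun.contDiffAt hF hy).of_le (WithTop.coe_le_coe.2 (le_top : (2 : ℕ∞) ≤ ⊤))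
  rw [laplacian_eq_sum_pd (h2 hx), laplacian_eq_sum_pd (h2 (smul_ne_zero ht.ne' hx)),
    Finset.mul_sum]
  refine Finset.sum_congr rfl fun i _ => ?_
  have h3 : pd i F = (t : ℂ) • fun y => pd i F (t • y) := funext fun y => SmoothFun.pd_smul hF ht i y
  have h4 : pd i (pd i F) x = t * pd i (fun y => pd i F (t • y)) x := by
    conv_lhs => rw [h3]
    unfold pd
    rw [fderiv_const_smul_field]
    rfl
  rw [h4, pd_smul_arg]
  ring

/-- A radial cutoff living away from the origin, where functions constant along rays fail to be
smooth, and equal to 1 on a shell wide enough to recover the function from the product. -/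
theorem exists_cutoff : ∃ η : E3 → ℂ, ContDiff ℝ (⊤ : ℕ∞) η ∧ HasCompactSupport η ∧
    tsupport η ⊆ shell (1 / 2) 3 ∧ ∀ x ∈ shell (13 / 10) (18 / 10), η =ᶠ[𝓝 x] 1 := by
  -- The bump is a function of |x|², which is smooth at 0: it equals 1 for 3/2 ≤ |x|² ≤ 7/2 and
  -- vanishes unless 1 < |x|² < 4.
  let b : ContDiffBump (5 / 2 : ℝ) := ⟨1, 3 / 2, one_pos, by norm_num⟩
  have hsupp : ∀ x : E3, (b (‖x‖ ^ 2) : ℂ) ≠ 0 ↔ 1 < ‖x‖ ^ 2 ∧ ‖x‖ ^ 2 < 4 := by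
    intro x
    rw [Complex.ofReal_ne_zero, ← Function.mem_support, b.support_eq, Metric.mem_ball,
      Real.dist_eq, abs_lt]
    simp only [b]
    constructor
    · rintro ⟨h1, h2⟩; constructor <;> linarith
    · rintro ⟨h1, h2⟩; constructor <;> linarith
  refine ⟨fun x => (b (‖x‖ ^ 2) : ℂ), ?_, ?_, ?_, ?_⟩
  · exact Complex.ofRealCLM.contDiff.comp (b.contDiff.comp (contDiff_norm_sq ℝ))
  · refine HasCompactSupport.of_support_subset_isCompact (isCompact_closedBall (0 : E3) 2) ?_
    intro x hx
    have := (hsupp x).1 hx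
    rw [mem_closedBall_zero_iff]
    nlinarith [norm_nonneg x]
  · have hcl : IsClosed {x : E3 | 1 ≤ ‖x‖ ^ 2 ∧ ‖x‖ ^ 2 ≤ 4} :=
      (isClosed_le continuous_const (continuous_norm.pow 2)).inter
        (isClosed_le (continuous_norm.pow 2) continuous_const)
    refine (closure_minimal (fun x hx => ?_) hcl).trans fun x hx => ?_
    · exact ⟨((hsupp x).1 hx).1.le, ((hsupp x).1 hx).2.le⟩
    · obtain ⟨h1, h2⟩ := hx
      constructor <;> nlinarith [norm_nonneg x]
  · intro x hx
    have ho : IsOpen (shell (13 / 10) (18 / 10)) :=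
      (isOpen_lt continuous_const continuous_norm).inter
        (isOpen_lt continuous_norm continuous_const)
    filter_upwards [ho.mem_nhds hx] with y hy
    obtain ⟨h1, h2⟩ := hy
    have : b (‖y‖ ^ 2) = 1 := by
      refine b.one_of_mem_closedBall ?_
      rw [Metric.mem_closedBall, Real.dist_eq, abs_le]
      constructor <;> simp only [b] <;> nlinarith [norm_nonneg y]
    simp [this]

/-- The product of a smooth function on the sphere with a cutoff function. -/
theorem contDiff_cutoff_mul {η F : E3 → ℂ} (hη : ContDiff ℝ (⊤ : ℕ∞) η)
    (hs : tsupport η ⊆ shell (1 / 2) 3) (hF : F ∈ SmoothFun) :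
    ContDiff ℝ (⊤ : ℕ∞) fun x => η x * F x := by
  rw [contDiff_iff_contDiffAt]
  intro x
  by_cases hx : x ∈ tsupport η
  · have hx0 : x ≠ 0 := by
      rintro rfl
      have := (hs hx).1
      norm_num at this
    exact hη.contDiffAt.mul (SmoothFun.contDiffAt hF hx0)
  · have h : (fun x => η x * F x) =ᶠ[𝓝 x] fun _ => 0 := by
      filter_upwards [notMem_tsupport_iff_eventuallyEq.1 hx] with y hy
      simp [hy]
    exact contDiffAt_const.congr_of_eventuallyEq h

theorem pd_mul {η F : E3 → ℂ} {x : E3} (hη : DifferentiableAt ℝ η x) (hF : DifferentiableAt ℝ F x)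
    (i : Fin 3) : pd i (fun y => η y * F y) x = η x * pd i F x + pd i η x * F x := by
  unfold pd
  rw [fderiv_fun_mul hη hF]
  simp [mul_comm]

theorem pd_add {u v : E3 → ℂ} {x : E3} (hu : DifferentiableAt ℝ u x) (hv : DifferentiableAt ℝ v x)
    (i : Fin 3) : pd i (fun y => u y + v y) x = pd i u x + pd i v x := by
  unfold pd
  rw [fderiv_fun_add hu hv]
  rfl

theorem pd_congr {u v : E3 → ℂ} {x : E3} (i : Fin 3) (h : u =ᶠ[𝓝 x] v) : pd i u x = pd i v x := by
  unfold pd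
  rw [h.fderiv_eq]

theorem norm_pd_le (u : E3 → ℂ) (x : E3) (i : Fin 3) : ‖pd i u x‖ ≤ ‖grad u x‖ :=
  PiLp.norm_apply_le (grad u x) i

theorem norm_grad_le_sum (u : E3 → ℂ) (x : E3) : ‖grad u x‖ ≤ ∑ i, ‖pd i u x‖ := by
  refine abs_le_of_sq_le_sq' ?_ (by positivity) |>.2
  rw [norm_grad_sq, Fin.sum_univ_three, Fin.sum_univ_three]
  nlinarith [mul_nonneg (norm_nonneg (pd 0 u x)) (norm_nonneg (pd 1 u x)),
    mul_nonneg (norm_nonneg (pd 0 u x)) (norm_nonneg (pd 2 u x)),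
    mul_nonneg (norm_nonneg (pd 1 u x)) (norm_nonneg (pd 2 u x))]

theorem exists_bound_pd {u : E3 → ℂ} (hu : ContDiff ℝ (⊤ : ℕ∞) u) (hcu : HasCompactSupport u) :
    ∃ M : ℝ, 0 ≤ M ∧ (∀ x, ‖u x‖ ≤ M) ∧ (∀ i x, ‖pd i u x‖ ≤ M) ∧
      ∀ i j x, ‖pd i (pd j u) x‖ ≤ M := by
  obtain ⟨a, ha⟩ := hu.continuous.bounded_above_of_compact_support hcu
  choose b hb using fun i => (contDiff_pd hu i).continuous.bounded_above_of_compact_support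
    (hasCompactSupport_pd hcu i)
  choose c hc using fun i j => (contDiff_pd (contDiff_pd hu j) i).continuous.bounded_above_of_compact_support
    (hasCompactSupport_pd (hasCompactSupport_pd hcu j) i)
  have ha0 : 0 ≤ a := (norm_nonneg _).trans (ha 0)
  have hb0 : ∀ i, 0 ≤ b i := fun i => (norm_nonneg _).trans (hb i 0)
  have hc0 : ∀ i j, 0 ≤ c i j := fun i j => (norm_nonneg _).trans (hc i j 0)
  have hbs : ∀ i, b i ≤ ∑ i, b i := fun i => Finset.single_le_sum (fun i _ => hb0 i) (Finset.mem_univ i)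
  have hcs : ∀ i j, c i j ≤ ∑ i, ∑ j, c i j := fun i j =>
    (Finset.single_le_sum (fun j _ => hc0 i j) (Finset.mem_univ j)).trans
      (Finset.single_le_sum (f := fun i => ∑ j, c i j) (fun i _ => Finset.sum_nonneg fun j _ => hc0 i j) (Finset.mem_univ i))
  have h1 : 0 ≤ ∑ i, b i := Finset.sum_nonneg fun i _ => hb0 i
  have h2 : 0 ≤ ∑ i, ∑ j, c i j := Finset.sum_nonneg fun i _ => Finset.sum_nonneg fun j _ => hc0 i j
  refine ⟨a + ∑ i, b i + ∑ i, ∑ j, c i j, by positivity, fun x => ?_, fun i x => ?_, fun i j x => ?_⟩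
  · linarith [ha x]
  · linarith [hb i x, hbs i]
  · linarith [hc i j x, hcs i j]

/-- Pointwise bounds for the derivatives of `η F`, in terms of the derivatives of `F` on the sphere
of radius `r`. -/
theorem exists_cutoff_bounds {η : E3 → ℂ} (hη : ContDiff ℝ (⊤ : ℕ∞) η)
    (hcη : HasCompactSupport η) {r : ℝ} (hr : 0 < r) :
    ∃ M : ℝ, 0 ≤ M ∧ ∀ F ∈ SmoothFun, ∀ x ∈ shell (1 / 2) 3,
      ‖η x * F x‖ ≤ M * ‖F (radialProj r x)‖ ∧
      ‖grad (fun y => η y * F y) x‖ ≤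
        M * (‖F (radialProj r x)‖ + ‖grad F (radialProj r x)‖) ∧
      ‖Laplacian.laplacian (fun y => η y * F y) x‖ ≤
        M * (‖F (radialProj r x)‖ + ‖grad F (radialProj r x)‖ +
          ‖Laplacian.laplacian F (radialProj r x)‖) := by
  obtain ⟨m, hm0, hm, hm1, hm2⟩ := exists_bound_pd hη hcη
  -- On the shell |x| > 1/2, so the scaling factor r/|x| is below 2r. The witness dominates all
  -- coefficients from Leibniz' rule summed over three coordinates.
  refine ⟨6 * m * (1 + 2 * r) ^ 2, by positivity, fun F hF x hx => ?_⟩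
  have hx0 : x ≠ 0 := by
    rintro rfl
    have := hx.1
    norm_num at this
  have hxn := norm_pos_iff.2 hx0
  set t := r / ‖x‖ with ht
  have ht0 : 0 < t := div_pos hr hxn
  have ht2 : t ≤ 2 * r := by
    rw [ht, div_le_iff₀ hxn]
    nlinarith [hx.1]
  have hFx : F (radialProj r x) = F x := SmoothFun.comp_radialProj hF hr hx0
  have hgx : ‖grad F x‖ = t * ‖grad F (radialProj r x)‖ := by
    rw [SmoothFun.grad_smul_arg hF ht0 x, norm_smul, Complex.norm_real, Real.norm_of_nonneg ht0.le]
    rfl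
  have hlx : ‖Laplacian.laplacian F x‖ = t ^ 2 * ‖Laplacian.laplacian F (radialProj r x)‖ := by
    rw [SmoothFun.laplacian_smul_arg hF ht0 hx0, norm_mul, norm_pow, Complex.norm_real,
      Real.norm_of_nonneg ht0.le]
    rfl
  have hFd : ∀ᶠ y in 𝓝 x, ContDiffAt ℝ (⊤ : ℕ∞) F y := by
    filter_upwards [isOpen_compl_singleton.mem_nhds hx0] with y hy
    exact SmoothFun.contDiffAt hF hy
  have hF2 : ContDiffAt ℝ 2 F x :=
    hFd.self_of_nhds.of_le (WithTop.coe_le_coe.2 (le_top : (2 : ℕ∞) ≤ ⊤))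
  have hd : ∀ i, DifferentiableAt ℝ (pd i F) x := fun i =>
    ((hF2.fderiv_right (m := 1) (by norm_num)).clm_apply contDiffAt_const).differentiableAt
      (by norm_num)
  have hηd : ∀ y, DifferentiableAt ℝ η y := fun y => hη.differentiable (by simp) y
  have h1 : ∀ i, pd i (fun y => η y * F y) =ᶠ[𝓝 x] fun y => η y * pd i F y + pd i η y * F y := by
    intro i
    filter_upwards [hFd] with y hy
    exact pd_mul (hηd y) (hy.differentiableAt (by simp)) i
  have h2 : ∀ i, pd i (pd i (fun y => η y * F y)) x =
      η x * pd i (pd i F) x + 2 * (pd i η x * pd i F x) + pd i (pd i η) x * F x := by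
    intro i
    have hηd1 : DifferentiableAt ℝ (pd i η) x := (contDiff_pd hη i).differentiable (by simp) x
    have hF1 : DifferentiableAt ℝ F x := hF2.differentiableAt (by norm_num)
    rw [pd_congr i (h1 i), pd_add ((hηd x).fun_mul (hd i)) (hηd1.fun_mul hF1), pd_mul (hηd x) (hd i),
      pd_mul hηd1 hF1]
    ring
  have hη2 : ContDiffAt ℝ 2 η x :=
    hη.contDiffAt.of_le (WithTop.coe_le_coe.2 (le_top : (2 : ℕ∞) ≤ ⊤))
  have hl : Laplacian.laplacian (fun y => η y * F y) x =
      η x * Laplacian.laplacian F x + ∑ i, (2 * (pd i η x * pd i F x) + pd i (pd i η) x * F x) := by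
    rw [laplacian_eq_sum_pd (hη2.mul hF2), laplacian_eq_sum_pd hF2, Finset.mul_sum,
      ← Finset.sum_add_distrib]
    exact Finset.sum_congr rfl fun i _ => by rw [h2]; ring
  have hg0 := norm_nonneg (grad F (radialProj r x))
  have hF0 := norm_nonneg (F x)
  have hl0 := norm_nonneg (Laplacian.laplacian F (radialProj r x))
  have htg : ‖grad F x‖ ≤ 2 * r * ‖grad F (radialProj r x)‖ := by
    rw [hgx]; exact mul_le_mul_of_nonneg_right ht2 hg0
  have htl : ‖Laplacian.laplacian F x‖ ≤ (2 * r) ^ 2 * ‖Laplacian.laplacian F (radialProj r x)‖ := by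
    rw [hlx]; exact mul_le_mul_of_nonneg_right (pow_le_pow_left₀ ht0.le ht2 2) hl0
  have hpg : ∀ i, ‖pd i F x‖ ≤ 2 * r * ‖grad F (radialProj r x)‖ := fun i =>
    (norm_pd_le F x i).trans htg
  have hmr : 0 ≤ m * r := by positivity
  have hmr2 : 0 ≤ m * r ^ 2 := by positivity
  rw [hFx]
  refine ⟨?_, ?_, ?_⟩
  · rw [norm_mul]
    refine mul_le_mul_of_nonneg_right ((hm x).trans ?_) hF0
    nlinarith
  · have h5 : ∀ i, ‖pd i (fun y => η y * F y) x‖ ≤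
        m * (2 * r * ‖grad F (radialProj r x)‖) + m * ‖F x‖ := by
      intro i
      rw [(h1 i).self_of_nhds]
      refine (norm_add_le _ _).trans (add_le_add ?_ ?_)
      · rw [norm_mul]; exact mul_le_mul (hm x) (hpg i) (norm_nonneg _) hm0
      · rw [norm_mul]; exact mul_le_mul_of_nonneg_right (hm1 i x) hF0
    refine (norm_grad_le_sum _ _).trans ((Finset.sum_le_sum fun i _ => h5 i).trans ?_)
    simp only [Finset.sum_const, Finset.card_univ, Fintype.card_fin, nsmul_eq_mul]
    push_cast
    nlinarith [mul_nonneg hmr hg0, mul_nonneg hm0 hg0, mul_nonneg hmr2 hg0, mul_nonneg hmr hF0,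
      mul_nonneg hm0 hF0, mul_nonneg hmr2 hF0]
  · have h6 : ∀ i, ‖2 * (pd i η x * pd i F x) + pd i (pd i η) x * F x‖ ≤
        2 * (m * (2 * r * ‖grad F (radialProj r x)‖)) + m * ‖F x‖ := by
      intro i
      refine (norm_add_le _ _).trans (add_le_add ?_ ?_)
      · rw [norm_mul, norm_mul, Complex.norm_ofNat]
        exact mul_le_mul_of_nonneg_left (mul_le_mul (hm1 i x) (hpg i) (norm_nonneg _) hm0) (by norm_num)
      · rw [norm_mul]; exact mul_le_mul_of_nonneg_right (hm2 i i x) hF0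
    have h7 : ‖η x * Laplacian.laplacian F x‖ ≤
        m * ((2 * r) ^ 2 * ‖Laplacian.laplacian F (radialProj r x)‖) := by
      rw [norm_mul]; exact mul_le_mul (hm x) htl (norm_nonneg _) hm0
    rw [hl]
    refine (norm_add_le _ _).trans ((add_le_add h7 ((norm_sum_le _ _).trans
      (Finset.sum_le_sum fun i _ => h6 i))).trans ?_)
    simp only [Finset.sum_const, Finset.card_univ, Fintype.card_fin, nsmul_eq_mul]
    push_cast
    nlinarith [mul_nonneg hmr hg0, mul_nonneg hm0 hg0, mul_nonneg hmr2 hg0, mul_nonneg hmr hF0,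
      mul_nonneg hm0 hF0, mul_nonneg hmr2 hF0, mul_nonneg hmr hl0,
      mul_nonneg hm0 hl0, mul_nonneg hmr2 hl0]

end Cutoff

/-! ### Sobolev and interpolation inequalities for smooth functions on the sphere -/

section Sobolev

theorem aestronglyMeasurable_surf {G : Type*} [NormedAddCommGroup G]
    {h : E3 → G} (hh : ContinuousOn h {0}ᶜ) (r : ℝ) : AEStronglyMeasurable h (surf r) := by
  have h1 : (surf r).restrict {0}ᶜ = surf r :=
    Measure.restrict_eq_self_of_ae_mem (ae_surf_ne_zero r)
  rw [← h1]
  exact hh.aestronglyMeasurable (measurableSet_singleton (0 : E3)).compl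

theorem SmoothFun.continuousOn {F : E3 → ℂ} (hF : F ∈ SmoothFun) : ContinuousOn F {0}ᶜ :=
  hF.1.continuousOn

theorem SmoothFun.continuousOn_pd {F : E3 → ℂ} (hF : F ∈ SmoothFun) (i : Fin 3) :
    ContinuousOn (pd i F) {0}ᶜ := by
  intro x hx
  have h := ((SmoothFun.contDiffAt hF hx).fderiv_right (m := 0) (by simp)).clm_apply
    (contDiffAt_const (c := (EuclideanSpace.single i 1 : E3)))
  exact h.continuousAt.continuousWithinAt

theorem SmoothFun.continuousOn_grad {F : E3 → ℂ} (hF : F ∈ SmoothFun) :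
    ContinuousOn (grad F) {0}ᶜ := by
  have h : ContinuousOn (fun x i => pd i F x) {0}ᶜ :=
    continuousOn_pi.2 fun i => SmoothFun.continuousOn_pd hF i
  exact (PiLp.continuous_toLp 2 _).comp_continuousOn h

theorem SmoothFun.continuousOn_laplacian {F : E3 → ℂ} (hF : F ∈ SmoothFun) :
    ContinuousOn (Laplacian.laplacian F) {0}ᶜ := by
  have h : ContinuousOn (fun x => ∑ i, fderiv ℝ (fderiv ℝ F) x (EuclideanSpace.single i 1)
      (EuclideanSpace.single i 1)) {0}ᶜ := by
    refine continuousOn_finsetSum _ fun i _ x hx => ?_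
    have h1 : ContDiffAt ℝ 0 (fderiv ℝ (fderiv ℝ F)) x :=
      ((SmoothFun.contDiffAt hF hx).fderiv_right (m := 1)
        (WithTop.coe_le_coe.2 (le_top : (2 : ℕ∞) ≤ ⊤))).fderiv_right (m := 0) (by norm_num)
    exact ((h1.clm_apply contDiffAt_const).clm_apply
      contDiffAt_const).continuousAt.continuousWithinAt
  refine h.congr fun x hx => ?_
  have h2 : ContDiffAt ℝ 2 F x :=
    (SmoothFun.contDiffAt hF hx).of_le (WithTop.coe_le_coe.2 (le_top : (2 : ℕ∞) ≤ ⊤))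
  rw [laplacian_eq_sum_pd h2]
  exact Finset.sum_congr rfl fun i _ => pd_pd_eq h2 i i

theorem support_grad_subset (u : E3 → ℂ) : Function.support (grad u) ⊆ tsupport u := by
  intro x hx
  refine support_fderiv_subset ℝ (f := u) ?_
  intro h0
  refine hx ?_
  ext i
  simp [grad, h0]

theorem support_laplacian_subset (u : E3 → ℂ) :
    Function.support (Laplacian.laplacian u) ⊆ tsupport u := by
  intro x hx
  by_contra h
  refine hx ?_
  have h1 : u =ᶠ[𝓝 x] fun _ => 0 := notMem_tsupport_iff_eventuallyEq.1 h
  have h2 := InnerProductSpace.laplacian_congr_nhds h1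
  rw [h2.self_of_nhds]
  exact congrFun (InnerProductSpace.laplacian_const (E := E3) (c := (0 : ℂ))) x

variable {r : ℝ}

/-- Passes from the sphere to space: a function supported in a shell and dominated by values at the
radial projection inherits the bound in norm. -/
theorem exists_eLpNorm_le_of_shell (hr : 0 < r) {a b : ℝ} (ha : 0 ≤ a) (hab : a < b)
    {p : ENNReal} (hp : p ≠ ⊤) {M : ℝ} (hM : 0 ≤ M) : ∃ C : NNReal, ∀ {W : Type}
      [NormedAddCommGroup W] (w : E3 → W) (g : E3 → ℝ), AEStronglyMeasurable g (surf r) →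
      Function.support w ⊆ shell a b → (∀ x ∈ shell a b, ‖w x‖ ≤ M * ‖g (radialProj r x)‖) →
      eLpNorm w p volume ≤ C * eLpNorm g p (surf r) := by
  obtain ⟨c, -, hct, hc⟩ := exists_eLpNorm_shell hr ha hab hp
  lift c to NNReal using hct
  refine ⟨M.toNNReal * c, fun w g hg hs hw => ?_⟩
  rw [← eLpNorm_restrict_eq_of_support_subset hs]
  have h1 := eLpNorm_le_nnreal_smul_eLpNorm_of_ae_le_mul
    (μ := (volume : Measure E3).restrict (shell a b)) (c := M.toNNReal) (f := w)
    (g := g ∘ radialProj r) (by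
      filter_upwards [ae_restrict_mem (measurableSet_shell a b)] with x hx
      rw [← NNReal.coe_le_coe]
      simpa [Real.coe_toNNReal _ hM] using hw x hx) p
  rw [hc g hg] at h1
  refine h1.trans (le_of_eq ?_)
  rw [ENNReal.smul_def, smul_eq_mul, ENNReal.coe_mul, mul_assoc]

/-- The return direction: integrating over the shell costs only a nonzero constant, so a norm on the
sphere is bounded by a norm in space. -/
theorem exists_eLpNorm_surf_le (hr : 0 < r) {a b : ℝ} (ha : 0 ≤ a) (hab : a < b)
    {p : ENNReal} (hp : p ≠ ⊤) {M : ℝ} (hM : 0 ≤ M) : ∃ C : NNReal, ∀ {W : Type}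
      [NormedAddCommGroup W] (w h : E3 → W), AEStronglyMeasurable h (surf r) →
      (∀ x ∈ shell a b, ‖h (radialProj r x)‖ ≤ M * ‖w x‖) →
      eLpNorm h p (surf r) ≤ C * eLpNorm w p volume := by
  obtain ⟨c, hc0, hct, hc⟩ := exists_eLpNorm_shell hr ha hab hp
  lift c to NNReal using hct
  refine ⟨c⁻¹ * M.toNNReal, fun w h hh hw => ?_⟩
  have h1 := eLpNorm_le_nnreal_smul_eLpNorm_of_ae_le_mul
    (μ := (volume : Measure E3).restrict (shell a b)) (c := M.toNNReal) (g := w)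
    (f := h ∘ radialProj r) (by
      filter_upwards [ae_restrict_mem (measurableSet_shell a b)] with x hx
      rw [← NNReal.coe_le_coe]
      simpa [Real.coe_toNNReal _ hM] using hw x hx) p
  rw [hc h hh] at h1
  have hc0' : c ≠ 0 := by simpa using hc0
  calc eLpNorm h p (surf r) = (c⁻¹ : NNReal) * (c * eLpNorm h p (surf r)) := by
        rw [← mul_assoc, ← ENNReal.coe_mul, inv_mul_cancel₀ hc0', ENNReal.coe_one, one_mul]
    _ ≤ (c⁻¹ : NNReal) * (M.toNNReal • eLpNorm w p volume) := by
        gcongr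
        exact h1.trans (by gcongr; exact Measure.restrict_le_self)
    _ = _ := by rw [ENNReal.smul_def, smul_eq_mul, ENNReal.coe_mul, mul_assoc]

/-- The comparison of a smooth function on the sphere with a test function on `ℝ³`. -/
theorem exists_test_function (hr : 0 < r) : ∃ C : NNReal, ∀ F ∈ SmoothFun, ∃ u : E3 → ℂ,
    ContDiff ℝ (⊤ : ℕ∞) u ∧ HasCompactSupport u ∧
    eLpNorm u 2 volume ≤ C * eLpNorm F 2 (surf r) ∧
    eLpNorm (grad u) 2 volume ≤ C * (eLpNorm F 2 (surf r) + eLpNorm (grad F) 2 (surf r)) ∧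
    eLpNorm (Laplacian.laplacian u) 2 volume ≤ C * (eLpNorm F 2 (surf r) +
      eLpNorm (grad F) 2 (surf r) + eLpNorm (Laplacian.laplacian F) 2 (surf r)) ∧
    eLpNorm F 6 (surf r) ≤ C * eLpNorm u 6 volume ∧
    eLpNorm (grad F) 6 (surf r) ≤ C * eLpNorm (grad u) 6 volume ∧
    eLpNorm (grad F) 2 (surf r) ≤ C * eLpNorm (grad u) 2 volume := by
  obtain ⟨η, hη, hcη, hsη, hη1⟩ := exists_cutoff
  obtain ⟨M, hM, hb⟩ := exists_cutoff_bounds hη hcη hr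
  obtain ⟨C, hC⟩ := exists_eLpNorm_le_of_shell hr (a := 1 / 2) (b := 3) (by norm_num)
    (by norm_num) (p := 2) (by simp) hM
  obtain ⟨D, hD⟩ := exists_eLpNorm_surf_le hr (a := 13 / 10) (b := 18 / 10) (by norm_num)
    -- One constant serves twice: it is at least 1, as needed for F, and at least 2/r > |x|/r, the
    -- factor by which the gradient changes under projection when |x| < 18/10.
    (by norm_num) (p := 6) (by simp) (M := 1 + 2 / r) (by positivity)
  obtain ⟨E, hE⟩ := exists_eLpNorm_surf_le hr (a := 13 / 10) (b := 18 / 10) (by norm_num)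
    (by norm_num) (p := 2) (by simp) (M := 1 + 2 / r) (by positivity)
  refine ⟨C + D + E, fun F hF => ?_⟩
  set u : E3 → ℂ := fun x => η x * F x with hu
  have hF0 := aestronglyMeasurable_surf (SmoothFun.continuousOn hF) r
  have hF1 := aestronglyMeasurable_surf (SmoothFun.continuousOn_grad hF) r
  have hF2 := aestronglyMeasurable_surf (SmoothFun.continuousOn_laplacian hF) r
  have hts : tsupport u ⊆ shell (1 / 2) 3 := (tsupport_mul_subset_left).trans hsη
  have hne : ∀ x ∈ shell (13 / 10) (18 / 10), x ≠ 0 := by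
    rintro x hx rfl
    have := hx.1
    norm_num at this
  have hFu : ∀ x ∈ shell (13 / 10) (18 / 10), F (radialProj r x) = u x := fun x hx => by
    rw [SmoothFun.comp_radialProj hF hr (hne x hx), hu]
    simp [(hη1 x hx).self_of_nhds]
  have hgu : ∀ x ∈ shell (13 / 10) (18 / 10),
      ‖grad F (radialProj r x)‖ ≤ (1 + 2 / r) * ‖grad u x‖ := fun x hx => by
    have h1 : grad u x = grad F x := by
      have h2 : u =ᶠ[𝓝 x] F := by
        filter_upwards [hη1 x hx] with y hy
        simp [hu, hy]
      ext i
      exact pd_congr i h2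
    have hxn := norm_pos_iff.2 (hne x hx)
    rw [h1, SmoothFun.grad_smul_arg hF (div_pos hr hxn) x, norm_smul, Complex.norm_real,
      Real.norm_of_nonneg (div_pos hr hxn).le, ← mul_assoc]
    refine le_mul_of_one_le_left (norm_nonneg _) ?_
    have h3 : 2 / r * (r / ‖x‖) = 2 / ‖x‖ := by field_simp
    have h4 : 1 ≤ 2 / ‖x‖ := by
      rw [le_div_iff₀ hxn]
      linarith [hx.2]
    have h5 := (div_pos hr hxn).le
    nlinarith
  have hCle : (C : ENNReal) ≤ ((C + D + E : NNReal) : ENNReal) := by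
    norm_cast; rw [add_assoc]; exact le_self_add
  have hDle : (D : ENNReal) ≤ ((C + D + E : NNReal) : ENNReal) := by
    norm_cast; rw [add_comm C D, add_assoc]; exact le_self_add
  have hEle : (E : ENNReal) ≤ ((C + D + E : NNReal) : ENNReal) := by
    norm_cast; exact le_add_self
  refine ⟨u, contDiff_cutoff_mul hη hsη hF, hcη.mul_right, ?_, ?_, ?_, ?_, ?_, ?_⟩
  · refine (hC u (fun x => ‖F x‖) hF0.norm ((subset_tsupport u).trans hts) fun x hx => ?_).trans ?_
    · rw [norm_norm]; exact (hb F hF x hx).1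
    · rw [eLpNorm_norm]; gcongr
  · refine (hC (grad u) (fun x => ‖F x‖ + ‖grad F x‖) (hF0.norm.add hF1.norm)
      ((support_grad_subset u).trans hts) fun x hx => ?_).trans ?_
    · rw [Real.norm_of_nonneg (by positivity)]; exact (hb F hF x hx).2.1
    · refine mul_le_mul' hCle ?_
      refine (eLpNorm_add_le hF0.norm hF1.norm (by norm_num)).trans (le_of_eq ?_)
      rw [eLpNorm_norm, eLpNorm_norm]
  · refine (hC (Laplacian.laplacian u)
      (fun x => ‖F x‖ + ‖grad F x‖ + ‖Laplacian.laplacian F x‖)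
      ((hF0.norm.add hF1.norm).add hF2.norm)
      ((support_laplacian_subset u).trans hts) fun x hx => ?_).trans ?_
    · rw [Real.norm_of_nonneg (by positivity)]; exact (hb F hF x hx).2.2
    · refine mul_le_mul' hCle ?_
      refine (eLpNorm_add_le (hF0.norm.add hF1.norm) hF2.norm (by norm_num)).trans ?_
      rw [eLpNorm_norm]
      gcongr
      refine (eLpNorm_add_le hF0.norm hF1.norm (by norm_num)).trans (le_of_eq ?_)
      rw [eLpNorm_norm, eLpNorm_norm]
  · refine (hD u F hF0 fun x hx => ?_).trans (by gcongr)
    rw [hFu x hx]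
    exact le_mul_of_one_le_left (norm_nonneg _) (by linarith [div_pos two_pos hr])
  · exact (hD (grad u) (grad F) hF1 hgu).trans (by gcongr)
  · exact (hE (grad u) (grad F) hF1 hgu).trans (by gcongr)

/-- The Sobolev inequality `‖F‖₆ ≤ C ‖F‖_{H¹}` on the sphere. -/
theorem SmoothFun.exists_eLpNorm_six_le (hr : 0 < r) : ∃ C : NNReal, ∀ F ∈ SmoothFun,
    eLpNorm F 6 (surf r) ≤ C * (eLpNorm F 2 (surf r) + eLpNorm (grad F) 2 (surf r)) := by
  obtain ⟨C, hC⟩ := exists_test_function hr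
  obtain ⟨D, hD⟩ := InertialWaves.exists_eLpNorm_six_le
  refine ⟨C * D * C, fun F hF => ?_⟩
  obtain ⟨u, hu, hcu, -, h1, -, h6, -, -⟩ := hC F hF
  calc eLpNorm F 6 (surf r) ≤ C * eLpNorm u 6 volume := h6
    _ ≤ C * (D * (C * (eLpNorm F 2 (surf r) + eLpNorm (grad F) 2 (surf r)))) := by
        gcongr; exact (hD u hu hcu).trans (by gcongr)
    _ = _ := by push_cast; ring

/-- The Sobolev inequality `‖∇F‖₆ ≤ C ‖F‖_{H²}` on the sphere. -/
theorem SmoothFun.exists_eLpNorm_grad_six_le (hr : 0 < r) : ∃ C : NNReal, ∀ F ∈ SmoothFun,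
    eLpNorm (grad F) 6 (surf r) ≤ C * (eLpNorm F 2 (surf r) + eLpNorm (grad F) 2 (surf r) +
      eLpNorm (Laplacian.laplacian F) 2 (surf r)) := by
  obtain ⟨C, hC⟩ := exists_test_function hr
  obtain ⟨D, hD⟩ := InertialWaves.exists_eLpNorm_grad_le
  refine ⟨C * D * C, fun F hF => ?_⟩
  obtain ⟨u, hu, hcu, -, -, h2, -, h6, -⟩ := hC F hF
  calc eLpNorm (grad F) 6 (surf r) ≤ C * eLpNorm (grad u) 6 volume := h6
    _ ≤ C * (D * (C * (eLpNorm F 2 (surf r) + eLpNorm (grad F) 2 (surf r) +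
      eLpNorm (Laplacian.laplacian F) 2 (surf r)))) := by
        gcongr; exact (hD u hu hcu).trans (by gcongr)
    _ = _ := by push_cast; ring

/-- The interpolation inequality `‖∇F‖² ≤ C ‖F‖ ‖F‖_{H²}` on the sphere. -/
theorem SmoothFun.exists_eLpNorm_grad_sq_le (hr : 0 < r) : ∃ C : NNReal, ∀ F ∈ SmoothFun,
    eLpNorm (grad F) 2 (surf r) ^ 2 ≤ C * eLpNorm F 2 (surf r) * (eLpNorm F 2 (surf r) +
      eLpNorm (grad F) 2 (surf r) + eLpNorm (Laplacian.laplacian F) 2 (surf r)) := by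
  obtain ⟨C, hC⟩ := exists_test_function hr
  refine ⟨C ^ 4, fun F hF => ?_⟩
  obtain ⟨u, hu, hcu, h0, -, h2, -, -, h3⟩ := hC F hF
  calc eLpNorm (grad F) 2 (surf r) ^ 2 ≤ (C * eLpNorm (grad u) 2 volume) ^ 2 := by gcongr
    _ = C ^ 2 * eLpNorm (grad u) 2 volume ^ 2 := by ring
    _ ≤ C ^ 2 * ((C * eLpNorm F 2 (surf r)) * (C * (eLpNorm F 2 (surf r) +
      eLpNorm (grad F) 2 (surf r) + eLpNorm (Laplacian.laplacian F) 2 (surf r)))) := by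
        gcongr
        exact (eLpNorm_grad_sq_le hu hcu).trans (by gcongr)
    _ = _ := by push_cast; ring

end Sobolev

/-! ### The Poincaré inequality on bounded convex sets -/

section Poincare

theorem lintegral_comp_add_smul {H : E3 → ENNReal} (hH : Measurable H) (z : E3) {t : ℝ}
    (ht : t ≠ 0) : ∫⁻ y, H (z + t • y) = ENNReal.ofReal |(t ^ 3)⁻¹| * ∫⁻ y, H y := by
  have h := Measure.map_addHaar_smul (volume : Measure E3) ht
  rw [show Module.finrank ℝ E3 = 3 by simp [E3]] at h
  have hm : Measurable fun y : E3 => t • y := measurable_const_smul t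
  calc ∫⁻ y, H (z + t • y) = ∫⁻ y, H (z + y) ∂(Measure.map (fun y : E3 => t • y) volume) :=
        (lintegral_map (hH.comp (measurable_const_add z)) hm).symm
    _ = ENNReal.ofReal |(t ^ 3)⁻¹| * ∫⁻ y, H (z + y) := by
        rw [show (fun y : E3 => t • y) = (t • · : E3 → E3) from rfl, h, lintegral_smul_measure]
        rfl
    _ = _ := by rw [lintegral_add_left_eq_self]

/-- Averages along segments in a convex set. -/
theorem setLIntegral_segment_le {K : Set E3} (hK : MeasurableSet K) (hc : Convex ℝ K)
    {H : E3 → ENNReal} (hH : Measurable H) {t : ℝ} (ht : t ∈ Icc (1 / 2 : ℝ) 1) {x : E3}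
    (hx : x ∈ K) : ∫⁻ y in K, H ((1 - t) • x + t • y) ≤ 8 * ∫⁻ y in K, H y := by
  have ht0 : 0 < t := by linarith [ht.1]
  calc ∫⁻ y in K, H ((1 - t) • x + t • y) ≤ ∫⁻ y, K.indicator H ((1 - t) • x + t • y) := by
        rw [← lintegral_indicator hK]
        refine lintegral_mono fun y => ?_
        by_cases hy : y ∈ K
        · have : (1 - t) • x + t • y ∈ K := hc hx hy (by linarith [ht.2]) ht0.le (by ring)
          simp [hy, this]
        · simp [hy]
    _ = ENNReal.ofReal |(t ^ 3)⁻¹| * ∫⁻ y in K, H y := by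
        rw [lintegral_comp_add_smul (hH.indicator hK) _ ht0.ne', lintegral_indicator hK]
    _ ≤ 8 * ∫⁻ y in K, H y := by
        gcongr
        -- The Jacobian factor t⁻³ is at most 8 because t ≥ 1/2.
        rw [abs_of_pos (by positivity)]
        refine ENNReal.ofReal_le_of_le_toReal ?_
        rw [inv_le_comm₀ (by positivity) (by norm_num)]
        have := pow_le_pow_left₀ (by norm_num) ht.1 3
        norm_num at this ⊢
        linarith

/-- The fundamental theorem of calculus along the segment, followed by Cauchy–Schwarz in t. The
segment must avoid the origin, where F need not be differentiable. -/
theorem enorm_sub_sq_le {F : E3 → ℂ} (hF : F ∈ SmoothFun) {x y : E3}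
    (hxy : ∀ t ∈ Icc (0 : ℝ) 1, (1 - t) • x + t • y ≠ 0) :
    ‖F y - F x‖ₑ ^ 2 ≤ ‖y - x‖ₑ ^ 2 *
      ∫⁻ t in Ioc (0 : ℝ) 1, ‖fderiv ℝ F ((1 - t) • x + t • y)‖ₑ ^ 2 := by
  set γ : ℝ → E3 := fun t => (1 - t) • x + t • y with hγ
  have hγc : Continuous γ := by fun_prop
  have hγd : ∀ t, HasDerivAt γ (y - x) t := by
    intro t
    have h1 : HasDerivAt (fun t : ℝ => (1 - t) • x) (-x) t := by
      simpa using ((hasDerivAt_id t).const_sub 1).smul_const x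
    have h2 : HasDerivAt (fun t : ℝ => t • y) y t := by
      simpa using (hasDerivAt_id t).smul_const y
    have h3 := h1.add h2
    rwa [neg_add_eq_sub] at h3
  have hfc : ContinuousOn (fun t => fderiv ℝ F (γ t)) (Icc 0 1) := by
    have h : ContinuousOn (fderiv ℝ F) {0}ᶜ := fun z hz =>
      ((SmoothFun.contDiffAt hF hz).fderiv_right (m := 0) (by simp)).continuousAt.continuousWithinAt
    exact h.comp hγc.continuousOn fun t ht => hxy t ht
  have hder : ∀ t ∈ uIcc (0 : ℝ) 1, HasDerivAt (fun t => F (γ t)) (fderiv ℝ F (γ t) (y - x)) t := by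
    intro t ht
    rw [uIcc_of_le zero_le_one] at ht
    exact ((SmoothFun.contDiffAt hF (hxy t ht)).differentiableAt
      (by simp)).hasFDerivAt.comp_hasDerivAt t (hγd t)
  have hint : IntervalIntegrable (fun t => fderiv ℝ F (γ t) (y - x)) volume 0 1 := by
    refine ContinuousOn.intervalIntegrable ?_
    rw [uIcc_of_le zero_le_one]
    exact hfc.clm_apply continuousOn_const
  have hftc := intervalIntegral.integral_eq_sub_of_hasDerivAt hder hint
  have h1 : F y - F x = ∫ t in Ioc (0 : ℝ) 1, fderiv ℝ F (γ t) (y - x) := by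
    rw [← intervalIntegral.integral_of_le zero_le_one, hftc]
    simp [hγ]
  have h2 : ‖F y - F x‖ₑ ≤ (∫⁻ t in Ioc (0 : ℝ) 1, ‖fderiv ℝ F (γ t)‖ₑ) * ‖y - x‖ₑ := by
    rw [h1, ← lintegral_mul_const' _ _ enorm_ne_top]
    exact (enorm_integral_le_lintegral_enorm _).trans
      (lintegral_mono fun t => ContinuousLinearMap.le_opENorm _ _)
  have hm : AEStronglyMeasurable (fun t => fderiv ℝ F (γ t)) (volume.restrict (Ioc (0 : ℝ) 1)) :=
    (hfc.mono Ioc_subset_Icc_self).aestronglyMeasurable measurableSet_Ioc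
  have h3 := lintegral_mul_le_eLpNorm (μ := volume.restrict (Ioc (0 : ℝ) 1)) hm
    (aestronglyMeasurable_const (b := (1 : ℝ)))
  simp only [enorm_one, mul_one] at h3
  have h4 : eLpNorm (fun _ : ℝ => (1 : ℝ)) 2 (volume.restrict (Ioc (0 : ℝ) 1)) = 1 := by
    rw [eLpNorm_const _ (by norm_num) (by simp)]
    simp
  rw [h4, mul_one] at h3
  calc ‖F y - F x‖ₑ ^ 2 ≤ ((∫⁻ t in Ioc (0 : ℝ) 1, ‖fderiv ℝ F (γ t)‖ₑ) * ‖y - x‖ₑ) ^ 2 := by gcongr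
    _ = ‖y - x‖ₑ ^ 2 * (∫⁻ t in Ioc (0 : ℝ) 1, ‖fderiv ℝ F (γ t)‖ₑ) ^ 2 := by ring
    _ ≤ ‖y - x‖ₑ ^ 2 *
        eLpNorm (fun t => fderiv ℝ F (γ t)) 2 (volume.restrict (Ioc (0 : ℝ) 1)) ^ 2 := by gcongr
    _ = _ := by rw [eLpNorm_two_sq]

/-- For `x ≠ 0` almost every segment starting at `x` avoids the origin. -/
theorem ae_segment_ne_zero {x : E3} (hx : x ≠ 0) :
    ∀ᵐ y : E3, ∀ t ∈ Icc (0 : ℝ) 1, (1 - t) • x + t • y ≠ 0 := by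
  have hs : (Submodule.span ℝ {x} : Submodule ℝ E3) ≠ ⊤ := by
    intro h
    have h1 := finrank_span_singleton (K := ℝ) hx
    rw [h, finrank_top] at h1
    simp [E3] at h1
  have h0 := Measure.addHaar_submodule (volume : Measure E3) _ hs
  filter_upwards [compl_mem_ae_iff.2 h0] with y hy t ht h
  rcases eq_or_ne t 0 with rfl | ht0
  · simp at h; exact hx h
  · refine hy ?_
    rw [SetLike.mem_coe, Submodule.mem_span_singleton]
    refine ⟨-(t⁻¹ * (1 - t)), ?_⟩
    have h1 : t • y = -((1 - t) • x) := by
      rw [eq_neg_iff_add_eq_zero, add_comm]; exact h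
    have h2 : y = t⁻¹ • (t • y) := by rw [smul_smul, inv_mul_cancel₀ ht0, one_smul]
    rw [h2, h1, smul_neg, smul_smul, neg_smul]

/-- Integrate the squared difference along segments and exchange the order of integration. For each
fixed t, one of the two endpoints carries weight at least 1/2; changing variables in that endpoint
keeps the Jacobian bounded. -/
theorem lintegral_lintegral_enorm_sub_sq_le {K : Set E3} (hK : MeasurableSet K)
    (hc : Convex ℝ K) {d : ENNReal} (hd : ∀ x ∈ K, ∀ y ∈ K, ‖y - x‖ₑ ≤ d) {F : E3 → ℂ}
    (hF : F ∈ SmoothFun) :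
    ∫⁻ x in K, ∫⁻ y in K, ‖F y - F x‖ₑ ^ 2 ≤
      8 * d ^ 2 * volume K * ∫⁻ x in K, ‖fderiv ℝ F x‖ₑ ^ 2 := by
  set H : E3 → ENNReal := fun x => ‖fderiv ℝ F x‖ₑ ^ 2 with hHdef
  have hH : Measurable H := (measurable_fderiv ℝ F).enorm.pow_const 2
  have hjoint : Measurable fun p : ℝ × E3 × E3 => H ((1 - p.1) • p.2.1 + p.1 • p.2.2) := by
    refine hH.comp ?_
    fun_prop
  have hJ : ∀ t ∈ Ioc (0 : ℝ) 1, ∫⁻ x in K, ∫⁻ y in K, H ((1 - t) • x + t • y) ≤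
      8 * volume K * ∫⁻ x in K, H x := by
    intro t ht
    -- For t ≥ 1/2 the inner integral over y is used; otherwise x and y change roles and t becomes 1
    -- - t.
    rcases le_total (1 / 2) t with h | h
    · calc _ ≤ ∫⁻ x in K, 8 * ∫⁻ y in K, H y :=
            setLIntegral_mono' hK fun x hx => setLIntegral_segment_le hK hc hH ⟨h, ht.2⟩ hx
        _ = _ := by rw [setLIntegral_const]; ring
    · have hm : Measurable fun p : E3 × E3 => H ((1 - t) • p.1 + t • p.2) :=
        hH.comp (by fun_prop)
      rw [lintegral_lintegral_swap hm.aemeasurable]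
      calc _ ≤ ∫⁻ x in K, 8 * ∫⁻ y in K, H y := by
            refine setLIntegral_mono' hK fun y hy => ?_
            have := setLIntegral_segment_le hK hc hH (t := 1 - t) ⟨by linarith, by linarith [ht.1]⟩ hy
            simpa only [sub_sub_cancel, add_comm] using this
        _ = _ := by rw [setLIntegral_const]; ring
  have hpt : ∀ x ∈ K, x ≠ 0 → ∫⁻ y in K, ‖F y - F x‖ₑ ^ 2 ≤
      d ^ 2 * ∫⁻ y in K, ∫⁻ t in Ioc (0 : ℝ) 1, H ((1 - t) • x + t • y) := by
    intro x hx hx0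
    have hm : Measurable fun y => ∫⁻ t in Ioc (0 : ℝ) 1, H ((1 - t) • x + t • y) := by
      refine Measurable.lintegral_prod_right' (f := fun p : E3 × ℝ => H ((1 - p.2) • x + p.2 • p.1)) ?_
      exact hH.comp (by fun_prop)
    rw [← lintegral_const_mul _ hm]
    refine lintegral_mono_ae ?_
    filter_upwards [ae_restrict_of_ae (ae_segment_ne_zero hx0), ae_restrict_mem hK] with y hy hyK
    refine (enorm_sub_sq_le hF hy).trans ?_
    gcongr
    exact hd x hx y hyK
  have hae : ∀ᵐ x : E3, x ≠ 0 := by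
    exact compl_mem_ae_iff.2 (measure_singleton (0 : E3))
  have hm1 : Measurable fun x => ∫⁻ y in K, ∫⁻ t in Ioc (0 : ℝ) 1, H ((1 - t) • x + t • y) := by
    refine Measurable.lintegral_prod_right' (f := fun p : E3 × E3 =>
      ∫⁻ t in Ioc (0 : ℝ) 1, H ((1 - t) • p.1 + t • p.2)) ?_
    refine Measurable.lintegral_prod_right' (f := fun p : (E3 × E3) × ℝ =>
      H ((1 - p.2) • p.1.1 + p.2 • p.1.2)) ?_
    exact hH.comp (by fun_prop)
  calc ∫⁻ x in K, ∫⁻ y in K, ‖F y - F x‖ₑ ^ 2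
      ≤ ∫⁻ x in K, d ^ 2 * ∫⁻ y in K, ∫⁻ t in Ioc (0 : ℝ) 1, H ((1 - t) • x + t • y) := by
        refine lintegral_mono_ae ?_
        filter_upwards [ae_restrict_of_ae hae, ae_restrict_mem hK] with x hx0 hx using hpt x hx hx0
    _ = d ^ 2 * ∫⁻ x in K, ∫⁻ t in Ioc (0 : ℝ) 1, ∫⁻ y in K, H ((1 - t) • x + t • y) := by
        rw [lintegral_const_mul _ hm1]
        congr 1
        refine lintegral_congr fun x => ?_
        refine lintegral_lintegral_swap (Measurable.aemeasurable ?_)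
        exact hH.comp (f := fun p : E3 × ℝ => (1 - p.2) • x + p.2 • p.1) (by fun_prop)
    _ = d ^ 2 * ∫⁻ t in Ioc (0 : ℝ) 1, ∫⁻ x in K, ∫⁻ y in K, H ((1 - t) • x + t • y) := by
        congr 1
        refine lintegral_lintegral_swap (Measurable.aemeasurable ?_)
        refine Measurable.lintegral_prod_right' (f := fun p : (E3 × ℝ) × E3 =>
          H ((1 - p.1.2) • p.1.1 + p.1.2 • p.2)) ?_
        exact hH.comp (by fun_prop)
    _ ≤ d ^ 2 * ∫⁻ t in Ioc (0 : ℝ) 1, 8 * volume K * ∫⁻ x in K, H x := by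
        gcongr d ^ 2 * ?_
        exact setLIntegral_mono' measurableSet_Ioc hJ
    _ = _ := by
        rw [setLIntegral_const]
        simp only [Real.volume_Ioc, sub_zero, ENNReal.ofReal_one, mul_one]
        ring

/-- Constancy along rays reduces boundedness to compactness of the unit sphere, apart from the
arbitrary value at the origin. -/
theorem SmoothFun.exists_bound {F : E3 → ℂ} (hF : F ∈ SmoothFun) :
    ∃ M : ℝ, ∀ x, ‖F x‖ ≤ M := by
  have hc : ContinuousOn F (Metric.sphere 0 1) :=
    (SmoothFun.continuousOn hF).mono fun x hx h => by
      rw [mem_singleton_iff.1 h] at hx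
      simp at hx
  obtain ⟨M, hM⟩ := (isCompact_sphere (0 : E3) 1).exists_bound_of_continuousOn hc
  refine ⟨max M ‖F 0‖, fun x => ?_⟩
  rcases eq_or_ne x 0 with rfl | hx
  · exact le_max_right _ _
  · refine le_max_of_le_left ?_
    have hxn := norm_pos_iff.2 hx
    rw [← hF.2 ‖x‖⁻¹ (inv_pos.2 hxn) x]
    refine hM _ ?_
    rw [mem_sphere_zero_iff_norm, norm_smul, norm_inv, norm_norm, inv_mul_cancel₀ hxn.ne']

theorem SmoothFun.aestronglyMeasurable {F : E3 → ℂ} (hF : F ∈ SmoothFun) :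
    AEStronglyMeasurable F (volume : Measure E3) := by
  rw [← restrict_compl_singleton (μ := (volume : Measure E3)) (0 : E3)]
  exact (SmoothFun.continuousOn hF).aestronglyMeasurable (measurableSet_singleton (0 : E3)).compl

/-- The Poincaré inequality on a bounded convex set. -/
theorem lintegral_enorm_sq_le_of_convex {K : Set E3} (hK : MeasurableSet K)
    (hc : Convex ℝ K) (hKt : volume K ≠ ⊤) {d : ENNReal}
    (hd : ∀ x ∈ K, ∀ y ∈ K, ‖y - x‖ₑ ≤ d) :
    ∃ c : NNReal, ∀ F ∈ SmoothFun, ∫⁻ x in K, ‖F x‖ₑ ^ 2 ≤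
      c * ‖∫ x in K, F x‖ₑ ^ 2 + 16 * d ^ 2 * ∫⁻ x in K, ‖fderiv ℝ F x‖ₑ ^ 2 := by
  -- The degenerate case must be covered, since the inequality will be applied to grid cells that
  -- may miss the ball.
  rcases eq_or_ne (volume K) 0 with h0 | h0
  · refine ⟨0, fun F _ => ?_⟩
    rw [Measure.restrict_eq_zero.2 h0]
    simp
  refine ⟨2 * (volume K)⁻¹.toNNReal, fun F hF => ?_⟩
  have : IsFiniteMeasure ((volume : Measure E3).restrict K) := ⟨by simpa using hKt.lt_top⟩
  obtain ⟨M, hM⟩ := SmoothFun.exists_bound hF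
  have hm := SmoothFun.aestronglyMeasurable hF
  have hi : Integrable F ((volume : Measure E3).restrict K) :=
    Integrable.of_bound hm.restrict M (Filter.Eventually.of_forall hM)
  set v := volume K with hv
  set I := ∫ x in K, F x with hI
  -- Pointwise comparison with the mean: |K| F(x) = ∫F - ∫(F(y) - F(x)) dy. The square of the last
  -- integral is estimated by Cauchy–Schwarz.
  have hpt : ∀ x, v ^ 2 * ‖F x‖ₑ ^ 2 ≤ 2 * ‖I‖ₑ ^ 2 + 2 * v * ∫⁻ y in K, ‖F y - F x‖ₑ ^ 2 := by
    intro x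
    have h1 : v * ‖F x‖ₑ ≤ ‖I‖ₑ + ∫⁻ y in K, ‖F y - F x‖ₑ := by
      have h2 : I - (∫ y in K, (F y - F x)) = (v.toReal : ℂ) * F x := by
        rw [integral_sub hi (integrable_const _), integral_const]
        simp [hI, hv, Measure.real]
      calc v * ‖F x‖ₑ = ‖(v.toReal : ℂ) * F x‖ₑ := by
            rw [enorm_mul, ← ofReal_norm (v.toReal : ℂ), Complex.norm_real,
              Real.norm_of_nonneg ENNReal.toReal_nonneg, ENNReal.ofReal_toReal hKt]
        _ ≤ ‖I‖ₑ + ‖∫ y in K, (F y - F x)‖ₑ := by rw [← h2]; exact enorm_sub_le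
        _ ≤ _ := by gcongr; exact enorm_integral_le_lintegral_enorm _
    have h3 : (∫⁻ y in K, ‖F y - F x‖ₑ) ^ 2 ≤ v * ∫⁻ y in K, ‖F y - F x‖ₑ ^ 2 := by
      have h4 := lintegral_mul_le_eLpNorm (μ := (volume : Measure E3).restrict K)
        (f := fun y => F y - F x) (hm.restrict.sub aestronglyMeasurable_const)
        (aestronglyMeasurable_const (b := (1 : ℝ)))
      simp only [enorm_one, mul_one] at h4
      calc _ ≤ (eLpNorm (fun y => F y - F x) 2 ((volume : Measure E3).restrict K) *
            eLpNorm (fun _ => (1 : ℝ)) 2 ((volume : Measure E3).restrict K)) ^ 2 := by gcongr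
        _ = _ := by
            rw [mul_pow, eLpNorm_two_sq, eLpNorm_two_sq]
            simp [mul_comm, hv]
    calc v ^ 2 * ‖F x‖ₑ ^ 2 = (v * ‖F x‖ₑ) ^ 2 := by ring
      _ ≤ (‖I‖ₑ + ∫⁻ y in K, ‖F y - F x‖ₑ) ^ 2 := by gcongr
      _ ≤ 2 * (‖I‖ₑ ^ 2 + (∫⁻ y in K, ‖F y - F x‖ₑ) ^ 2) := by
          have := ENNReal.rpow_add_le_mul_rpow_add_rpow ‖I‖ₑ (∫⁻ y in K, ‖F y - F x‖ₑ)
            (p := 2) (by norm_num)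
          norm_num at this
          exact this
      _ ≤ 2 * (‖I‖ₑ ^ 2 + v * ∫⁻ y in K, ‖F y - F x‖ₑ ^ 2) := by gcongr
      _ = _ := by ring
  have hFm : AEMeasurable (fun x => ‖F x‖ₑ ^ 2) ((volume : Measure E3).restrict K) :=
    hm.restrict.enorm.pow_const 2
  have hint : v ^ 2 * ∫⁻ x in K, ‖F x‖ₑ ^ 2 ≤
      2 * ‖I‖ₑ ^ 2 * v + 2 * v * (8 * d ^ 2 * v * ∫⁻ x in K, ‖fderiv ℝ F x‖ₑ ^ 2) := by
    rw [← lintegral_const_mul'' _ hFm]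
    refine (lintegral_mono hpt).trans ?_
    rw [lintegral_add_left measurable_const, setLIntegral_const,
      lintegral_const_mul' _ _ (ENNReal.mul_ne_top (by simp) hKt)]
    gcongr
    exact lintegral_lintegral_enorm_sub_sq_le hK hc hd hF
  have hvi : v⁻¹ ≠ ⊤ := ENNReal.inv_ne_top.2 h0
  have hvv : v * v⁻¹ = 1 := ENNReal.mul_inv_cancel h0 hKt
  calc ∫⁻ x in K, ‖F x‖ₑ ^ 2 = (v * v⁻¹) ^ 2 * ∫⁻ x in K, ‖F x‖ₑ ^ 2 := by rw [hvv]; simp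
    _ = v⁻¹ ^ 2 * (v ^ 2 * ∫⁻ x in K, ‖F x‖ₑ ^ 2) := by ring
    _ ≤ v⁻¹ ^ 2 * (2 * ‖I‖ₑ ^ 2 * v + 2 * v * (8 * d ^ 2 * v *
        ∫⁻ x in K, ‖fderiv ℝ F x‖ₑ ^ 2)) := by gcongr
    _ = (2 * v⁻¹) * ‖I‖ₑ ^ 2 * (v * v⁻¹) + 16 * d ^ 2 * (v * v⁻¹) ^ 2 *
        ∫⁻ x in K, ‖fderiv ℝ F x‖ₑ ^ 2 := by ring
    _ = _ := by
        rw [hvv, ENNReal.coe_mul, ENNReal.coe_toNNReal hvi]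
        simp

end Poincare

/-! ### Poincaré and Rellich inequalities on the sphere -/

section Rellich

variable {r : ℝ}

theorem restrict_shell_eq_ball :
    (volume : Measure E3).restrict (shell 0 1) = volume.restrict (Metric.ball 0 1) := by
  have h : shell 0 1 = Metric.ball (0 : E3) 1 \ {0} := by
    ext x
    simp [shell, and_comm]
  rw [h]
  exact Measure.restrict_congr_set (sdiff_null_ae_eq_self (measure_singleton (0 : E3)))

theorem exists_map_ball (hr : 0 < r) : ∃ c : NNReal, c ≠ 0 ∧
    ((volume : Measure E3).restrict (Metric.ball 0 1)).map (radialProj r) = c • surf r := by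
  obtain ⟨c, h0, ht, h⟩ := exists_map_shell hr le_rfl one_pos
  lift c to NNReal using ht
  rw [restrict_shell_eq_ball] at h
  exact ⟨c, by simpa using h0, h⟩

theorem lintegral_ball_comp (hr : 0 < r) : ∃ c : NNReal, c ≠ 0 ∧ ∀ F ∈ SmoothFun,
    ∫⁻ x in Metric.ball 0 1, ‖F x‖ₑ ^ 2 = c * eLpNorm F 2 (surf r) ^ 2 := by
  obtain ⟨c, h0, hc⟩ := exists_map_ball hr
  refine ⟨c, h0, fun F hF => ?_⟩
  have hF0 := aestronglyMeasurable_surf (SmoothFun.continuousOn hF) r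
  rw [eLpNorm_two_sq]
  calc ∫⁻ x in Metric.ball 0 1, ‖F x‖ₑ ^ 2
      = ∫⁻ x in Metric.ball 0 1, ‖F (radialProj r x)‖ₑ ^ 2 := by
        refine lintegral_congr_ae (ae_restrict_of_ae ?_)
        filter_upwards [compl_mem_ae_iff.2 (measure_singleton (0 : E3))] with x hx
        rw [SmoothFun.comp_radialProj hF hr hx]
    _ = ∫⁻ x, ‖F x‖ₑ ^ 2 ∂(c • surf r) := by
        rw [← hc, lintegral_map' ?_ (measurable_radialProj r).aemeasurable]
        rw [hc]
        exact ((hF0.smul_measure (c : ENNReal)).enorm).pow_const 2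
    _ = _ := by
        rw [show (c • surf r) = (c : ENNReal) • surf r from rfl, lintegral_smul_measure]
        rfl

/-- The squared derivative blows up like |x|⁻² at the origin, which is integrable in dimension 3:
the radial weight t²(r/t)² is constant. This makes convex sets containing the origin usable. -/
theorem lintegral_ball_fderiv_le (hr : 0 < r) : ∃ A : NNReal, ∀ F ∈ SmoothFun,
    ∫⁻ x in Metric.ball 0 1, ‖fderiv ℝ F x‖ₑ ^ 2 ≤ A * eLpNorm (grad F) 2 (surf r) ^ 2 := by
  set a : ℝ → ENNReal := (Iio (1 : ℝ)).indicator fun t => ENNReal.ofReal ((r / t) ^ 2) with ha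
  have ham : Measurable a :=
    ((measurable_const.div measurable_id).pow_const 2).ennreal_ofReal.indicator measurableSet_Iio
  have hA : (∫⁻ t in Ioi (0 : ℝ), ENNReal.ofReal (t ^ 2) * a t) * (ENNReal.ofReal (r ^ 2))⁻¹ ≠ ⊤ := by
    refine ENNReal.mul_ne_top ?_ (by simpa using hr.ne')
    have : ∫⁻ t in Ioi (0 : ℝ), ENNReal.ofReal (t ^ 2) * a t ≤
        ∫⁻ t in Ioi (0 : ℝ), (Iio 1).indicator (fun _ => ENNReal.ofReal (r ^ 2)) t := by
      refine setLIntegral_mono' measurableSet_Ioi fun t ht => ?_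
      by_cases h1 : t ∈ Iio (1 : ℝ)
      · rw [ha, indicator_of_mem h1, indicator_of_mem h1, ← ENNReal.ofReal_mul (by positivity)]
        refine ENNReal.ofReal_le_ofReal (le_of_eq ?_)
        have : t ≠ 0 := ne_of_gt ht
        field_simp
      · simp [ha, h1]
    refine ne_top_of_le_ne_top ?_ this
    rw [setLIntegral_indicator measurableSet_Iio, setLIntegral_const]
    refine ENNReal.mul_ne_top ENNReal.ofReal_ne_top ?_
    rw [inter_comm, Ioi_inter_Iio]
    simp
  lift ((∫⁻ t in Ioi (0 : ℝ), ENNReal.ofReal (t ^ 2) * a t) * (ENNReal.ofReal (r ^ 2))⁻¹) to NNReal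
    using hA with A hAeq
  refine ⟨9 * A, fun F hF => ?_⟩
  have hm : Measurable fun x => ‖fderiv ℝ F x‖ₑ ^ 2 := (measurable_fderiv ℝ F).enorm.pow_const 2
  have hpol := lintegral_polar hr ham hm
  rw [← hAeq] at hpol
  have hle : ∫⁻ x, ‖fderiv ℝ F x‖ₑ ^ 2 ∂(surf r) ≤ eLpNorm (grad F) 2 (surf r) ^ 2 := by
    rw [eLpNorm_two_sq]
    refine lintegral_mono fun x => ?_
    gcongr
    rw [← ofReal_norm, ← ofReal_norm]
    exact ENNReal.ofReal_le_ofReal (norm_fderiv_le_grad F x)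
  calc ∫⁻ x in Metric.ball 0 1, ‖fderiv ℝ F x‖ₑ ^ 2
      ≤ ∫⁻ x, 1 * (a ‖x‖ * ‖fderiv ℝ F (radialProj r x)‖ₑ ^ 2) := by
        rw [← lintegral_indicator Metric.isOpen_ball.measurableSet]
        refine lintegral_mono_ae ?_
        filter_upwards [compl_mem_ae_iff.2 (measure_singleton (0 : E3))] with x hx
        by_cases h1 : x ∈ Metric.ball (0 : E3) 1
        · have hxn : 0 < ‖x‖ := norm_pos_iff.2 hx
          have h2 : ‖x‖ ∈ Iio (1 : ℝ) := mem_ball_zero_iff.1 h1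
          have hs : fderiv ℝ F x = (r / ‖x‖) • fderiv ℝ F (radialProj r x) := by
            have h3 : F = fun y => F ((r / ‖x‖) • y) :=
              funext fun y => (hF.2 _ (div_pos hr hxn) y).symm
            conv_lhs => rw [h3]
            rw [fderiv_comp_smul]
            rfl
          rw [indicator_of_mem h1, ha, indicator_of_mem h2, hs, enorm_smul, mul_pow,
            one_mul, ← ofReal_norm, Real.norm_of_nonneg (div_pos hr hxn).le,
            ENNReal.ofReal_pow (div_pos hr hxn).le]
        · simp [h1]
    _ = A * ∫⁻ x, ‖fderiv ℝ F x‖ₑ ^ 2 ∂(surf r) := by simp_rw [one_mul]; exact hpol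
    _ ≤ (9 * A : NNReal) * eLpNorm (grad F) 2 (surf r) ^ 2 := by
        gcongr
        exact le_mul_of_one_le_left zero_le (by norm_num)

/-- One constant works for every subset of the ball, so averages over all grid cells are averages
over the sphere against uniformly dominated measures, hence bounded functionals on L². -/
theorem map_radialProj_le (hr : 0 < r) : ∃ c : NNReal, ∀ K : Set E3, K ⊆ Metric.ball 0 1 →
    ((volume : Measure E3).restrict K).map (radialProj r) ≤ c • surf r := by
  obtain ⟨c, -, hc⟩ := exists_map_ball hr
  refine ⟨c, fun K hK => ?_⟩
  rw [← hc]
  exact Measure.map_mono (Measure.restrict_mono hK le_rfl) (measurable_radialProj r)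

theorem setIntegral_eq_integral_map (hr : 0 < r) {K : Set E3} (hK : K ⊆ Metric.ball 0 1)
    {F : E3 → ℂ} (hF : F ∈ SmoothFun) :
    ∫ x in K, F x = ∫ x, F x ∂(((volume : Measure E3).restrict K).map (radialProj r)) := by
  obtain ⟨c, hc⟩ := map_radialProj_le hr
  have hF0 := aestronglyMeasurable_surf (SmoothFun.continuousOn hF) r
  rw [integral_map (measurable_radialProj r).aemeasurable
    ((hF0.smul_measure (c : ENNReal)).mono_measure (hc K hK))]
  refine integral_congr_ae (ae_restrict_of_ae ?_)
  filter_upwards [compl_mem_ae_iff.2 (measure_singleton (0 : E3))] with x hx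
  rw [SmoothFun.comp_radialProj hF hr hx]

/-- The Poincaré inequality on the sphere. -/
theorem SmoothFun.exists_poincare (hr : 0 < r) : ∃ C : NNReal, ∀ F ∈ SmoothFun,
    eLpNorm F 2 (surf r) ^ 2 ≤
      C * (‖∫ x, F x ∂(surf r)‖ₑ ^ 2 + eLpNorm (grad F) 2 (surf r) ^ 2) := by
  obtain ⟨a, ha0, ha⟩ := lintegral_ball_comp hr
  obtain ⟨A, hA⟩ := lintegral_ball_fderiv_le hr
  obtain ⟨b, -, hb⟩ := exists_map_ball hr
  obtain ⟨c, hc⟩ := lintegral_enorm_sq_le_of_convex (K := Metric.ball (0 : E3) 1)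
    Metric.isOpen_ball.measurableSet (convex_ball _ _) measure_ball_lt_top.ne (d := 2) (by
      intro x hx y hy
      rw [← ofReal_norm]
      refine ENNReal.ofReal_le_of_le_toReal ?_
      have := norm_sub_le y x
      rw [mem_ball_zero_iff] at hx hy
      norm_num
      linarith)
  -- The unit ball has diameter 2, and 64 = 16 · 2².
  refine ⟨a⁻¹ * (c * b ^ 2 + 64 * A), fun F hF => ?_⟩
  have h := hc F hF
  rw [ha F hF, setIntegral_eq_integral_map hr le_rfl hF, hb] at h
  have hsm : ∫ x, F x ∂(b • surf r) = (b : ℝ) • ∫ x, F x ∂(surf r) := by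
    rw [integral_smul_nnreal_measure]; rfl
  rw [hsm, enorm_smul, mul_pow] at h
  have hbn : ‖(b : ℝ)‖ₑ = b := by
    exact (Real.enorm_of_nonneg b.2).trans ENNReal.ofReal_coe_nnreal
  rw [hbn] at h
  have hpos : (a⁻¹ : NNReal) * (a : ENNReal) = 1 := by
    rw [← ENNReal.coe_mul, inv_mul_cancel₀ ha0, ENNReal.coe_one]
  calc eLpNorm F 2 (surf r) ^ 2 = (a⁻¹ : NNReal) * (a * eLpNorm F 2 (surf r) ^ 2) := by
        rw [← mul_assoc, hpos, one_mul]
    _ ≤ (a⁻¹ : NNReal) * (c * (b ^ 2 * ‖∫ x, F x ∂(surf r)‖ₑ ^ 2) +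
          16 * 2 ^ 2 * (A * eLpNorm (grad F) 2 (surf r) ^ 2)) := by
        refine mul_le_mul_right (h.trans ?_) _
        gcongr
        exact hA F hF
    _ = (a⁻¹ : NNReal) * (c * b ^ 2 * ‖∫ x, F x ∂(surf r)‖ₑ ^ 2 +
          64 * A * eLpNorm (grad F) 2 (surf r) ^ 2) := by ring
    _ ≤ (a⁻¹ : NNReal) * ((c * b ^ 2 + 64 * A) * ‖∫ x, F x ∂(surf r)‖ₑ ^ 2 +
          (c * b ^ 2 + 64 * A) * eLpNorm (grad F) 2 (surf r) ^ 2) := by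
        gcongr
        · exact le_self_add
        · exact le_add_self
    _ = _ := by push_cast; ring

/-- The cells of a cubic grid in the unit ball. -/
def cell (N : ℕ) (j : Fin 3 → ℤ) : Set E3 :=
  {x | x ∈ Metric.ball (0 : E3) 1 ∧ ∀ i, (N : ℝ) * x i ∈ Ico (j i : ℝ) (j i + 1)}

theorem measurableSet_cell (N : ℕ) (j : Fin 3 → ℤ) : MeasurableSet (cell N j) := by
  have : cell N j = Metric.ball (0 : E3) 1 ∩
      ⋂ i, (fun x : E3 => (N : ℝ) * x i) ⁻¹' Ico (j i : ℝ) (j i + 1) := by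
    ext x; simp [cell]
  rw [this]
  refine Metric.isOpen_ball.measurableSet.inter (MeasurableSet.iInter fun i => ?_)
  have : Continuous fun x : E3 => (N : ℝ) * x i := by fun_prop
  exact this.measurable measurableSet_Ico

theorem convex_cell (N : ℕ) (j : Fin 3 → ℤ) : Convex ℝ (cell N j) := by
  have : cell N j = Metric.ball (0 : E3) 1 ∩
      ⋂ i, (fun x : E3 => (N : ℝ) * x i) ⁻¹' Ico (j i : ℝ) (j i + 1) := by
    ext x; simp [cell]
  rw [this]
  refine (convex_ball _ _).inter (convex_iInter fun i => ?_)
  exact (convex_Ico _ _).is_linear_preimage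
    ⟨fun x y => by simp [mul_add], fun c x => by simp; ring⟩

theorem norm_le_sum_coord (x : E3) : ‖x‖ ≤ ∑ i, |x i| := by
  rw [EuclideanSpace.norm_eq]
  refine Real.sqrt_le_iff.2 ⟨by positivity, ?_⟩
  simp only [Fin.sum_univ_three, Real.norm_eq_abs]
  nlinarith [mul_nonneg (abs_nonneg (x 0)) (abs_nonneg (x 1)),
    mul_nonneg (abs_nonneg (x 0)) (abs_nonneg (x 2)), mul_nonneg (abs_nonneg (x 1)) (abs_nonneg (x 2))]

theorem enorm_sub_le_of_mem_cell {N : ℕ} (hN : 0 < N) {j : Fin 3 → ℤ} {x y : E3}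
    (hx : x ∈ cell N j) (hy : y ∈ cell N j) : ‖y - x‖ₑ ≤ ENNReal.ofReal (3 / N) := by
  rw [← ofReal_norm]
  refine ENNReal.ofReal_le_ofReal ((norm_le_sum_coord _).trans ?_)
  have hN' : (0 : ℝ) < N := Nat.cast_pos.2 hN
  have h : ∀ i, |(y - x) i| ≤ 1 / N := by
    intro i
    have h1 := hx.2 i
    have h2 := hy.2 i
    rw [le_div_iff₀ hN', show |(y - x) i| * (N : ℝ) = |(y - x) i * N| by rw [abs_mul, abs_of_pos hN'], abs_le]
    have h3 : (y - x) i * N = N * y i - N * x i := by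
      rw [PiLp.sub_apply]; ring
    rw [h3]
    constructor <;> linarith [h1.1, h1.2, h2.1, h2.2]
  calc ∑ i, |(y - x) i| ≤ ∑ _i : Fin 3, 1 / (N : ℝ) := Finset.sum_le_sum fun i _ => h i
    _ = 3 / N := by simp; ring

/-- Coordinates of points of the unit ball lie between -1 and 1, so only integer parts between -N
and N occur and finitely many cells suffice. -/
theorem iUnion_cell {N : ℕ} (hN : 0 < N) :
    ⋃ j ∈ Fintype.piFinset fun _ : Fin 3 => Finset.Icc (-N : ℤ) N, cell N j =
      Metric.ball (0 : E3) 1 := by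
  ext x
  simp only [mem_iUnion, exists_prop]
  constructor
  · rintro ⟨j, -, hj⟩
    exact hj.1
  · intro hx
    refine ⟨fun i => ⌊(N : ℝ) * x i⌋, ?_, hx, fun i => ⟨Int.floor_le _, Int.lt_floor_add_one _⟩⟩
    rw [Fintype.mem_piFinset]
    intro i
    have h1 : |x i| ≤ 1 := (PiLp.norm_apply_le x i).trans (mem_ball_zero_iff.1 hx).le
    have hN' : (0 : ℝ) < N := Nat.cast_pos.2 hN
    rw [abs_le] at h1
    rw [Finset.mem_Icc]
    constructor
    · rw [Int.le_floor]; push_cast; nlinarith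
    · have : ((⌊(N : ℝ) * x i⌋ : ℤ) : ℝ) ≤ N := (Int.floor_le _).trans (by nlinarith)
      exact_mod_cast this

theorem pairwiseDisjoint_cell (N : ℕ) (s : Set (Fin 3 → ℤ)) : s.PairwiseDisjoint (cell N) := by
  intro j _ k _ hjk
  refine Set.disjoint_left.2 fun x hx hy => hjk (funext fun i => ?_)
  have h1 := hx.2 i
  have h2 := hy.2 i
  have h3 : (j i : ℝ) < k i + 1 := h1.1.trans_lt h2.2
  have h4 : (k i : ℝ) < j i + 1 := h2.1.trans_lt h1.2
  have h5 : j i < k i + 1 := by exact_mod_cast h3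
  have h6 : k i < j i + 1 := by exact_mod_cast h4
  omega

/-- The quantitative Rellich lemma: up to a small multiple of the gradient, the `L²` norm of a
smooth function on the sphere is controlled by finitely many averages. -/
theorem SmoothFun.exists_rellich (hr : 0 < r) : ∃ A : NNReal, ∀ N : ℕ, 0 < N →
    ∃ (s : Finset (Fin 3 → ℤ)) (ν : (Fin 3 → ℤ) → Measure E3) (k c : NNReal),
      (∀ j, ν j ≤ k • surf r) ∧ ∀ F ∈ SmoothFun, eLpNorm F 2 (surf r) ^ 2 ≤
        c * ∑ j ∈ s, ‖∫ x, F x ∂(ν j)‖ₑ ^ 2 +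
          A * ENNReal.ofReal (3 / N) ^ 2 * eLpNorm (grad F) 2 (surf r) ^ 2 := by
  obtain ⟨a, ha0, ha⟩ := lintegral_ball_comp hr
  obtain ⟨A, hA⟩ := lintegral_ball_fderiv_le hr
  obtain ⟨k, hk⟩ := map_radialProj_le hr
  -- This factor is fixed before N, so refining the grid makes the gradient term as small as
  -- desired; only the cells and the constant in front of the averages depend on N.
  refine ⟨a⁻¹ * (16 * A), fun N hN => ?_⟩
  have hsub : ∀ j, cell N j ⊆ Metric.ball (0 : E3) 1 := fun j x hx => hx.1
  choose c hc using fun j => lintegral_enorm_sq_le_of_convex (measurableSet_cell N j)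
    (convex_cell N j) (ne_top_of_le_ne_top measure_ball_lt_top.ne (measure_mono (hsub j)))
    (fun x hx y hy => enorm_sub_le_of_mem_cell hN hx hy)
  set s := Fintype.piFinset fun _ : Fin 3 => Finset.Icc (-N : ℤ) N with hs
  refine ⟨s, fun j => ((volume : Measure E3).restrict (cell N j)).map (radialProj r), k,
    a⁻¹ * ∑ j ∈ s, c j, fun j => hk _ (hsub j), fun F hF => ?_⟩
  have hpos : (a⁻¹ : NNReal) * (a : ENNReal) = 1 := by
    rw [← ENNReal.coe_mul, inv_mul_cancel₀ ha0, ENNReal.coe_one]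
  have hsum : ∀ f : E3 → ENNReal,
      ∫⁻ x in Metric.ball 0 1, f x = ∑ j ∈ s, ∫⁻ x in cell N j, f x := fun f => by
    rw [← iUnion_cell hN, lintegral_biUnion_finset (pairwiseDisjoint_cell N _)
      (fun j _ => measurableSet_cell N j)]
  have h1 : ∫⁻ x in Metric.ball 0 1, ‖F x‖ₑ ^ 2 ≤
      (∑ j ∈ s, c j : NNReal) * (∑ j ∈ s, ‖∫ x in cell N j, F x‖ₑ ^ 2) +
        16 * ENNReal.ofReal (3 / N) ^ 2 * ∫⁻ x in Metric.ball 0 1, ‖fderiv ℝ F x‖ₑ ^ 2 := by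
    rw [hsum, hsum, Finset.mul_sum, Finset.mul_sum, ← Finset.sum_add_distrib]
    refine Finset.sum_le_sum fun j hj => (hc j F hF).trans ?_
    gcongr
    exact Finset.single_le_sum (f := c) (fun _ _ => zero_le) hj
  rw [ha F hF] at h1
  calc eLpNorm F 2 (surf r) ^ 2 = (a⁻¹ : NNReal) * (a * eLpNorm F 2 (surf r) ^ 2) := by
        rw [← mul_assoc, hpos, one_mul]
    _ ≤ (a⁻¹ : NNReal) * ((∑ j ∈ s, c j : NNReal) * (∑ j ∈ s, ‖∫ x in cell N j, F x‖ₑ ^ 2) +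
        16 * ENNReal.ofReal (3 / N) ^ 2 * (A * eLpNorm (grad F) 2 (surf r) ^ 2)) := by
        refine mul_le_mul_right (h1.trans ?_) _
        gcongr
        exact hA F hF
    _ = _ := by
        simp_rw [setIntegral_eq_integral_map hr (hsub _) hF]
        push_cast
        ring

end Rellich

/-! ### Passage to H¹ and H², completeness and compact embeddings -/

section Closure

variable {r : ℝ}

/-- Lower semicontinuity of an `L^q` norm with respect to `L^p` convergence. -/
theorem eLpNorm_le_of_tendsto_Lp {α E : Type*} [MeasurableSpace α] [NormedAddCommGroup E]
    {μ : Measure α} {p : ENNReal} [Fact (1 ≤ p)] {q : ENNReal} {f : ℕ → Lp E p μ} {g : Lp E p μ}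
    (hfg : Tendsto f atTop (𝓝 g)) {b : ℕ → ENNReal} {c : ENNReal} (hb : ∀ n, eLpNorm (f n) q μ ≤ b n)
    (hbc : Tendsto b atTop (𝓝 c)) : eLpNorm g q μ ≤ c := by
  obtain ⟨ns, hns, hae⟩ := (tendstoInMeasure_of_tendsto_Lp hfg).exists_seq_tendsto_ae
  refine (Lp.eLpNorm_lim_le_liminf_eLpNorm (fun n => Lp.aestronglyMeasurable (f (ns n))) _ hae).trans ?_
  rw [← (hbc.comp hns.tendsto_atTop).liminf_eq]
  exact liminf_le_liminf (Filter.Eventually.of_forall fun n => hb (ns n))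

theorem enorm_grad_le (p : Jet2 r) : ‖p.snd.fst‖ₑ ≤ ‖p‖ₑ :=
  (WithLp.enorm_fst_le _ _).trans (WithLp.enorm_snd_le _ _)

theorem enorm_lap_le (p : Jet2 r) : ‖p.snd.snd‖ₑ ≤ ‖p‖ₑ :=
  (WithLp.enorm_snd_le _ _).trans (WithLp.enorm_snd_le _ _)

theorem norm_sq_jet2 (p : Jet2 r) :
    ‖p‖ ^ 2 = ‖p.fst‖ ^ 2 + (‖p.snd.fst‖ ^ 2 + ‖p.snd.snd‖ ^ 2) := by
  rw [WithLp.prod_norm_sq_eq_of_L2, WithLp.prod_norm_sq_eq_of_L2]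

theorem continuous_jet2_fst : Continuous fun p : Jet2 r => p.fst :=
  (WithLp.fstL 2 ℂ (L2 r) (WithLp 2 (L2vec r × L2 r))).continuous

theorem continuous_jet2_grad : Continuous fun p : Jet2 r => p.snd.fst :=
  (WithLp.fstL 2 ℂ (L2vec r) (L2 r)).continuous.comp
    (WithLp.sndL 2 ℂ (L2 r) (WithLp 2 (L2vec r × L2 r))).continuous

theorem continuous_jet1_fst : Continuous fun p : Jet1 r => p.fst :=
  (WithLp.fstL 2 ℂ (L2 r) (L2vec r)).continuous

/-- H² is by definition the closure of the smooth jets, so any closed condition need only be checked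
on smooth functions. -/
theorem H2_induction {P : Jet2 r → Prop} (hc : IsClosed {p | P p})
    (hs : ∀ F ∈ SmoothFun, ∀ p : Jet2 r, p.fst =ᵐ[surf r] F → p.snd.fst =ᵐ[surf r] grad F →
      p.snd.snd =ᵐ[surf r] Laplacian.laplacian F → P p) {p : Jet2 r} (hp : p ∈ H2 r) : P p := by
  refine closure_minimal (fun p hp => ?_) hc hp
  obtain ⟨F, hF, h1, h2, h3⟩ := hp
  exact hs F hF p h1 h2 h3

/-- `‖∇Ψ‖₆ ≤ C ‖Ψ‖` on `H²(M)`. -/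
theorem exists_eLpNorm_grad_six_le (hr : 0 < r) : ∃ C : NNReal, ∀ p ∈ H2 r,
    eLpNorm p.snd.fst 6 (surf r) ≤ C * ‖p‖ₑ := by
  obtain ⟨C, hC⟩ := SmoothFun.exists_eLpNorm_grad_six_le hr
  refine ⟨3 * C, fun p hp => ?_⟩
  refine H2_induction (P := fun p => eLpNorm p.snd.fst 6 (surf r) ≤ (3 * C : NNReal) * ‖p‖ₑ) ?_ ?_ hp
  -- The L⁶ norm is not continuous for L² convergence, but Fatou's lemma along an almost everywhere
  -- convergent subsequence gives lower semicontinuity.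
  · refine IsSeqClosed.isClosed fun f p hf hfp => ?_
    refine eLpNorm_le_of_tendsto_Lp ((continuous_jet2_grad.tendsto p).comp hfp) hf ?_
    exact ENNReal.Tendsto.const_mul ((continuous_enorm.tendsto p).comp hfp) (Or.inr ENNReal.coe_ne_top)
  · intro F hF p h1 h2 h3
    rw [eLpNorm_congr_ae h2]
    have h := hC F hF
    rw [← eLpNorm_congr_ae (p := 2) h1, ← eLpNorm_congr_ae (p := 2) h2, ← eLpNorm_congr_ae (p := 2) h3, ← Lp.enorm_def,
      ← Lp.enorm_def, ← Lp.enorm_def] at h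
    calc _ ≤ C * (‖p.fst‖ₑ + ‖p.snd.fst‖ₑ + ‖p.snd.snd‖ₑ) := h
      _ ≤ C * (‖p‖ₑ + ‖p‖ₑ + ‖p‖ₑ) := by
          gcongr
          · exact WithLp.enorm_fst_le _ _
          · exact enorm_grad_le p
          · exact enorm_lap_le p
      _ = _ := by push_cast; ring

/-- This is the integrability gained from Ω ∈ H¹; it puts β in L⁴. -/
theorem memLp_six_of_mem_H1 (hr : 0 < r) {p : Jet1 r} (hp : p ∈ H1 r) :
    MemLp p.fst 6 (surf r) := by
  obtain ⟨C, hC⟩ := SmoothFun.exists_eLpNorm_six_le hr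
  refine ⟨Lp.aestronglyMeasurable _, lt_of_le_of_lt ?_
    (ENNReal.mul_lt_top (a := (2 * C : NNReal)) ENNReal.coe_lt_top (enorm_lt_top (x := p)))⟩
  refine closure_minimal (s := (smoothJet1 r : Set (Jet1 r)))
    (t := {p : Jet1 r | eLpNorm p.fst 6 (surf r) ≤ (2 * C : NNReal) * ‖p‖ₑ}) (fun p hp => ?_) ?_ hp
  · obtain ⟨F, hF, h1, h2⟩ := hp
    have h := hC F hF
    rw [← eLpNorm_congr_ae (p := 6) h1, ← eLpNorm_congr_ae (p := 2) h1,
      ← eLpNorm_congr_ae (p := 2) h2, ← Lp.enorm_def, ← Lp.enorm_def] at h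
    calc _ ≤ C * (‖p.fst‖ₑ + ‖p.snd‖ₑ) := h
      _ ≤ C * (‖p‖ₑ + ‖p‖ₑ) := by
          gcongr
          · exact WithLp.enorm_fst_le _ _
          · exact WithLp.enorm_snd_le _ _
      _ = _ := by push_cast; ring
  · refine IsSeqClosed.isClosed fun f p hf hfp => ?_
    refine eLpNorm_le_of_tendsto_Lp ((continuous_jet1_fst.tendsto p).comp hfp) hf ?_
    exact ENNReal.Tendsto.const_mul ((continuous_enorm.tendsto p).comp hfp) (Or.inr ENNReal.coe_ne_top)

/-- The interpolation inequality on `H²(M)`. -/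
theorem exists_norm_grad_sq_le (hr : 0 < r) : ∃ C : ℝ, 0 ≤ C ∧ ∀ p ∈ H2 r,
    ‖p.snd.fst‖ ^ 2 ≤ C * ‖p.fst‖ * ‖p‖ := by
  obtain ⟨C, hC⟩ := SmoothFun.exists_eLpNorm_grad_sq_le hr
  refine ⟨(C * 3 : NNReal), NNReal.coe_nonneg _, fun p hp => ?_⟩
  refine H2_induction (P := fun p => ‖p.snd.fst‖ ^ 2 ≤ (C * 3 : NNReal) * ‖p.fst‖ * ‖p‖) ?_ ?_ hp
  · exact isClosed_le (continuous_jet2_grad.norm.pow 2)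
      ((continuous_const.mul continuous_jet2_fst.norm).mul continuous_norm)
  · intro F hF p h1 h2 h3
    have h := hC F hF
    rw [← eLpNorm_congr_ae (p := 2) h1, ← eLpNorm_congr_ae (p := 2) h2, ← eLpNorm_congr_ae (p := 2) h3, ← Lp.enorm_def,
      ← Lp.enorm_def, ← Lp.enorm_def] at h
    have h4 : ‖p.snd.fst‖ₑ ^ 2 ≤ (C * 3 : NNReal) * ‖p.fst‖ₑ * ‖p‖ₑ := by
      calc _ ≤ C * ‖p.fst‖ₑ * (‖p.fst‖ₑ + ‖p.snd.fst‖ₑ + ‖p.snd.snd‖ₑ) := h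
        _ ≤ C * ‖p.fst‖ₑ * (‖p‖ₑ + ‖p‖ₑ + ‖p‖ₑ) := by
            gcongr
            · exact WithLp.enorm_fst_le _ _
            · exact enorm_grad_le p
            · exact enorm_lap_le p
        _ = _ := by push_cast; ring
    simp only [enorm_eq_nnnorm] at h4
    simp only [← coe_nnnorm]
    exact_mod_cast h4

/-- Integration against a measure dominated by the surface measure. -/
theorem exists_clm_integral {ν : Measure E3} {k : NNReal} (hν : ν ≤ k • surf r) :
    ∃ l : L2 r →L[ℂ] ℂ, ∀ f : L2 r, l f = ∫ x, f x ∂ν := by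
  have hac : ν ≪ surf r := (Measure.absolutelyContinuous_of_le hν).trans
    (Measure.smul_absolutelyContinuous)
  have hν' : ν ≤ (k : ENNReal) • surf r := hν
  have hfin : IsFiniteMeasure ν := ⟨lt_of_le_of_lt (hν' univ)
    (ENNReal.mul_lt_top ENNReal.coe_lt_top (measure_lt_top (surf r) univ))⟩
  have hmem : ∀ f : L2 r, MemLp f 2 ν := fun f =>
    ((Lp.memLp f).smul_measure ENNReal.coe_ne_top).mono_measure hν'
  have hint : ∀ f : L2 r, Integrable f ν := fun f => (hmem f).integrable one_le_two
  let L : L2 r →ₗ[ℂ] ℂ :=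
    { toFun := fun f => ∫ x, f x ∂ν
      map_add' := fun f g => by
        rw [integral_congr_ae (hac.ae_le (Lp.coeFn_add f g))]
        exact integral_add (hint f) (hint g)
      map_smul' := fun c f => by
        rw [integral_congr_ae (hac.ae_le (Lp.coeFn_smul c f))]
        exact integral_smul c _ }
  have hb : ∃ C : NNReal, ∀ f : L2 r, ‖∫ x, f x ∂ν‖ₑ ≤ C * ‖f‖ₑ := by
    have hc1 : (k : ENNReal) ^ (1 / (2 : ENNReal)).toReal ≠ ⊤ := by
      simp
    have hc2 : eLpNorm (fun _ : E3 => (1 : ℝ)) 2 ν ≠ ⊤ := (memLp_const (1 : ℝ)).eLpNorm_ne_top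
    lift (k : ENNReal) ^ (1 / (2 : ENNReal)).toReal to NNReal using hc1 with a ha
    lift eLpNorm (fun _ : E3 => (1 : ℝ)) 2 ν to NNReal using hc2 with b hb
    refine ⟨a * b, fun f => ?_⟩
    have h1 := lintegral_mul_le_eLpNorm (μ := ν) (hmem f).1 (aestronglyMeasurable_const (b := (1 : ℝ)))
    simp only [enorm_one, mul_one] at h1
    have h2 : eLpNorm f 2 ν ≤ a * ‖f‖ₑ := by
      refine (eLpNorm_mono_measure f hν').trans ?_
      rw [eLpNorm_smul_measure_of_ne_top (by simp), ← ha, smul_eq_mul, Lp.enorm_def]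
    calc _ ≤ ∫⁻ x, ‖f x‖ₑ ∂ν := enorm_integral_le_lintegral_enorm _
      _ ≤ eLpNorm f 2 ν * b := by rw [hb]; exact h1
      _ ≤ a * ‖f‖ₑ * b := by gcongr
      _ = _ := by push_cast; ring
  obtain ⟨C, hC⟩ := hb
  exact ⟨L.mkContinuous C fun f => by
    have h := hC f
    change ‖∫ x, f x ∂ν‖ ≤ _
    simp only [enorm_eq_nnnorm] at h
    simp only [← coe_nnnorm]
    exact_mod_cast h, fun f => rfl⟩

/-- The Poincaré inequality on `H²_⋄(M)`. -/
theorem exists_norm_fst_le (hr : 0 < r) : ∃ C : ℝ, 0 ≤ C ∧ ∀ p ∈ Hd2 r,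
    ‖p.fst‖ ^ 2 ≤ C * ‖p.snd.fst‖ ^ 2 := by
  obtain ⟨C, hC⟩ := SmoothFun.exists_poincare hr
  obtain ⟨l, hl⟩ := exists_clm_integral (r := r) (ν := surf r) (k := 1) (by simp)
  refine ⟨C, NNReal.coe_nonneg _, fun p hp => ?_⟩
  have h : ‖p.fst‖ ^ 2 ≤ C * (‖l p.fst‖ ^ 2 + ‖p.snd.fst‖ ^ 2) := by
    refine H2_induction (P := fun p => ‖p.fst‖ ^ 2 ≤ C * (‖l p.fst‖ ^ 2 + ‖p.snd.fst‖ ^ 2)) ?_ ?_ hp.1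
    · exact isClosed_le (continuous_jet2_fst.norm.pow 2) (continuous_const.mul
        (((l.continuous.comp continuous_jet2_fst).norm.pow 2).add (continuous_jet2_grad.norm.pow 2)))
    · intro F hF p h1 h2 _
      have h := hC F hF
      rw [← eLpNorm_congr_ae (p := 2) h1, ← eLpNorm_congr_ae (p := 2) h2, ← integral_congr_ae h1, ← Lp.enorm_def,
        ← Lp.enorm_def, ← hl] at h
      simp only [enorm_eq_nnnorm] at h
      simp only [← coe_nnnorm]
      exact_mod_cast h
  have h0 : l p.fst = 0 := by rw [hl]; exact hp.2
  simpa [h0] using h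

/-- The mean is a continuous functional on L², so the mean-zero condition is closed. This gives the
completeness needed for Lax–Milgram and Riesz. -/
theorem isClosed_Hd2 : IsClosed (Hd2 r : Set (Jet2 r)) := by
  obtain ⟨l, hl⟩ := exists_clm_integral (r := r) (ν := surf r) (k := 1) (by simp)
  have h : (Hd2 r : Set (Jet2 r)) = (H2 r : Set (Jet2 r)) ∩ {p | l p.fst = 0} := by
    ext p
    change (p ∈ H2 r ∧ ∫ x, p.fst x ∂(surf r) = 0) ↔ (p ∈ H2 r ∧ l p.fst = 0)
    rw [hl]
  rw [h]
  exact (smoothJet2 r).isClosed_topologicalClosure.inter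
    (isClosed_eq (l.continuous.comp continuous_jet2_fst) continuous_const)

instance : CompleteSpace (Hd2 r) := isClosed_Hd2.completeSpace_coe

/-- The inclusion of `H²_⋄(M)` into `L²(M)`. -/
def fstL : Hd2 r →L[ℂ] L2 r :=
  (WithLp.fstL 2 ℂ (L2 r) (WithLp 2 (L2vec r × L2 r))).comp (Hd2 r).subtypeL

/-- The weak gradient as a bounded operator. -/
def gradL : Hd2 r →L[ℂ] L2vec r :=
  ((WithLp.fstL 2 ℂ (L2vec r) (L2 r)).comp
    (WithLp.sndL 2 ℂ (L2 r) (WithLp 2 (L2vec r × L2 r)))).comp (Hd2 r).subtypeL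

@[simp] theorem gradL_apply (Ψ : Hd2 r) : gradL Ψ = gradH Ψ := rfl

/-- The Rellich theorem: the embedding of `H²_⋄(M)` into `L²(M)` is compact. -/
theorem isCompactOperator_fstL (hr : 0 < r) : IsCompactOperator (fstL : Hd2 r →L[ℂ] L2 r) := by
  obtain ⟨A, hA⟩ := SmoothFun.exists_rellich hr
  refine isCompactOperator_of_norm_le fun ε hε => ?_
  -- N is taken so large that the gradient coefficient √A · 3/N is at most ε; the maximum with 0
  -- ensures N > 0.
  obtain ⟨N, hN⟩ := exists_nat_gt (max 0 (3 * √A / ε))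
  have hN0 : (0 : ℝ) < N := (le_max_left _ _).trans_lt hN
  have hNε : √A * (3 / N) ≤ ε := by
    have h1 := ((le_max_right _ _).trans_lt hN).le
    rw [div_le_iff₀ hε] at h1
    rw [mul_div_assoc', div_le_iff₀ hN0]
    linarith
  obtain ⟨s, ν, k, c, hν, hF⟩ := hA N (Nat.cast_pos.1 hN0)
  choose l hl using fun j => exists_clm_integral (hν j)
  -- The weighted cell averages form an operator of finite rank, hence compact. It dominates the L²
  -- norm up to ε‖v‖.
  let K : Hd2 r →L[ℂ] EuclideanSpace ℂ s :=
    (√c : ℂ) • ((EuclideanSpace.equiv s ℂ).symm : (s → ℂ) →L[ℂ] EuclideanSpace ℂ s).comp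
      (ContinuousLinearMap.pi fun j : s => (l j).comp fstL)
  have hKn : ∀ v : Hd2 r, ‖K v‖ ^ 2 = c * ∑ j ∈ s, ‖l j (v : Jet2 r).fst‖ ^ 2 := by
    intro v
    have : K v = (√c : ℂ) • WithLp.toLp 2 fun j : s => l j (v : Jet2 r).fst := rfl
    rw [this, norm_smul, mul_pow, EuclideanSpace.norm_sq_eq, Complex.norm_real,
      Real.norm_of_nonneg (Real.sqrt_nonneg _), Real.sq_sqrt (NNReal.coe_nonneg c)]
    congr 1
    exact Finset.sum_coe_sort s fun j => ‖l j (v : Jet2 r).fst‖ ^ 2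
  have h2 : ∀ p ∈ H2 r, ‖p.fst‖ ^ 2 ≤ c * ∑ j ∈ s, ‖l j p.fst‖ ^ 2 +
      A * (3 / N) ^ 2 * ‖p.snd.fst‖ ^ 2 := by
    intro p hp
    refine H2_induction (P := fun p => ‖p.fst‖ ^ 2 ≤ c * ∑ j ∈ s, ‖l j p.fst‖ ^ 2 +
      A * (3 / N) ^ 2 * ‖p.snd.fst‖ ^ 2) ?_ ?_ hp
    · refine isClosed_le (continuous_jet2_fst.norm.pow 2) (Continuous.add (continuous_const.mul
        (continuous_finsetSum _ fun j _ => ((l j).continuous.comp continuous_jet2_fst).norm.pow 2))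
        (continuous_const.mul (continuous_jet2_grad.norm.pow 2)))
    · intro F hFs p h1 h2 _
      have h := hF F hFs
      have hac : ∀ j, ν j ≪ surf r := fun j =>
        (Measure.absolutelyContinuous_of_le (hν j)).trans Measure.smul_absolutelyContinuous
      have h3 : ∀ j, ∫ x, F x ∂(ν j) = l j p.fst := fun j => by
        rw [hl, integral_congr_ae ((hac j).ae_le h1)]
      simp_rw [h3] at h
      rw [← eLpNorm_congr_ae (p := 2) h1, ← eLpNorm_congr_ae (p := 2) h2, ← Lp.enorm_def, ← Lp.enorm_def,
        show (3 : ℝ) / N = ((3 / N : NNReal) : ℝ) by push_cast; rfl,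
        ENNReal.ofReal_coe_nnreal] at h
      simp only [enorm_eq_nnnorm] at h
      simp only [← coe_nnnorm]
      exact_mod_cast h
  refine ⟨EuclideanSpace ℂ s, inferInstance, inferInstance, K,
    isCompactOperator_of_locallyCompactSpace_dom K, fun v => ?_⟩
  have h3 := h2 _ v.2.1
  rw [← hKn] at h3
  have h4 : ‖(v : Jet2 r).snd.fst‖ ≤ ‖v‖ := by
    have := enorm_grad_le (v : Jet2 r)
    simp only [enorm_eq_nnnorm] at this
    simp only [← coe_nnnorm]
    exact_mod_cast this
  change ‖(v : Jet2 r).fst‖ ≤ _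
  have h6 : A * (3 / N) ^ 2 * ‖(v : Jet2 r).snd.fst‖ ^ 2 ≤ (ε * ‖v‖) ^ 2 := by
    have h7 : (√A * (3 / N)) * ‖(v : Jet2 r).snd.fst‖ ≤ ε * ‖v‖ :=
      mul_le_mul hNε h4 (norm_nonneg _) hε.le
    calc _ = ((√A * (3 / N)) * ‖(v : Jet2 r).snd.fst‖) ^ 2 := by
          rw [mul_pow, mul_pow, Real.sq_sqrt (NNReal.coe_nonneg A)]
      _ ≤ _ := pow_le_pow_left₀ (by positivity) h7 2
  refine abs_le_of_sq_le_sq' ?_ (by positivity) |>.2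
  nlinarith [norm_nonneg (K v), mul_nonneg hε.le (norm_nonneg v),
    mul_nonneg (norm_nonneg (K v)) (mul_nonneg hε.le (norm_nonneg v))]

/-- The weak gradient is a compact operator from `H²_⋄(M)` to `L²(M; ℂ³)`. -/
theorem isCompactOperator_gradL (hr : 0 < r) :
    IsCompactOperator (gradL : Hd2 r →L[ℂ] L2vec r) := by
  obtain ⟨C, hC0, hC⟩ := exists_norm_grad_sq_le hr
  refine isCompactOperator_of_norm_le fun ε hε => ?_
  -- Writing C‖v‖₂‖v‖ = (ε‖v‖)(Cε⁻¹‖v‖₂) and bounding the product by the square of the sum, the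
  -- compact operator Cε⁻¹ times the embedding dominates ∇v up to ε‖v‖.
  refine ⟨L2 r, inferInstance, inferInstance, ((C / ε : ℝ) : ℂ) • fstL,
    (isCompactOperator_fstL hr).smul ((C / ε : ℝ) : ℂ), fun v => ?_⟩
  have h := hC _ v.2.1
  change ‖(v : Jet2 r).snd.fst‖ ≤ ε * ‖v‖ + ‖((C / ε : ℝ) : ℂ) • (v : Jet2 r).fst‖
  rw [norm_smul, Complex.norm_real, Real.norm_of_nonneg (by positivity)]
  refine abs_le_of_sq_le_sq' ?_ (by positivity) |>.2
  have h1 : C * ‖(v : Jet2 r).fst‖ * ‖(v : Jet2 r)‖ =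
      (ε * ‖v‖) * (C / ε * ‖(v : Jet2 r).fst‖) := by
    rw [show ‖(v : Jet2 r)‖ = ‖v‖ from rfl]
    field_simp
  rw [h1] at h
  have h2 : 0 ≤ ε * ‖v‖ := by positivity
  have h3 : 0 ≤ C / ε * ‖(v : Jet2 r).fst‖ := by positivity
  nlinarith [mul_nonneg h2 h3]

end Closure

/-! ### Hölder estimates and sesquilinearity of the form -/

section Form

variable {r : ℝ}

theorem ae_surf_norm_eq (hr : 0 < r) : ∀ᵐ x ∂(surf r), ‖x‖ = r := by
  unfold surf
  refine Measure.ae_smul_measure ?_ _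
  have hm : Measurable fun s : Metric.sphere (0 : E3) 1 => r • (s : E3) :=
    measurable_subtype_coe.const_smul r
  refine (ae_map_iff hm.aemeasurable (measurableSet_eq_fun measurable_norm measurable_const)).2 ?_
  refine Filter.Eventually.of_forall fun s => ?_
  have := s.2
  rw [mem_sphere_zero_iff_norm] at this
  rw [norm_smul, this, mul_one, Real.norm_of_nonneg hr.le]

theorem ae_surf_coord_le (hr : 0 < r) : ∀ᵐ x ∂(surf r), ∀ i, |x i| ≤ r := by
  filter_upwards [ae_surf_norm_eq hr] with x hx i
  rw [← hx]
  exact PiLp.norm_apply_le x i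

theorem eLpNorm_pow_eq_lintegral {α F : Type*} [MeasurableSpace α] [ENorm F]
    (f : α → F) (μ : Measure α) {n : ℕ} (hn : n ≠ 0) :
    eLpNorm f n μ ^ n = ∫⁻ x, ‖f x‖ₑ ^ n ∂μ := by
  have := eLpNorm_nnreal_pow_eq_lintegral (μ := μ) (f := f) (p := n) (by exact_mod_cast hn)
  simpa using this

/-- Interpolation of `L⁴` between `L²` and `L⁶`. -/
theorem eLpNorm_four_pow_le {α F : Type*} [MeasurableSpace α] [NormedAddCommGroup F]
    {μ : Measure α} {f : α → F} (hf : AEStronglyMeasurable f μ) :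
    eLpNorm f 4 μ ^ 4 ≤ eLpNorm f 2 μ * eLpNorm f 6 μ ^ 3 := by
  have h4 := eLpNorm_pow_eq_lintegral f μ (n := 4) (by norm_num)
  have h6 := eLpNorm_pow_eq_lintegral f μ (n := 6) (by norm_num)
  have h2 : eLpNorm (fun x => ‖f x‖ ^ 3) 2 μ = eLpNorm f 6 μ ^ 3 := by
    refine (ENNReal.pow_right_strictMono two_ne_zero).injective ?_
    rw [eLpNorm_two_sq, ← pow_mul]
    norm_num at h6 ⊢
    rw [h6]
    refine lintegral_congr fun x => ?_
    rw [← pow_mul]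
  -- Cauchy–Schwarz for |f|⁴ = |f| · |f|³, where the L² norm of |f|³ is the cube of the L⁶ norm of
  -- f.
  have h := lintegral_mul_le_eLpNorm hf (hf.norm.pow 3)
  simp only [Pi.pow_apply] at h
  rw [show (fun x => ‖f x‖) ^ 3 = fun x => ‖f x‖ ^ 3 from rfl, h2] at h
  refine le_trans (le_of_eq ?_) h
  norm_num at h4
  rw [h4]
  refine lintegral_congr fun x => ?_
  rw [enorm_pow, enorm_norm]
  ring

/-- Hölder with 1/2 + 1/4 + 1/4 = 1. In both coefficient terms of the form one factor is only in L²
and the other two are in L⁴. -/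
theorem lintegral_mul_mul_le {α F G H : Type*} [MeasurableSpace α] {μ : Measure α}
    [NormedAddCommGroup F] [NormedAddCommGroup G] [NormedAddCommGroup H] {f : α → F} {g : α → G}
    {h : α → H} (hf : AEStronglyMeasurable f μ) (hg : AEStronglyMeasurable g μ)
    (hh : AEStronglyMeasurable h μ) :
    ∫⁻ x, ‖f x‖ₑ * (‖g x‖ₑ * ‖h x‖ₑ) ∂μ ≤ eLpNorm f 2 μ * (eLpNorm g 4 μ * eLpNorm h 4 μ) := by
  have : ENNReal.HolderTriple 4 4 2 := ⟨by
    rw [← two_mul, show (4 : ENNReal) = 2 * 2 by norm_num, ENNReal.mul_inv (by simp) (by simp),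
      ← mul_assoc, ENNReal.mul_inv_cancel (by simp) (by simp), one_mul]⟩
  have h1 := eLpNorm_le_eLpNorm_mul_eLpNorm'_of_norm (p := 4) (q := 4) (r := 2) (μ := μ)
    hg.norm hh.norm (fun a b : ℝ => a * b) 1 (Filter.Eventually.of_forall fun x => by simp)
  rw [eLpNorm_norm, eLpNorm_norm, ENNReal.coe_one, one_mul] at h1
  have h2 := lintegral_mul_le_eLpNorm hf (hg.norm.mul hh.norm)
  refine le_trans (le_of_eq ?_) (h2.trans (mul_le_mul_right h1 _))
  refine lintegral_congr fun x => ?_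
  rw [Pi.mul_apply, enorm_mul, enorm_norm, enorm_norm]

theorem aestronglyMeasurable_coord {μ : Measure E3} {f : E3 → EuclideanSpace ℂ (Fin 3)}
    (hf : AEStronglyMeasurable f μ) (i : Fin 3) : AEStronglyMeasurable (fun x => f x i) μ :=
  (EuclideanSpace.proj (𝕜 := ℂ) i).continuous.comp_aestronglyMeasurable hf

theorem aestronglyMeasurable_gradH (ψ : Hd2 r) (i : Fin 3) :
    AEStronglyMeasurable (fun x => gradH ψ x i) (surf r) :=
  aestronglyMeasurable_coord (Lp.aestronglyMeasurable _) i

theorem continuous_coord (i : Fin 3) : Continuous fun x : E3 => (x i : ℂ) :=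
  Complex.continuous_ofReal.comp (by fun_prop)

theorem aestronglyMeasurable_dPhi (ψ : Hd2 r) : AEStronglyMeasurable (dPhi ψ) (surf r) :=
  ((continuous_coord 0).aestronglyMeasurable.mul (aestronglyMeasurable_gradH ψ 1)).sub
    ((continuous_coord 1).aestronglyMeasurable.mul (aestronglyMeasurable_gradH ψ 0))

theorem aestronglyMeasurable_vCurl (ψ : Hd2 r) (i : Fin 3) :
    AEStronglyMeasurable (fun x => vCurl ψ x i) (surf r) := by
  have h : ∀ j k, AEStronglyMeasurable
      (fun x => (r : ℂ)⁻¹ * (gradH ψ x j * x k - gradH ψ x k * x j)) (surf r) := fun j k =>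
    (((aestronglyMeasurable_gradH ψ j).mul (continuous_coord k).aestronglyMeasurable).sub
      ((aestronglyMeasurable_gradH ψ k).mul (continuous_coord j).aestronglyMeasurable)).const_mul _
  fin_cases i
  · exact h 1 2
  · exact h 2 0
  · exact h 0 1

theorem norm_dPhi_le (hr : 0 < r) (ψ : Hd2 r) :
    ∀ᵐ x ∂(surf r), ‖dPhi ψ x‖ ≤ 2 * r * ‖gradH ψ x‖ := by
  filter_upwards [ae_surf_coord_le hr] with x hx
  have h : ∀ i j, ‖(x i : ℂ) * gradH ψ x j‖ ≤ r * ‖gradH ψ x‖ := fun i j => by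
    rw [norm_mul, Complex.norm_real]
    exact mul_le_mul (hx i) (PiLp.norm_apply_le (gradH ψ x) j) (norm_nonneg _) hr.le
  calc _ ≤ r * ‖gradH ψ x‖ + r * ‖gradH ψ x‖ := (norm_sub_le _ _).trans (add_le_add (h 0 1) (h 1 0))
    _ = _ := by ring

theorem norm_vCurl_le (hr : 0 < r) (ψ : Hd2 r) :
    ∀ᵐ x ∂(surf r), ∀ i, ‖vCurl ψ x i‖ ≤ 2 * ‖gradH ψ x‖ := by
  filter_upwards [ae_surf_coord_le hr] with x hx i
  have h : ∀ j k, ‖gradH ψ x j * (x k : ℂ)‖ ≤ ‖gradH ψ x‖ * r := fun j k => by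
    rw [norm_mul, Complex.norm_real]
    exact mul_le_mul (PiLp.norm_apply_le (gradH ψ x) j) (hx k) (norm_nonneg _) (norm_nonneg _)
  have h2 : ∀ j k, ‖(r : ℂ)⁻¹ * (gradH ψ x j * x k - gradH ψ x k * x j)‖ ≤ 2 * ‖gradH ψ x‖ := by
    intro j k
    rw [norm_mul, norm_inv, Complex.norm_real, Real.norm_of_nonneg hr.le, inv_mul_le_iff₀ hr]
    calc _ ≤ ‖gradH ψ x‖ * r + ‖gradH ψ x‖ * r :=
          (norm_sub_le _ _).trans (add_le_add (h j k) (h k j))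
      _ = _ := by ring
  fin_cases i
  · exact h2 1 2
  · exact h2 2 0
  · exact h2 0 1

/-- The `L⁴` norm of the gradient. -/
def gradNorm4 (Ψ : Hd2 r) : NNReal := (eLpNorm (gradH Ψ) 4 (surf r)).toNNReal

/-- Interpolation between L² and the Sobolev exponent 6. The factor ‖∇Ψ‖₂ on the right is what makes
the coefficient terms lower order. -/
theorem exists_gradNorm4_pow_le (hr : 0 < r) : ∃ K : NNReal, ∀ Ψ : Hd2 r,
    eLpNorm (gradH Ψ) 4 (surf r) = gradNorm4 Ψ ∧
      (gradNorm4 Ψ : ℝ) ^ 4 ≤ K * ‖gradH Ψ‖ * ‖Ψ‖ ^ 3 := by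
  obtain ⟨C, hC⟩ := exists_eLpNorm_grad_six_le hr
  refine ⟨C ^ 3, fun Ψ => ?_⟩
  have h1 : eLpNorm (gradH Ψ) 4 (surf r) ^ 4 ≤ ‖gradH Ψ‖ₑ * (C * ‖(Ψ : Jet2 r)‖ₑ) ^ 3 := by
    refine (eLpNorm_four_pow_le (Lp.aestronglyMeasurable _)).trans ?_
    rw [Lp.enorm_def]
    gcongr
    exact hC _ Ψ.2.1
  have hfin : eLpNorm (gradH Ψ) 4 (surf r) ≠ ⊤ := by
    intro h
    rw [h, ENNReal.top_pow (by norm_num), top_le_iff] at h1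
    exact ENNReal.mul_ne_top enorm_ne_top
      (ENNReal.pow_ne_top (ENNReal.mul_ne_top ENNReal.coe_ne_top enorm_ne_top)) h1
  have h2 : eLpNorm (gradH Ψ) 4 (surf r) = gradNorm4 Ψ := (ENNReal.coe_toNNReal hfin).symm
  refine ⟨h2, ?_⟩
  rw [h2] at h1
  simp only [enorm_eq_nnnorm] at h1
  have h3 : gradNorm4 Ψ ^ 4 ≤ ‖gradH Ψ‖₊ * (C * ‖(Ψ : Jet2 r)‖₊) ^ 3 := by exact_mod_cast h1
  have h4 : (gradNorm4 Ψ : ℝ) ^ 4 ≤ ‖gradH Ψ‖ * (C * ‖(Ψ : Jet2 r)‖) ^ 3 := by exact_mod_cast h3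
  refine h4.trans (le_of_eq ?_)
  rw [show ‖(Ψ : Jet2 r)‖ = ‖Ψ‖ from rfl]
  push_cast
  ring

/-- Ω and its weak gradient are in L², and the trigonometric factors, written in Cartesian
coordinates, are continuous and bounded on the sphere; the representation of sin θ e_θ has no
singularity at the poles. -/
theorem memLp_alphaTilde (hr : 0 < r) (Ω : H1 r) : MemLp (alphaTilde Ω) 2 (surf r) := by
  have hbd : ∀ {f : E3 → ℂ} {c : E3 → ℝ} (C : ℝ), MemLp f 2 (surf r) → Continuous c →
      (∀ᵐ x ∂(surf r), ‖c x‖ ≤ C) → MemLp (fun x => f x * (c x : ℂ)) 2 (surf r) := by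
    intro f c C hf hc hC
    refine MemLp.of_le_mul (c := C) hf
      (hf.1.mul (Complex.continuous_ofReal.comp hc).aestronglyMeasurable) ?_
    filter_upwards [hC] with x hx
    rw [norm_mul, Complex.norm_real, mul_comm]
    exact mul_le_mul_of_nonneg_right hx (norm_nonneg _)
  have hcos : Continuous (cosColat r) := by unfold cosColat; fun_prop
  have hcosb : ∀ᵐ x ∂(surf r), |cosColat r x| ≤ 1 := by
    filter_upwards [ae_surf_coord_le hr] with x hx
    rw [cosColat, abs_div, abs_of_pos hr, div_le_one hr]
    exact hx 2
  have hsin : ∀ i, Continuous fun x => sinColatVec r x i := by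
    intro i
    unfold sinColatVec
    simp only [PiLp.sub_apply, PiLp.smul_apply, smul_eq_mul]
    fun_prop
  have hsinb : ∀ i, ∀ᵐ x ∂(surf r), ‖sinColatVec r x i‖ ≤ 2 := by
    intro i
    filter_upwards [ae_surf_coord_le hr, hcosb] with x hx hc
    have h1 : ‖cosColat r x / r * x i‖ ≤ 1 := by
      rw [Real.norm_eq_abs, abs_mul, abs_div, abs_of_pos hr, div_mul_eq_mul_div, div_le_one hr]
      calc _ ≤ 1 * r := mul_le_mul hc (hx i) (abs_nonneg _) zero_le_one
        _ = r := one_mul r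
    have h2 : ‖(EuclideanSpace.single (2 : Fin 3) (1 : ℝ) : E3) i‖ ≤ 1 :=
      (PiLp.norm_apply_le _ i).trans (by simp)
    unfold sinColatVec
    rw [PiLp.sub_apply, PiLp.smul_apply, smul_eq_mul]
    exact (norm_sub_le _ _).trans (by linarith)
  have hg : ∀ i, MemLp (fun x => (Ω : Jet1 r).snd x i) 2 (surf r) := fun i =>
    MemLp.of_le (Lp.memLp (Ω : Jet1 r).snd) (aestronglyMeasurable_coord (Lp.aestronglyMeasurable _) i)
      (Filter.Eventually.of_forall fun x => PiLp.norm_apply_le _ i)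
  have h1 : MemLp (sinMulDeriv Ω) 2 (surf r) := by
    have h2 : MemLp (fun x => ∑ i, (Ω : Jet1 r).snd x i * (sinColatVec r x i : ℂ)) 2 (surf r) :=
      memLp_finsetSum _ fun i _ => hbd 2 (hg i) (hsin i) (hsinb i)
    exact h2.const_mul (r : ℂ)
  have h2 : MemLp (fun x => 2 * (Ω : Jet1 r).fst x * (cosColat r x : ℂ)) 2 (surf r) :=
    hbd 1 ((Lp.memLp (Ω : Jet1 r).fst).const_mul 2) hcos hcosb
  exact h1.add h2

theorem memLp_beta (hr : 0 < r) (Ωref : ℝ) (Ω : H1 r) : MemLp (beta Ωref Ω) 4 (surf r) := by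
  have h : MemLp (fun x => (Ω : Jet1 r).fst x) 4 (surf r) :=
    (memLp_six_of_mem_H1 hr Ω.2).mono_exponent (by norm_num)
  exact h.sub (memLp_const _)

/-- A function dominated by a product of integrands in `L²`, `L⁴`, `L⁴` is integrable. -/
theorem integrable_and_norm_integral_le {f : E3 → ℂ} {F G H : Type*} [NormedAddCommGroup F]
    [NormedAddCommGroup G] [NormedAddCommGroup H] {u : E3 → F} {v : E3 → G} {w : E3 → H}
    (hf : AEStronglyMeasurable f (surf r)) (hu : AEStronglyMeasurable u (surf r))
    (hv : AEStronglyMeasurable v (surf r)) (hw : AEStronglyMeasurable w (surf r)) {C a b c : NNReal}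
    (ha : eLpNorm u 2 (surf r) = a) (hb : eLpNorm v 4 (surf r) = b) (hc : eLpNorm w 4 (surf r) = c)
    (h : ∀ᵐ x ∂(surf r), ‖f x‖ ≤ C * (‖u x‖ * (‖v x‖ * ‖w x‖))) :
    Integrable f (surf r) ∧ ‖∫ x, f x ∂(surf r)‖ ≤ C * (a * (b * c)) := by
  have h1 : ∫⁻ x, ‖f x‖ₑ ∂(surf r) ≤ (C * (a * (b * c)) : NNReal) := by
    calc _ ≤ ∫⁻ x, C * (‖u x‖ₑ * (‖v x‖ₑ * ‖w x‖ₑ)) ∂(surf r) := by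
          refine lintegral_mono_ae ?_
          filter_upwards [h] with x hx
          simp only [enorm_eq_nnnorm]
          simp only [← coe_nnnorm] at hx
          exact_mod_cast hx
      _ = C * ∫⁻ x, ‖u x‖ₑ * (‖v x‖ₑ * ‖w x‖ₑ) ∂(surf r) :=
          lintegral_const_mul' _ _ ENNReal.coe_ne_top
      _ ≤ C * (a * (b * c)) := by
          rw [← ha, ← hb, ← hc]
          gcongr
          exact lintegral_mul_mul_le hu hv hw
      _ = _ := by push_cast; rfl
  refine ⟨⟨hf, h1.trans_lt ENNReal.coe_lt_top⟩, ?_⟩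
  have h2 := (enorm_integral_le_lintegral_enorm f).trans h1
  rw [enorm_eq_nnnorm] at h2
  have h3 : ‖∫ x, f x ∂(surf r)‖₊ ≤ C * (a * (b * c)) := by exact_mod_cast h2
  exact_mod_cast h3

theorem aestronglyMeasurable_alphaIntegrand (hr : 0 < r) (Ω : H1 r) (Ψ ψ : Hd2 r) :
    AEStronglyMeasurable (alphaIntegrand Ω Ψ ψ) (surf r) := by
  refine (memLp_alphaTilde hr Ω).1.mul ?_
  refine Finset.aestronglyMeasurable_fun_sum _ fun i _ => ?_
  exact (aestronglyMeasurable_gradH Ψ i).mul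
    (Complex.continuous_conj.comp_aestronglyMeasurable (aestronglyMeasurable_vCurl ψ i))

/-- Hölder with α̃ in L² and both gradients in L⁴. The factor 6 counts three coordinates, each
bounded by the 2 of `norm_vCurl_le`. -/
theorem exists_alpha_bound (hr : 0 < r) (Ω : H1 r) : ∃ K : NNReal, ∀ Ψ ψ : Hd2 r,
    Integrable (alphaIntegrand Ω Ψ ψ) (surf r) ∧
      ‖∫ x, alphaIntegrand Ω Ψ ψ x ∂(surf r)‖ ≤ K * (gradNorm4 Ψ * gradNorm4 ψ) := by
  obtain ⟨_, hn⟩ := exists_gradNorm4_pow_le hr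
  have hα := memLp_alphaTilde hr Ω
  refine ⟨6 * (eLpNorm (alphaTilde Ω) 2 (surf r)).toNNReal, fun Ψ ψ => ?_⟩
  have h := integrable_and_norm_integral_le (C := 6) (aestronglyMeasurable_alphaIntegrand hr Ω Ψ ψ)
    hα.1 (Lp.aestronglyMeasurable (gradH Ψ)) (Lp.aestronglyMeasurable (gradH ψ))
    (ENNReal.coe_toNNReal hα.eLpNorm_ne_top).symm (hn Ψ).1 (hn ψ).1 ?_
  · refine ⟨h.1, h.2.trans (le_of_eq ?_)⟩
    push_cast
    ring
  · filter_upwards [norm_vCurl_le hr ψ] with x hx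
    unfold alphaIntegrand
    rw [norm_mul]
    have h1 : ‖∑ i, gradH Ψ x i * conj (vCurl ψ x i)‖ ≤
        ∑ _i : Fin 3, ‖gradH Ψ x‖ * (2 * ‖gradH ψ x‖) := by
      refine (norm_sum_le _ _).trans (Finset.sum_le_sum fun i _ => ?_)
      rw [norm_mul, RCLike.norm_conj]
      exact mul_le_mul (PiLp.norm_apply_le _ i) (hx i) (norm_nonneg _) (norm_nonneg _)
    refine (mul_le_mul_of_nonneg_left h1 (norm_nonneg _)).trans (le_of_eq ?_)
    simp only [Finset.sum_const, Finset.card_univ, Fintype.card_fin, nsmul_eq_mul]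
    push_cast
    ring

/-- Here the roles differ: ΔΨ takes the L² place, while β and ∂ψ/∂φ are in L⁴. -/
theorem exists_beta_bound (hr : 0 < r) (Ωref : ℝ) (Ω : H1 r) : ∃ K : NNReal, ∀ Ψ ψ : Hd2 r,
    Integrable (betaIntegrand Ωref Ω Ψ ψ) (surf r) ∧
      ‖∫ x, betaIntegrand Ωref Ω Ψ ψ x ∂(surf r)‖ ≤ K * (‖lapH Ψ‖ * gradNorm4 ψ) := by
  obtain ⟨_, hn⟩ := exists_gradNorm4_pow_le hr
  have hβ := memLp_beta hr Ωref Ω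
  refine ⟨2 * r.toNNReal * (eLpNorm (beta Ωref Ω) 4 (surf r)).toNNReal, fun Ψ ψ => ?_⟩
  have hm : AEStronglyMeasurable (betaIntegrand Ωref Ω Ψ ψ) (surf r) :=
    (hβ.1.mul (Lp.aestronglyMeasurable (lapH Ψ))).mul
      (Complex.continuous_conj.comp_aestronglyMeasurable (aestronglyMeasurable_dPhi ψ))
  have h := integrable_and_norm_integral_le (C := 2 * r.toNNReal) hm
    (Lp.aestronglyMeasurable (lapH Ψ)) hβ.1 (Lp.aestronglyMeasurable (gradH ψ))
    (a := ‖lapH Ψ‖₊) (by rw [← Lp.enorm_def, enorm_eq_nnnorm])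
    (ENNReal.coe_toNNReal hβ.eLpNorm_ne_top).symm (hn ψ).1 ?_
  · refine ⟨h.1, h.2.trans (le_of_eq ?_)⟩
    push_cast
    ring
  · filter_upwards [norm_dPhi_le hr ψ] with x hx
    unfold betaIntegrand
    rw [norm_mul, norm_mul, RCLike.norm_conj]
    refine (mul_le_mul_of_nonneg_left hx (by positivity)).trans (le_of_eq ?_)
    push_cast
    rw [Real.coe_toNNReal _ hr.le]
    ring

theorem gradH_add (Ψ Φ : Hd2 r) : ∀ᵐ x ∂(surf r), gradH (Ψ + Φ) x = gradH Ψ x + gradH Φ x :=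
  Lp.coeFn_add (gradH Ψ) (gradH Φ)

theorem gradH_smul (c : ℂ) (Ψ : Hd2 r) : ∀ᵐ x ∂(surf r), gradH (c • Ψ) x = c • gradH Ψ x :=
  Lp.coeFn_smul c (gradH Ψ)

theorem lapH_add (Ψ Φ : Hd2 r) : ∀ᵐ x ∂(surf r), lapH (Ψ + Φ) x = lapH Ψ x + lapH Φ x :=
  Lp.coeFn_add (lapH Ψ) (lapH Φ)

theorem lapH_smul (c : ℂ) (Ψ : Hd2 r) : ∀ᵐ x ∂(surf r), lapH (c • Ψ) x = c • lapH Ψ x :=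
  Lp.coeFn_smul c (lapH Ψ)

/-- Stated at a point, for an arbitrary χ whose gradient is the sum there, because the weak gradient
is additive only almost everywhere. -/
theorem vCurl_of_add {ψ φ χ : Hd2 r} {x : E3} (h : gradH χ x = gradH ψ x + gradH φ x) (i : Fin 3) :
    vCurl χ x i = vCurl ψ x i + vCurl φ x i := by
  unfold vCurl
  rw [h]
  fin_cases i <;> simp <;> ring

theorem vCurl_of_smul {ψ χ : Hd2 r} {x : E3} {c : ℂ} (h : gradH χ x = c • gradH ψ x) (i : Fin 3) :
    vCurl χ x i = c * vCurl ψ x i := by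
  unfold vCurl
  rw [h]
  fin_cases i <;> simp <;> ring

theorem dPhi_of_add {ψ φ χ : Hd2 r} {x : E3} (h : gradH χ x = gradH ψ x + gradH φ x) :
    dPhi χ x = dPhi ψ x + dPhi φ x := by
  unfold dPhi
  rw [h]
  simp only [PiLp.add_apply]
  ring

theorem dPhi_of_smul {ψ χ : Hd2 r} {x : E3} {c : ℂ} (h : gradH χ x = c • gradH ψ x) :
    dPhi χ x = c * dPhi ψ x := by
  unfold dPhi
  rw [h]
  simp only [PiLp.smul_apply, smul_eq_mul]
  ring

variable (γ Ωref : ℝ) (Ω : H1 r) (ω : ℂ)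

/-- Additivity of the integrals requires absolute convergence of each term, hence the Hölder bounds;
compatibility with scalars does not. -/
theorem formA_add_left (hr : 0 < r) (Ψ Φ ψ : Hd2 r) :
    formA γ Ωref Ω ω (Ψ + Φ) ψ = formA γ Ωref Ω ω Ψ ψ + formA γ Ωref Ω ω Φ ψ := by
  obtain ⟨_, hα⟩ := exists_alpha_bound hr Ω
  obtain ⟨_, hβ⟩ := exists_beta_bound hr Ωref Ω
  have h1 : ∫ x, alphaIntegrand Ω (Ψ + Φ) ψ x ∂(surf r) =
      ∫ x, alphaIntegrand Ω Ψ ψ x ∂(surf r) + ∫ x, alphaIntegrand Ω Φ ψ x ∂(surf r) := by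
    rw [← integral_add (hα Ψ ψ).1 (hα Φ ψ).1]
    refine integral_congr_ae ?_
    filter_upwards [gradH_add Ψ Φ] with x hx
    simp only [alphaIntegrand, hx, PiLp.add_apply, add_mul, Finset.sum_add_distrib, mul_add]
  have h2 : ∫ x, betaIntegrand Ωref Ω (Ψ + Φ) ψ x ∂(surf r) =
      ∫ x, betaIntegrand Ωref Ω Ψ ψ x ∂(surf r) + ∫ x, betaIntegrand Ωref Ω Φ ψ x ∂(surf r) := by
    rw [← integral_add (hβ Ψ ψ).1 (hβ Φ ψ).1]
    refine integral_congr_ae ?_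
    filter_upwards [lapH_add Ψ Φ] with x hx
    simp only [betaIntegrand, hx]
    ring
  unfold formA
  rw [h1, h2, show lapH (Ψ + Φ) = lapH Ψ + lapH Φ from rfl,
    show gradH (Ψ + Φ) = gradH Ψ + gradH Φ from rfl, inner_add_right, inner_add_right]
  ring

theorem formA_smul_left (c : ℂ) (Ψ ψ : Hd2 r) :
    formA γ Ωref Ω ω (c • Ψ) ψ = c * formA γ Ωref Ω ω Ψ ψ := by
  have h1 : ∫ x, alphaIntegrand Ω (c • Ψ) ψ x ∂(surf r) =
      c * ∫ x, alphaIntegrand Ω Ψ ψ x ∂(surf r) := by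
    rw [← integral_const_mul]
    refine integral_congr_ae ?_
    filter_upwards [gradH_smul c Ψ] with x hx
    simp only [alphaIntegrand, hx, PiLp.smul_apply, smul_eq_mul, mul_assoc, ← Finset.mul_sum]
    ring
  have h2 : ∫ x, betaIntegrand Ωref Ω (c • Ψ) ψ x ∂(surf r) =
      c * ∫ x, betaIntegrand Ωref Ω Ψ ψ x ∂(surf r) := by
    rw [← integral_const_mul]
    refine integral_congr_ae ?_
    filter_upwards [lapH_smul c Ψ] with x hx
    simp only [betaIntegrand, hx, smul_eq_mul]
    ring
  unfold formA
  rw [h1, h2, show lapH (c • Ψ) = c • lapH Ψ from rfl,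
    show gradH (c • Ψ) = c • gradH Ψ from rfl, inner_smul_right, inner_smul_right]
  ring

theorem formA_add_right (hr : 0 < r) (Ψ ψ φ : Hd2 r) :
    formA γ Ωref Ω ω Ψ (ψ + φ) = formA γ Ωref Ω ω Ψ ψ + formA γ Ωref Ω ω Ψ φ := by
  obtain ⟨_, hα⟩ := exists_alpha_bound hr Ω
  obtain ⟨_, hβ⟩ := exists_beta_bound hr Ωref Ω
  have h1 : ∫ x, alphaIntegrand Ω Ψ (ψ + φ) x ∂(surf r) =
      ∫ x, alphaIntegrand Ω Ψ ψ x ∂(surf r) + ∫ x, alphaIntegrand Ω Ψ φ x ∂(surf r) := by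
    rw [← integral_add (hα Ψ ψ).1 (hα Ψ φ).1]
    refine integral_congr_ae ?_
    filter_upwards [gradH_add ψ φ] with x hx
    simp only [alphaIntegrand, vCurl_of_add hx, map_add, mul_add, Finset.sum_add_distrib]
  have h2 : ∫ x, betaIntegrand Ωref Ω Ψ (ψ + φ) x ∂(surf r) =
      ∫ x, betaIntegrand Ωref Ω Ψ ψ x ∂(surf r) + ∫ x, betaIntegrand Ωref Ω Ψ φ x ∂(surf r) := by
    rw [← integral_add (hβ Ψ ψ).1 (hβ Ψ φ).1]
    refine integral_congr_ae ?_
    filter_upwards [gradH_add ψ φ] with x hx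
    simp only [betaIntegrand, dPhi_of_add hx, map_add, mul_add]
  unfold formA
  rw [h1, h2, show lapH (ψ + φ) = lapH ψ + lapH φ from rfl,
    show gradH (ψ + φ) = gradH ψ + gradH φ from rfl, inner_add_left, inner_add_left]
  ring

theorem formA_smul_right (c : ℂ) (Ψ ψ : Hd2 r) :
    formA γ Ωref Ω ω Ψ (c • ψ) = conj c * formA γ Ωref Ω ω Ψ ψ := by
  have h1 : ∫ x, alphaIntegrand Ω Ψ (c • ψ) x ∂(surf r) =
      conj c * ∫ x, alphaIntegrand Ω Ψ ψ x ∂(surf r) := by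
    rw [← integral_const_mul]
    refine integral_congr_ae ?_
    filter_upwards [gradH_smul c ψ] with x hx
    simp only [alphaIntegrand, vCurl_of_smul hx, map_mul, Finset.mul_sum]
    exact Finset.sum_congr rfl fun i _ => by ring
  have h2 : ∫ x, betaIntegrand Ωref Ω Ψ (c • ψ) x ∂(surf r) =
      conj c * ∫ x, betaIntegrand Ωref Ω Ψ ψ x ∂(surf r) := by
    rw [← integral_const_mul]
    refine integral_congr_ae ?_
    filter_upwards [gradH_smul c ψ] with x hx
    simp only [betaIntegrand, dPhi_of_smul hx, map_mul]
    ring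
  unfold formA
  rw [h1, h2, show lapH (c • ψ) = c • lapH ψ from rfl,
    show gradH (c • ψ) = c • gradH ψ from rfl, inner_smul_left, inner_smul_left]
  ring

end Form

/-! ### Boundedness of the operator and the Gårding inequality -/

section Operator

variable {r : ℝ}

/-- Young's inequality for n² ≤ (K d h³)^(1/2), put in a form free of fractional powers. It absorbs
the squared L⁴ norm of the gradient into ε‖Ψ‖² plus a multiple of ‖∇Ψ‖₂². -/
theorem sq_le_of_pow_four_le {K ε : ℝ} (hε : 0 < ε) {n d h : ℝ}
    (hn : n ^ 4 ≤ K * d * h ^ 3) : n ^ 2 ≤ ε * h ^ 2 + K ^ 2 / ε ^ 3 * d ^ 2 := by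
  -- The substitution removes the high power of ε; the claim is then checked after squaring both
  -- sides.
  obtain ⟨k, rfl⟩ : ∃ k, K = ε * k := ⟨K / ε, by field_simp⟩
  have hM : (ε * k) ^ 2 / ε ^ 3 = k ^ 2 / ε := by field_simp
  rw [hM]
  refine (pow_le_pow_iff_left₀ (by positivity) (by positivity) two_ne_zero).1 ?_
  calc (n ^ 2) ^ 2 = n ^ 4 := by ring
    _ ≤ ε * k * d * h ^ 3 := hn
    _ ≤ h ^ 2 * (ε ^ 2 * h ^ 2 + 2 * (k * d) ^ 2) + (k ^ 2 / ε * d ^ 2) ^ 2 := by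
        have h1 : ε * k * d * h ≤ ε ^ 2 * h ^ 2 + 2 * (k * d) ^ 2 := by
          nlinarith [sq_nonneg (ε * h - k * d), sq_nonneg (ε * h), sq_nonneg (k * d)]
        nlinarith [mul_le_mul_of_nonneg_left h1 (sq_nonneg h), sq_nonneg (k ^ 2 / ε * d ^ 2)]
    _ = _ := by field_simp; ring

theorem norm_gradH_le (Ψ : Hd2 r) : ‖gradH Ψ‖ ≤ ‖Ψ‖ := by
  have h := norm_sq_jet2 (Ψ : Jet2 r)
  refine (pow_le_pow_iff_left₀ (norm_nonneg _) (norm_nonneg _) two_ne_zero).1 ?_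
  change ‖(Ψ : Jet2 r).snd.fst‖ ^ 2 ≤ ‖(Ψ : Jet2 r)‖ ^ 2
  nlinarith [sq_nonneg ‖(Ψ : Jet2 r).fst‖, sq_nonneg ‖(Ψ : Jet2 r).snd.snd‖]

theorem norm_lapH_le (Ψ : Hd2 r) : ‖lapH Ψ‖ ≤ ‖Ψ‖ := by
  have h := norm_sq_jet2 (Ψ : Jet2 r)
  refine (pow_le_pow_iff_left₀ (norm_nonneg _) (norm_nonneg _) two_ne_zero).1 ?_
  change ‖(Ψ : Jet2 r).snd.snd‖ ^ 2 ≤ ‖(Ψ : Jet2 r)‖ ^ 2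
  nlinarith [sq_nonneg ‖(Ψ : Jet2 r).fst‖, sq_nonneg ‖(Ψ : Jet2 r).snd.fst‖]

theorem exists_gradNorm4_le (hr : 0 < r) : ∃ K : ℝ, 0 ≤ K ∧ ∀ Ψ : Hd2 r,
    gradNorm4 Ψ ≤ K * ‖Ψ‖ := by
  obtain ⟨K, hK⟩ := exists_gradNorm4_pow_le hr
  refine ⟨K + 1, by positivity, fun Ψ => ?_⟩
  refine (pow_le_pow_iff_left₀ (NNReal.coe_nonneg _) (by positivity) four_ne_zero).1 ?_
  have h1 : (K : ℝ) ≤ (K + 1) ^ 4 := by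
    have := one_le_pow₀ (n := 3) (show (1 : ℝ) ≤ K + 1 by simp)
    nlinarith [NNReal.coe_nonneg K]
  calc _ ≤ K * ‖gradH Ψ‖ * ‖Ψ‖ ^ 3 := (hK Ψ).2
    _ ≤ (K + 1) ^ 4 * ‖Ψ‖ * ‖Ψ‖ ^ 3 := by gcongr; exact norm_gradH_le Ψ
    _ = _ := by ring

theorem exists_norm_formA_le (hr : 0 < r) (γ Ωref : ℝ) (Ω : H1 r) (ω : ℂ) :
    ∃ C : ℝ, ∀ Ψ ψ : Hd2 r, ‖formA γ Ωref Ω ω Ψ ψ‖ ≤ C * ‖Ψ‖ * ‖ψ‖ := by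
  obtain ⟨K, hK0, hK⟩ := exists_gradNorm4_le hr
  obtain ⟨Ka, hα⟩ := exists_alpha_bound hr Ω
  obtain ⟨Kb, hβ⟩ := exists_beta_bound hr Ωref Ω
  refine ⟨|γ| + ‖ω‖ + Ka * K ^ 2 + Kb * K, fun Ψ ψ => ?_⟩
  have h1 : ‖(γ : ℂ) * inner ℂ (lapH ψ) (lapH Ψ)‖ ≤ |γ| * (‖ψ‖ * ‖Ψ‖) := by
    rw [norm_mul, Complex.norm_real, Real.norm_eq_abs]
    gcongr
    exact (norm_inner_le_norm _ _).trans (by gcongr <;> exact norm_lapH_le _)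
  have h2 : ‖Complex.I * ω * inner ℂ (gradH ψ) (gradH Ψ)‖ ≤ ‖ω‖ * (‖ψ‖ * ‖Ψ‖) := by
    rw [norm_mul, norm_mul, Complex.norm_I, one_mul]
    gcongr
    exact (norm_inner_le_norm _ _).trans (by gcongr <;> exact norm_gradH_le _)
  have h3 : ‖∫ x, alphaIntegrand Ω Ψ ψ x ∂(surf r)‖ ≤ Ka * (K * ‖Ψ‖ * (K * ‖ψ‖)) :=
    (hα Ψ ψ).2.trans (by gcongr <;> exact hK _)
  have h4 : ‖∫ x, betaIntegrand Ωref Ω Ψ ψ x ∂(surf r)‖ ≤ Kb * (‖Ψ‖ * (K * ‖ψ‖)) :=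
    (hβ Ψ ψ).2.trans (by gcongr; exacts [norm_lapH_le _, hK _])
  calc _ ≤ |γ| * (‖ψ‖ * ‖Ψ‖) + ‖ω‖ * (‖ψ‖ * ‖Ψ‖) + Ka * (K * ‖Ψ‖ * (K * ‖ψ‖))
        + Kb * (‖Ψ‖ * (K * ‖ψ‖)) :=
        (norm_add_le _ _).trans (add_le_add ((norm_add_le _ _).trans
          (add_le_add ((norm_sub_le _ _).trans (add_le_add h1 h2)) h3)) h4)
    _ = _ := by ring

theorem exists_isInertialWaveOperator (hr : 0 < r) (γ Ωref : ℝ) (Ω : H1 r) (ω : ℂ) :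
    ∃ B : Hd2 r →L[ℂ] Hdm2 r, IsInertialWaveOperator γ Ωref Ω ω B := by
  obtain ⟨C, hC⟩ := exists_norm_formA_le hr γ Ωref Ω ω
  obtain ⟨_, hα⟩ := exists_alpha_bound hr Ω
  obtain ⟨_, hβ⟩ := exists_beta_bound hr Ωref Ω
  refine ⟨LinearMap.mkContinuous₂ (LinearMap.mk₂'ₛₗ (RingHom.id ℂ) (starRingEnd ℂ)
    (formA γ Ωref Ω ω) (formA_add_left γ Ωref Ω ω hr) (formA_smul_left γ Ωref Ω ω)
    (formA_add_right γ Ωref Ω ω hr) (formA_smul_right γ Ωref Ω ω)) C hC, fun Ψ ψ => ?_⟩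
  exact ⟨(hα Ψ ψ).1, (hβ Ψ ψ).1, rfl⟩

/-- The Poincaré inequality turns γ‖ΔΨ‖² into γ‖Ψ‖² minus a multiple of ‖∇Ψ‖². The α̃ and β terms
are bounded through the L⁴ norm of the gradient and absorbed. -/
theorem exists_garding (hr : 0 < r) {γ : ℝ} (hγ : 0 < γ) (Ωref : ℝ) (Ω : H1 r) :
    ∃ c μ : ℝ, 0 < c ∧ ∀ Ψ : Hd2 r,
      c * ‖Ψ‖ ^ 2 ≤ (formA γ Ωref Ω 0 Ψ Ψ).re + μ * ‖gradH Ψ‖ ^ 2 := by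
  obtain ⟨K, hK⟩ := exists_gradNorm4_pow_le hr
  obtain ⟨Ka, hα⟩ := exists_alpha_bound hr Ω
  obtain ⟨Kb, hβ⟩ := exists_beta_bound hr Ωref Ω
  obtain ⟨Cp, _, hP⟩ := exists_norm_fst_le hr
  -- L collects the coefficients of ‖∇Ψ‖₄² from the α̃ term and from Young's inequality for the β
  -- term; the 1 keeps it positive so that ε can be defined by Lε = γ/8.
  set L : ℝ := Ka + 2 * Kb ^ 2 / γ + 1 with hL
  have hL0 : 0 < L := by positivity
  set ε : ℝ := γ / 8 / L with hε
  have hε0 : 0 < ε := by positivity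
  have hLε : L * ε = γ / 8 := mul_div_cancel₀ _ hL0.ne'
  set M : ℝ := K ^ 2 / ε ^ 3 with hM
  -- Two losses of γ/8, from the β term and from absorbing ‖∇Ψ‖₄², leave γ - γ/4. The first part of
  -- μ pays for Poincaré, the second for the absorption.
  refine ⟨3 * γ / 4, γ * (1 + Cp) + L * M, by positivity, fun Ψ => ?_⟩
  have hn := sq_le_of_pow_four_le hε0 (hK Ψ).2
  have h1 := (Complex.abs_re_le_norm _).trans (hα Ψ Ψ).2
  have h2 := (Complex.abs_re_le_norm _).trans (hβ Ψ Ψ).2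
  have h3 := hP Ψ Ψ.2
  have h4 := norm_sq_jet2 (Ψ : Jet2 r)
  have h5 := norm_lapH_le Ψ
  have hre : (formA γ Ωref Ω 0 Ψ Ψ).re = γ * ‖lapH Ψ‖ ^ 2
      + (∫ x, alphaIntegrand Ω Ψ Ψ x ∂(surf r)).re
      + (∫ x, betaIntegrand Ωref Ω Ψ Ψ x ∂(surf r)).re := by
    unfold formA
    rw [inner_self_eq_norm_sq_to_K]
    simp [← Complex.ofReal_pow, ← Complex.ofReal_mul]
  rw [hre]
  change ‖Ψ‖ ^ 2 = _ + (‖gradH Ψ‖ ^ 2 + ‖lapH Ψ‖ ^ 2) at h4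
  change _ ≤ Cp * ‖gradH Ψ‖ ^ 2 at h3
  have h6 : Kb * (‖lapH Ψ‖ * gradNorm4 Ψ) ≤
      γ / 8 * ‖Ψ‖ ^ 2 + 2 * Kb ^ 2 / γ * (gradNorm4 Ψ : ℝ) ^ 2 := by
    have h7 : Kb * (‖lapH Ψ‖ * gradNorm4 Ψ) ≤ Kb * (‖Ψ‖ * gradNorm4 Ψ) := by gcongr
    -- Completing the square with weight γ/8 produces the coefficient 2Kb²/γ of ‖∇Ψ‖₄².
    have h8 : 0 ≤ γ / 8 * (‖Ψ‖ - 4 * Kb / γ * gradNorm4 Ψ) ^ 2 := by positivity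
    refine h7.trans (sub_nonneg.1 (h8.trans (le_of_eq ?_)))
    field_simp
    ring
  have h9 : L * (gradNorm4 Ψ : ℝ) ^ 2 ≤ γ / 8 * ‖Ψ‖ ^ 2 + L * M * ‖gradH Ψ‖ ^ 2 := by
    refine (mul_le_mul_of_nonneg_left hn hL0.le).trans (le_of_eq ?_)
    rw [← hM, ← hLε]
    ring
  have h10 := (abs_le.1 h1).1
  have h11 := (abs_le.1 h2).1
  have h12 := sq_nonneg (gradNorm4 Ψ : ℝ)
  have h13 : γ * ‖lapH Ψ‖ ^ 2 ≥ γ * (‖Ψ‖ ^ 2 - (1 + Cp) * ‖gradH Ψ‖ ^ 2) := by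
    gcongr
    linarith
  linear_combination h13 + h10 + h11 + h6 + h9 + h12 + (gradNorm4 Ψ : ℝ) ^ 2 * hL

/-- `exists_discrete_spectrum` on a complete subspace. -/
theorem exists_discrete_spectrum_submodule {W X : Type*} [NormedAddCommGroup W] [InnerProductSpace ℂ W]
    [NormedAddCommGroup X] [InnerProductSpace ℂ X]
    (S : Submodule ℂ W) [CompleteSpace S] [CompleteSpace X]
    (A : S →L[ℂ] S →L⋆[ℂ] ℂ) (G : S →L[ℂ] X) (hG : IsCompactOperator G) {c μ : ℝ} (hc : 0 < c)
    (hA : ∀ v, c * ‖v‖ ^ 2 ≤ (A v v).re + μ * ‖G v‖ ^ 2)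
    (B : ℂ → S →L[ℂ] S →L⋆[ℂ] ℂ)
    (hB : ∀ ω v w, B ω v w = A v w - Complex.I * ω * inner ℂ (G w) (G v)) :
    ∃ Λ : Set ℂ, IsDiscrete Λ ∧ (∀ z : ℂ, ¬ AccPt z (Filter.principal Λ)) ∧
        (∀ ω : ℂ, ω ∉ Λ → (B ω).IsInvertible) ∧
        (∀ ω ∈ Λ, FiniteDimensional ℂ ((B ω).ker) ∧ (B ω).ker ≠ ⊥) :=
  exists_discrete_spectrum A G hG hc hA B hB

end Operator

end InertialWaves

end

/-! ### Conclusion: the spectral alternative for the inertial wave operator -/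

theorem corollary3p4 (r γ Ωref : ℝ) (hr : 0 < r) (hγ : 0 < γ)
    (Ω : InertialWaves.H1 r) (hΩ : InertialWaves.IsAxisymmetric Ω) :
    ∃ B : ℂ → (InertialWaves.Hd2 r →L[ℂ] InertialWaves.Hdm2 r),
      (∀ ω : ℂ, InertialWaves.IsInertialWaveOperator γ Ωref Ω ω (B ω)) ∧
      ∃ Λ : Set ℂ, IsDiscrete Λ ∧ (∀ z : ℂ, ¬ AccPt z (Filter.principal Λ)) ∧
        (∀ ω : ℂ, ω ∉ Λ → (B ω).IsInvertible) ∧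
        (∀ ω ∈ Λ, FiniteDimensional ℂ ((B ω).ker) ∧ (B ω).ker ≠ ⊥) := by
  choose B hB using InertialWaves.exists_isInertialWaveOperator hr γ Ωref Ω
  obtain ⟨c, μ, hc, hμ⟩ := InertialWaves.exists_garding hr hγ Ωref Ω
  refine ⟨B, hB, ?_⟩
  have hA : ∀ Ψ : InertialWaves.Hd2 r,
      c * ‖Ψ‖ ^ 2 ≤ (B 0 Ψ Ψ).re + μ * ‖InertialWaves.gradL Ψ‖ ^ 2 := fun Ψ => by
    rw [(hB 0 Ψ Ψ).2.2]
    exact hμ Ψ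
  -- The frequency enters the form only through -iω⟨∇Ψ, ∇ψ⟩, so B_0 plays the role of A and ∇_h that
  -- of G.
  have hBA : ∀ (ω : ℂ) (Ψ ψ : InertialWaves.Hd2 r), B ω Ψ ψ = B 0 Ψ ψ -
      Complex.I * ω * inner ℂ (InertialWaves.gradL ψ) (InertialWaves.gradL Ψ) := fun ω Ψ ψ => by
    rw [(hB ω Ψ ψ).2.2, (hB 0 Ψ ψ).2.2]
    simp only [InertialWaves.formA, InertialWaves.gradL_apply]
    ring
  have hG := InertialWaves.isCompactOperator_gradL hr
  exact InertialWaves.exists_discrete_spectrum_submodule (InertialWaves.Hd2 r) (B 0) InertialWaves.gradL hG hc hA B hBA
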